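/- Let $\nu,L,h,H>0$ and let $B\subset\mathbb R^2$ be a bounded domain with smooth boundary $S$ and $\overline B\subset\{x_2>0\}$, such that $B\subset\{x:\ |x_1|<L,\ x_2>h\}$ and $B\subset\{x_2<H\}$. Put $\Omega=\{x_2>0\}\setminus\overline B$, $\Gamma=\{x_2=0\}$, and let $n$ be the unit normal exterior to $\Omega$. Let $\chi\in C^\infty(\mathbb R)$ be real-valued with $\chi(t)=0$ for $t<1$ and $\chi(t)=1$ for $t>3$, let $\gamma_1^2=(L+\nu^{-1}+H)^{-1}$ and $$U^{\pm}(x)=\chi(\pm x_1\gamma_1^2)\,e^{\mp i\nu x_1-\nu x_2}.$$ Let $f\in C_0^\infty(\Omega)$, $g_1\in C^\infty(S)$, $g_2\in C_0^\infty(\Gamma)$ and $d^\pm\in\mathbb C$ (all functions may be complex-valued), and $f_1=f+\Delta(d^+U^++d^-U^-)$. Let $v$ be smooth on $\overline\Omega$ with $$-\Delta v=f_1\ \text{in }\Omega,\qquad \partial_n v=g_1\ \text{on }S,\qquad \partial_n v-\nu v=g_2\ \text{on }\Gamma,$$ and suppose that $v$ has finite energy: $\nabla v\in L_2(\Omega)$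 and $v|_\Gamma\in L_2(\Gamma)$. Let $r=|x|$, let $\|\cdot\|_\Omega$, $\|\cdot\|_\Gamma$ be $L_2$ norms, and $$J=\mathrm{Re}\Big(\int_\Omega f_1\overline v\,dx+\int_S g_1\overline v\,dS+\int_\Gamma g_2\overline v\,dx_1\Big).$$ Then the integrals in $J$ converge, $rf_1\in L_2(\Omega)$, $rg_2\in L_2(\Gamma)$, and $$\|\nabla v\|_\Omega^2\le 4J+18\left(\|rf_1\|_\Omega^2+\nu\|rg_2\|_\Gamma^2\right)+(C_7-3)\|v_{x_1}\|_\Omega^2,\qquad C_7=72\,\frac{\nu L^2}{h}(1+\nu h)^3 .$$ The same inequality holds with $f_1,g_1,g_2,v$ replaced by their real parts. -/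

import Mathlib

open MeasureTheory Set
open scoped ContDiff InnerProductSpace Laplacian

noncomputable section

namespace WaterWaves

/-- The plane with its Euclidean norm; `x 0` and `x 1` are the coordinates `x₁` and `x₂`.
The `x₂`-axis points into the water. -/
abbrev Plane := EuclideanSpace ℝ (Fin 2)

/-- The partial derivative of `v` in the `i`-th coordinate direction. -/
def pd (i : Fin 2) (v : Plane → ℂ) (x : Plane) : ℂ :=
  fderiv ℝ v x (EuclideanSpace.single i 1)

/-- The point `(t, 0)` of the water surface `Γ = {x₂ = 0}`. -/
def surf (t : ℝ) : Plane := !₂[t, 0]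

/-- `ρ` is a smooth local defining function of `B` at `p`: near `p`, `B = {ρ < 0}`, and
`∇ρ(p) ≠ 0`.  (Only the germ of `ρ` at `p` matters, so asking for global smoothness is no
restriction.) -/
def IsDefiningAt (B : Set Plane) (p : Plane) (ρ : Plane → ℝ) : Prop :=
  ContDiff ℝ ∞ ρ ∧ gradient ρ p ≠ 0 ∧ ∀ᶠ x in nhds p, (x ∈ B ↔ ρ x < 0)

/-- A submerged body: a bounded domain with smooth boundary whose closure lies in the open
half-plane `x₂ > 0`. -/
structure IsSubmergedBody (B : Set Plane) : Prop where
  isOpen : IsOpen B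
  isConnected : IsConnected B
  isBounded : Bornology.IsBounded B
  closure_subset : closure B ⊆ {x | 0 < x 1}
  smooth_boundary : ∀ p ∈ frontier B, ∃ ρ, IsDefiningAt B p ρ

/-- The water domain `Ω`: the half-plane `x₂ > 0` without the closed body. -/
def water (B : Set Plane) : Set Plane := {x | 0 < x 1} \ closure B

/-- `n` is the unit normal at the point `p` of `S = ∂B` that is exterior to the water domain,
i.e. that points into `B` (`B = {ρ < 0}` near `p`, so `n = -∇ρ(p)/|∇ρ(p)|`). -/
def IsWaterNormal (B : Set Plane) (p n : Plane) : Prop :=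
  ∃ ρ, IsDefiningAt B p ρ ∧ n = -(‖gradient ρ p‖⁻¹ • gradient ρ p)

/-- `χ` is a smooth cut-off function on the line, `χ = 0` on `t < 1` and `χ = 1` on `t > 3`. -/
def IsCutoff (χ : ℝ → ℝ) : Prop :=
  ContDiff ℝ ∞ χ ∧ (∀ t < 1, χ t = 0) ∧ ∀ t > 3, χ t = 1

/-- `γ₁² = (L + ν⁻¹ + H)⁻¹`. -/
def gammaOneSq (ν L H : ℝ) : ℝ := (L + ν⁻¹ + H)⁻¹

/-- `U⁺(x) = χ(γ₁² x₁) exp(-iνx₁ - νx₂)`. -/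
def Uplus (χ : ℝ → ℝ) (ν L H : ℝ) (x : Plane) : ℂ :=
  (χ (x 0 * gammaOneSq ν L H) : ℂ) * Complex.exp (-Complex.I * ν * x 0 - ν * x 1)

/-- `U⁻(x) = χ(-γ₁² x₁) exp(iνx₁ - νx₂)`. -/
def Uminus (χ : ℝ → ℝ) (ν L H : ℝ) (x : Plane) : ℂ :=
  (χ (-x 0 * gammaOneSq ν L H) : ℂ) * Complex.exp (Complex.I * ν * x 0 - ν * x 1)

/-- The right-hand side `f₁ = f + Δ(d⁺U⁺ + d⁻U⁻)` of the equation for the remainder `v`. -/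
def fOne (χ : ℝ → ℝ) (ν L H : ℝ) (dp dm : ℂ) (f : Plane → ℂ) (x : Plane) : ℂ :=
  f x + (Δ (fun y : Plane => dp * Uplus χ ν L H y + dm * Uminus χ ν L H y)) x

/-- The data `f ∈ C₀^∞(Ω)`, `g₁ ∈ C^∞(S)`, `g₂ ∈ C₀^∞(Γ)`.  A smooth function on the compact
smooth curve `S` is the restriction of a smooth function on the plane; `Γ` is identified
with `ℝ`. -/
structure IsData (B : Set Plane) (f g₁ : Plane → ℂ) (g₂ : ℝ → ℂ) : Prop where
  f_smooth : ContDiff ℝ ∞ f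
  f_compact : HasCompactSupport f
  f_support : tsupport f ⊆ water B
  g₁_smooth : ContDiff ℝ ∞ g₁
  g₂_smooth : ContDiff ℝ ∞ g₂
  g₂_compact : HasCompactSupport g₂

/-- `v`, smooth up to the boundary of the water domain, solves
`-Δv = f₁` in `Ω`, `∂ₙv = g₁` on `S`, `∂ₙv - νv = g₂` on `Γ`, where `n` is exterior to `Ω`
(so `∂ₙ = -∂/∂x₂` on `Γ`).  As usual, smooth on `closure Ω` means: the restriction of a smooth
function on the plane; only the values of `v` on `closure Ω` enter below. -/
structure IsSolution (B : Set Plane) (ν : ℝ) (f₁ g₁ : Plane → ℂ) (g₂ : ℝ → ℂ)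
    (v : Plane → ℂ) : Prop where
  smooth : ContDiff ℝ ∞ v
  eq_water : ∀ x ∈ water B, -(Δ v) x = f₁ x
  eq_body : ∀ p ∈ frontier B, ∀ n, IsWaterNormal B p n → fderiv ℝ v p n = g₁ p
  eq_surface : ∀ t : ℝ, -pd 1 v (surf t) - ν * v (surf t) = g₂ t

/-- `v` has finite energy: `∇v ∈ L₂(Ω)` and `v|_Γ ∈ L₂(Γ)`. -/
structure FiniteEnergy (B : Set Plane) (v : Plane → ℂ) : Prop where
  pd_memLp : ∀ i, MemLp (pd i v) 2 (volume.restrict (water B))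
  trace_memLp : MemLp (fun t : ℝ => v (surf t)) 2 volume

/-- All integrals in `J`, `‖r f₁‖_Ω` and `‖r g₂‖_Γ` converge. -/
structure IntegralsConverge (B : Set Plane) (f₁ g₁ : Plane → ℂ) (g₂ : ℝ → ℂ)
    (v : Plane → ℂ) : Prop where
  water : IntegrableOn (fun x => f₁ x * star (v x)) (water B)
  body : IntegrableOn (fun x => g₁ x * star (v x)) (frontier B) μH[1]
  surface : Integrable (fun t : ℝ => g₂ t * star (v (surf t)))
  weighted_water : MemLp (fun x => (‖x‖ : ℂ) * f₁ x) 2 (volume.restrict (WaterWaves.water B))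
  weighted_surface : MemLp (fun t : ℝ => (‖surf t‖ : ℂ) * g₂ t) 2 volume

/-- `J = Re (∫_Ω f₁ v̄ dx + ∫_S g₁ v̄ dS + ∫_Γ g₂ v̄ dx₁)`; for real-valued functions
this is `∫_Ω f₁ v dx + ∫_S g₁ v dS + ∫_Γ g₂ v dx₁`. Arc length `dS` on `S = ∂B` is
one-dimensional Hausdorff measure. -/
def J (B : Set Plane) (f₁ g₁ : Plane → ℂ) (g₂ : ℝ → ℂ) (v : Plane → ℂ) : ℝ :=
  ((∫ x in water B, f₁ x * star (v x)) + (∫ x in frontier B, g₁ x * star (v x) ∂μH[1])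
    + ∫ t : ℝ, g₂ t * star (v (surf t))).re

/-- `‖w‖²_Ω`, the square of the `L₂` norm on the water domain. -/
def sqNormWater (B : Set Plane) (w : Plane → ℂ) : ℝ := ∫ x in water B, ‖w x‖ ^ 2

/-- `‖w‖²_Γ`, the square of the `L₂` norm on the surface. -/
def sqNormSurface (w : ℝ → ℂ) : ℝ := ∫ t : ℝ, ‖w t‖ ^ 2

/-- The estimate
`‖∇v‖²_Ω ≤ 4J + 18(‖r f₁‖²_Ω + ν‖r g₂‖²_Γ) + (C - 3)‖v_{x₁}‖²_Ω`, with `r = |x|`. -/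
def GradientEstimate (B : Set Plane) (ν C : ℝ) (f₁ g₁ : Plane → ℂ) (g₂ : ℝ → ℂ)
    (v : Plane → ℂ) : Prop :=
  sqNormWater B (pd 0 v) + sqNormWater B (pd 1 v) ≤
    4 * J B f₁ g₁ g₂ v
      + 18 * (sqNormWater B (fun x => (‖x‖ : ℂ) * f₁ x)
          + ν * sqNormSurface (fun t => (‖surf t‖ : ℂ) * g₂ t))
      + (C - 3) * sqNormWater B (pd 0 v)

/-- The real part of a function, as a complex-valued function. -/
def rePart {α : Type*} (w : α → ℂ) (x : α) : ℂ := ((w x).re : ℂ)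

end WaterWaves

end

open WaterWaves

namespace WaterWaves

/-! ### A weighted one-dimensional inequality -/

/-! Let `u` be the real or imaginary part of `v`, with coordinates `(x, y)`. Green's formula with
multiplier `u` gives the energy identity `‖∇u‖² = J + ν‖u‖²_Γ`. Taking it four times and subtracting
`3‖∇u‖²` reduces the estimate to a trace inequality for an arbitrary smooth `u` of finite energy,
with no condition on `S`: `4ν‖u‖²_Γ ≤ 3‖u_y‖² + 18(‖rΔu‖² + ν‖x(u_y + νu)‖²_Γ) + C₇‖u_x‖²`. Summing
over real and imaginary parts gives the complex statement.

By reflection and scaling the trace inequality is needed only for `x > 0` and `ν = 1`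
(`quarter_plane_inequality`). Columns with `x > L` miss the body. There `w(x) = ∫ e^{-y} u dy`
satisfies `w'' + w = ∫ e^{-y} Δu dy + (u_y + u)(x, 0)`, whence `(w'' + w)² ≤ 3/2 (∫ (Δu)² dy + (u_y
+ u)²)` (`residual_sq_le`), and `4u(x,0)² ≤ 3∫ u_y² dy + 12w²`. The term `12∫ w²` is removed by
`one_dimensional_inequality`, a bound of `∫ w²` by `∫ (x²(w'' + w)² + c w'²)` with `c` proportional
to `L²`, which leaves the surplus `(1 + κ) L w(L)²`. The factor 18 is `12 · 3/2`, and the `w'²` term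
is paid for by `u_x`.

For `0 < x < L` only the strip above the body is available, and only its part of depth `s = min h
(2/5)` is used. The trace is bounded there by the mean `P(x)` of `u` over `[0, s]`, which is
transported to `x = L` at the expense of `u_x` (`inner_strip_inequality`). The price is a multiple
of `L P(L)²`. It is paid by the surplus in `w(L)²` together with a multiple of `L (P - (3 - 4i) w)²`
at `x = L`, where `i = expDefect s`; the latter is gained by comparing `P` with `w` in the outer
columns (`outer_strip_inequality`).

Most of the integral inequalities are proved by the lemma below: to bound `∫ φ` from below, exhibit
`g` with known boundary values such that `φ - g'` is visibly nonnegative, usually a sum of squares.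

Fields of finite energy are reached by a cutoff at scale `R`. Hardy's inequality on vertical lines
places `u/(1+y)` in `L₂` away from the body, and this dominates the commutator terms; the weight `r`
in `rΔu` exactly balances the factor `1/R`. Green's formula with Hausdorff measure on `S` is derived
from local graphs (`integral_divergence_body`). The weighted norm of `f₁` is finite because the
waves `U^±` are harmonic for large `|x|`, so that `Δ(d⁺U⁺ + d⁻U⁻) = k(x) e^{-νy}` with `k` of
compact support. -/

theorem sub_le_integral_of_deriv_le {a b : ℝ} (hab : a ≤ b) {g g' φ : ℝ → ℝ}
    (hg : ∀ x ∈ Icc a b, HasDerivAt g (g' x) x) (hφ : ContinuousOn φ (Icc a b))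
    (hle : ∀ x ∈ Icc a b, g' x ≤ φ x) : g b - g a ≤ ∫ x in a..b, φ x := by
  refine intervalIntegral.sub_le_integral_of_hasDeriv_right_of_le hab
    (fun x hx => (hg x hx).continuousAt.continuousWithinAt)
    (fun x hx => (hg x (Ioo_subset_Icc_self hx)).hasDerivWithinAt)
    (hφ.integrableOn_compact isCompact_Icc)
    (fun x hx => hle x (Ioo_subset_Icc_self hx))

/-- The quadratic density `x²(w'' + w)² - w² + c w'²`. -/
noncomputable def density (c : ℝ) (w w1 w2 : ℝ → ℝ) (x : ℝ) : ℝ :=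
  x ^ 2 * (w2 x + w x) ^ 2 - w x ^ 2 + c * w1 x ^ 2

section

variable {w w1 w2 : ℝ → ℝ} (h1 : ∀ x, HasDerivAt w (w1 x) x)
  (h2 : ∀ x, HasDerivAt w1 (w2 x) x) (h2c : Continuous w2)

include h1 h2 h2c

theorem continuous_density (c : ℝ) : Continuous (density c w w1 w2) := by
  have c0 : Continuous w := continuous_iff_continuousAt.2 fun x => (h1 x).continuousAt
  have c1 : Continuous w1 := continuous_iff_continuousAt.2 fun x => (h2 x).continuousAt
  unfold density
  fun_prop

/-- The multiplier `μ x w'`. -/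
theorem integral_density_ge_multiplier {c μ L X : ℝ} (hμ : 1 ≤ μ) (hc : μ ^ 2 - μ ≤ c)
    (hLX : L ≤ X) (hX : w X = 0) (hX1 : w1 X = 0) :
    μ * (L * (w L ^ 2 + w1 L ^ 2)) ≤ ∫ x in L..X, density c w w1 w2 x := by
  have := sub_le_integral_of_deriv_le hLX (g := fun x => -(μ * (x * (w x ^ 2 + w1 x ^ 2))))
    (g' := fun x => -(μ * ((w x ^ 2 + w1 x ^ 2) + x * (2 * w x * w1 x + 2 * w1 x * w2 x))))
    (φ := density c w w1 w2) ?_ (continuous_density h1 h2 h2c c).continuousOn ?_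
  · simpa [hX, hX1] using this
  · intro x _
    have := ((hasDerivAt_id x).mul (((h1 x).pow 2).add ((h2 x).pow 2))).const_mul μ |>.neg
    refine this.congr_deriv ?_
    simp
  · intro x _
    unfold density
    -- The density minus `g'` equals `(x(w'' + w) + μw')² + (c + μ - μ²)w'² + (μ - 1)w²`.
    nlinarith [sq_nonneg (x * (w2 x + w x) + μ * w1 x),
      mul_nonneg (sub_nonneg.2 hc) (sq_nonneg (w1 x)),
      mul_nonneg (sub_nonneg.2 hμ) (sq_nonneg (w x))]

set_option maxHeartbeats 1000000 in
/-- The test function `1 - x²/R²` with `R = 7/2`. -/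
theorem integral_density_ge_test {c κ L X : ℝ} (hc : 0 < c) (hL : 0 < L) (hL' : L < 7 / 2)
    (hX' : 7 / 2 ≤ X) (hX : w X = 0) (hX1 : w1 X = 0)
    (hnum : κ * L * (187 / 100 + 1941 / 100 / c + L) ≤
      ((7 / 2) ^ 2 / 4 * (1 - L ^ 2 / (7 / 2) ^ 2) ^ 2) ^ 2) :
    (1 + κ) * (L * w L ^ 2) ≤ ∫ x in L..X, density c w w1 w2 x := by
  -- With `μ = 1` the density exceeds `-(x(w² + w'²))'` by `Z² + c w'²`, where `Z = (xw')' + xw`.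
  -- Testing `Z` with `ψ = 1 - x²/R²` and integrating by parts gives `∫ ψZ + ∫ Θw' = [ψxw' - Ψw]`,
  -- with `Ψ' = -xψ`, `Ψ(R) = 0` and `Θ = xψ' - Ψ`. Hence `2tψZ - t²ψ² ≤ Z²` and `2tΘw' - t²Θ²/c ≤
  -- cw'²` yield a lower bound in terms of `w(L)`.
  set Ψ : ℝ → ℝ := fun x => (7 / 2) ^ 2 / 4 * (1 - x ^ 2 / (7 / 2) ^ 2) ^ 2 with hΨ
  set ψ : ℝ → ℝ := fun x => 1 - x ^ 2 / (7 / 2) ^ 2 with hψ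
  set Θ : ℝ → ℝ := fun x => -2 * x ^ 2 / (7 / 2) ^ 2 - Ψ x with hΘ
  set Z : ℝ := 187 / 100 + 1941 / 100 / c + L with hZ
  have hZ0 : 0 < Z := by positivity
  -- The maximizer of `2tΨ(L)w(L) - t²Z`. In `Z`, the number 1.87 bounds `∫ ψ²` over `[0, R]`, 19.41
  -- bounds `∫ Θ²`, and `L` is the cost of absorbing the boundary term in `w'(L)`. `A` and `Bf` are
  -- antiderivatives of `ψ²` and `Θ²`.
  set t : ℝ := Ψ L * w L / Z with ht
  set A : ℝ → ℝ := fun x => x - 2 * x ^ 3 / 3 / (7 / 2) ^ 2 + x ^ 5 / 5 / (7 / 2) ^ 4 with hA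
  set Bf : ℝ → ℝ := fun x => (49 / 16) ^ 2 * x - 2 * (49 / 16) * (33 / 8) * (x ^ 3 / 3 / (7 / 2) ^ 2)
    + ((33 / 8) ^ 2 + 2 * (49 / 16) ^ 2) * (x ^ 5 / 5 / (7 / 2) ^ 4)
    - 2 * (49 / 16) * (33 / 8) * (x ^ 7 / 7 / (7 / 2) ^ 6) + (49 / 16) ^ 2 * (x ^ 9 / 9 / (7 / 2) ^ 8)
    with hBf
  have c0 : Continuous w := continuous_iff_continuousAt.2 fun x => (h1 x).continuousAt
  have c1 : Continuous w1 := continuous_iff_continuousAt.2 fun x => (h2 x).continuousAt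
  have hψd : ∀ x, HasDerivAt ψ (-(2 * x) / (7 / 2) ^ 2) x := by
    intro x
    have := (((hasDerivAt_id x).pow 2).div_const ((7 / 2 : ℝ) ^ 2)).const_sub 1
    refine this.congr_deriv ?_
    simp
    ring
  have hΨd : ∀ x, HasDerivAt Ψ (-(x * ψ x)) x := by
    intro x
    have := ((hψd x).pow 2).const_mul ((7 / 2 : ℝ) ^ 2 / 4)
    refine this.congr_deriv ?_
    simp
    ring
  have hAd : ∀ x, HasDerivAt A (ψ x ^ 2) x := by
    intro x
    have e1 := (((hasDerivAt_pow 3 x).const_mul 2).div_const 3).div_const ((7 / 2 : ℝ) ^ 2)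
    have e2 := ((hasDerivAt_pow 5 x).div_const 5).div_const ((7 / 2 : ℝ) ^ 4)
    refine (((hasDerivAt_id x).sub e1).add e2).congr_deriv ?_
    simp [hψ]
    ring
  have hBd : ∀ x, HasDerivAt Bf (Θ x ^ 2) x := by
    intro x
    have e0 := (hasDerivAt_id x).const_mul ((49 / 16 : ℝ) ^ 2)
    have e1 := (((hasDerivAt_pow 3 x).div_const 3).div_const ((7 / 2 : ℝ) ^ 2)).const_mul
      (2 * (49 / 16) * (33 / 8))
    have e2 := (((hasDerivAt_pow 5 x).div_const 5).div_const ((7 / 2 : ℝ) ^ 4)).const_mul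
      ((33 / 8) ^ 2 + 2 * (49 / 16) ^ 2)
    have e3 := (((hasDerivAt_pow 7 x).div_const 7).div_const ((7 / 2 : ℝ) ^ 6)).const_mul
      (2 * (49 / 16) * (33 / 8))
    have e4 := (((hasDerivAt_pow 9 x).div_const 9).div_const ((7 / 2 : ℝ) ^ 8)).const_mul
      ((49 / 16 : ℝ) ^ 2)
    refine ((((e0.sub e1).add e2).sub e3).add e4).congr_deriv ?_
    simp [hΘ, hΨ]
    ring
  have main := sub_le_integral_of_deriv_le hL'.le
    (g := fun x => -(x * (w x ^ 2 + w1 x ^ 2)) + 2 * t * (ψ x * (x * w1 x) - Ψ x * w x)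
      - t ^ 2 * (A x + Bf x / c))
    (g' := fun x => -((w x ^ 2 + w1 x ^ 2) + x * (2 * w x * w1 x + 2 * w1 x * w2 x))
      + 2 * t * ((-(2 * x) / (7 / 2) ^ 2) * (x * w1 x) + ψ x * (w1 x + x * w2 x)
        - (-(x * ψ x) * w x + Ψ x * w1 x)) - t ^ 2 * (ψ x ^ 2 + Θ x ^ 2 / c))
    (φ := density c w w1 w2) ?_ (continuous_density h1 h2 h2c c).continuousOn ?_
  rotate_left
  · intro x _
    have e1 := ((hasDerivAt_id x).mul (((h1 x).pow 2).add ((h2 x).pow 2))).neg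
    have e2 := (((hψd x).mul ((hasDerivAt_id x).mul (h2 x))).sub
      ((hΨd x).mul (h1 x))).const_mul (2 * t)
    have e3 := ((hAd x).add ((hBd x).div_const c)).const_mul (t ^ 2)
    refine ((e1.add e2).sub e3).congr_deriv ?_
    simp
  · intro x _
    have key : density c w w1 w2 x - (-((w x ^ 2 + w1 x ^ 2) +
        x * (2 * w x * w1 x + 2 * w1 x * w2 x))
      + 2 * t * ((-(2 * x) / (7 / 2) ^ 2) * (x * w1 x) + ψ x * (w1 x + x * w2 x)
        - (-(x * ψ x) * w x + Ψ x * w1 x)) - t ^ 2 * (ψ x ^ 2 + Θ x ^ 2 / c))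
      = (x * w2 x + w1 x + x * w x - t * ψ x) ^ 2 + c * (w1 x - t * Θ x / c) ^ 2 := by
      simp only [density, hΘ]
      field_simp
      ring
    have : 0 ≤ (x * w2 x + w1 x + x * w x - t * ψ x) ^ 2 + c * (w1 x - t * Θ x / c) ^ 2 := by
      positivity
    linarith
  -- Beyond `R` the multiplier with `μ = 1` returns exactly the boundary term `R(w² + w'²)` lost at
  -- `R`.
  have far := integral_density_ge_multiplier h1 h2 h2c (c := c) (μ := 1) le_rfl (by linarith) hX' hX hX1
  have hsplit : (∫ x in L..(7 / 2 : ℝ), density c w w1 w2 x) + ∫ x in (7 / 2 : ℝ)..X, density c w w1 w2 x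
      = ∫ x in L..X, density c w w1 w2 x :=
    intervalIntegral.integral_add_adjacent_intervals
      ((continuous_density h1 h2 h2c c).intervalIntegrable _ _)
      ((continuous_density h1 h2 h2c c).intervalIntegrable _ _)
  have hAL : 0 ≤ A L := by
    have : A L = L * (1 - 2 * (L ^ 2 / (7 / 2) ^ 2) / 3 + (L ^ 2 / (7 / 2) ^ 2) ^ 2 / 5) := by
      simp only [hA]; ring
    rw [this]
    have h : 0 ≤ 1 - 2 * (L ^ 2 / (7 / 2) ^ 2) / 3 + (L ^ 2 / (7 / 2) ^ 2) ^ 2 / 5 := by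
      nlinarith [sq_nonneg (L ^ 2 / (7 / 2) ^ 2 - 5 / 3)]
    positivity
  have hBL : 0 ≤ Bf L := by
    have m : MonotoneOn Bf (Icc 0 L) := by
      apply monotoneOn_of_deriv_nonneg (convex_Icc 0 L)
        (fun x _ => (hBd x).continuousAt.continuousWithinAt)
        (fun x _ => (hBd x).differentiableAt.differentiableWithinAt)
      intro x _
      rw [(hBd x).deriv]; positivity
    have := m (left_mem_Icc.2 hL.le) (right_mem_Icc.2 hL.le) hL.le
    simpa [hBf] using this
  have hAR : A (7 / 2) ≤ 187 / 100 := by simp only [hA]; norm_num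
  have hBR : Bf (7 / 2) ≤ 1941 / 100 := by simp only [hBf]; norm_num
  have hψR : ψ (7 / 2) = 0 := by simp only [hψ]; norm_num
  have hΨR : Ψ (7 / 2) = 0 := by simp only [hΨ]; norm_num
  have hψL : ψ L ^ 2 ≤ 1 := by
    have hL2 : L ^ 2 ≤ (7 / 2) ^ 2 := pow_le_pow_left₀ hL.le hL'.le 2
    have p0 : 0 ≤ ψ L := by simp only [hψ]; rw [sub_nonneg, div_le_one (by norm_num)]; exact hL2
    have p1 : ψ L ≤ 1 := sub_le_self _ (by positivity)
    exact pow_le_one₀ p0 p1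
  simp only [hψR, hΨR] at main
  replace hnum : κ * L * Z ≤ Ψ L ^ 2 := hnum
  clear_value A Bf Θ Ψ ψ
  clear hΨd hAd hBd hψd
  have hBc : Bf (7 / 2) / c ≤ 1941 / 100 / c := by gcongr
  have hBc' : 0 ≤ Bf L / c := by positivity
  have y1 : 2 * t * (ψ L * (L * w1 L)) ≤ L * w1 L ^ 2 + t ^ 2 * L := by
    have : t ^ 2 * L * ψ L ^ 2 ≤ t ^ 2 * L := mul_le_of_le_one_right (by positivity) hψL
    nlinarith [mul_nonneg hL.le (sq_nonneg (w1 L - t * ψ L))]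
  have tot : L * w L ^ 2 + (2 * t * (Ψ L * w L) - t ^ 2 * Z) ≤ ∫ x in L..X, density c w w1 w2 x := by
    rw [← hsplit]
    have : t ^ 2 * (A (7 / 2) + Bf (7 / 2) / c - (A L + Bf L / c)) ≤
        t ^ 2 * (187 / 100 + 1941 / 100 / c) := by
      apply mul_le_mul_of_nonneg_left _ (sq_nonneg t); linarith
    have hs : t ^ 2 * Z = t ^ 2 * (187 / 100 + 1941 / 100 / c) + t ^ 2 * L := by rw [hZ]; ring
    rw [hs]
    clear hs hnum hψL hBc hBc' hAL hBL hAR hBR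
    generalize (∫ x in L..(7 / 2 : ℝ), density c w w1 w2 x) = i1 at *
    generalize (∫ x in (7 / 2 : ℝ)..X, density c w w1 w2 x) = i2 at *
    linarith
  have tv : 2 * t * (Ψ L * w L) - t ^ 2 * Z = (Ψ L) ^ 2 / Z * w L ^ 2 := by
    rw [ht]; field_simp; ring
  have : κ * L ≤ (Ψ L) ^ 2 / Z := by
    rw [le_div_iff₀ hZ0]; exact hnum
  nlinarith [mul_le_mul_of_nonneg_right this (sq_nonneg (w L))]

end

section

variable {w w1 w2 : ℝ → ℝ} (h1 : ∀ x, HasDerivAt w (w1 x) x)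
  (h2 : ∀ x, HasDerivAt w1 (w2 x) x) (h2c : Continuous w2)

/-- The expression is affine in `ε`, so the two endpoint values of `ε` suffice. It is the
coefficient of `w²` left over in `integral_density_ge_riccati`, times `x²/ε`, in the variable `u =
1/(x² + 1/2)`; the bound 16/17 is the value of `u` at `x = 3/4`. -/
theorem riccati_polynomial_nonneg {u ε : ℝ} (hu : 0 ≤ u) (hu' : u ≤ 16 / 17) (hε : 0 ≤ ε)
    (hε' : ε ≤ 671 / 1000) :
    0 ≤ (27 / 50 + 247 / 100 * u - 611 / 100 * u ^ 2 + 39 / 10 * u ^ 3 - 39 / 50 * u ^ 4)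
      + ε * (-(3 / 4) + 39 / 20 * u - 19591 / 10000 * u ^ 2 + 2002 / 2500 * u ^ 3
        - 1183 / 10000 * u ^ 4) := by
  have p0 : 0 ≤ 27 / 50 + 247 / 100 * u - 611 / 100 * u ^ 2 + 39 / 10 * u ^ 3 - 39 / 50 * u ^ 4 := by
    nlinarith [mul_nonneg hu (sub_nonneg.2 hu'), mul_nonneg (mul_nonneg hu hu) (sub_nonneg.2 hu'), mul_nonneg hu (sq_nonneg (u-1)), sq_nonneg (u*(u-1)), sq_nonneg (u-1), mul_nonneg (mul_nonneg hu (sub_nonneg.2 hu')) (mul_nonneg hu (sub_nonneg.2 hu'))]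
  have p1 : 0 ≤ (27 / 50 + 247 / 100 * u - 611 / 100 * u ^ 2 + 39 / 10 * u ^ 3 - 39 / 50 * u ^ 4)
      + 671 / 1000 * (-(3 / 4) + 39 / 20 * u - 19591 / 10000 * u ^ 2 + 2002 / 2500 * u ^ 3
        - 1183 / 10000 * u ^ 4) := by
    nlinarith [mul_nonneg hu (sub_nonneg.2 hu'), mul_nonneg (mul_nonneg hu hu) (sub_nonneg.2 hu'), mul_nonneg hu (sq_nonneg (u-1)), sq_nonneg (u*(u-1)), sq_nonneg (u-1), mul_nonneg (mul_nonneg hu (sub_nonneg.2 hu')) (mul_nonneg hu (sub_nonneg.2 hu'))]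
  nlinarith

set_option maxHeartbeats 1000000 in
include h1 h2 h2c in
-- For small `c = ε²` the form `x(w² + w'²)` is corrected at order `ε` by a form `a w² + B w w' + x
-- D w'²` that solves a Riccati inequality. The result is an extra positive multiple of `ε w(3/4)²`,
-- which the plain multiplier with `μ = 1` does not provide. The relation `B = D - xD'` and the
-- choice of `a` remove the unwanted `w'²` and `w w'` terms. What remains is `(Z + ε(B/(2x) w +
-- Dw'))²`, where `Z = xw'' + xw + w'`, plus multiples of `w²` and `w'²` whose coefficients are
-- nonnegative.
theorem integral_density_ge_riccati {ε X : ℝ} (hε : 0 ≤ ε)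
    (hε' : ε ≤ 671 / 1000) (hX' : 3 / 4 ≤ X) (hX : w X = 0) (hX1 : w1 X = 0) :
    3 / 4 * (w (3 / 4) ^ 2 + w1 (3 / 4) ^ 2) + ε * (595 / 1000 + 249 / 1000 * ε) * w (3 / 4) ^ 2
      ≤ ∫ x in (3 / 4)..X, density (ε ^ 2) w w1 w2 x := by
  set u : ℝ → ℝ := fun x => (x ^ 2 + 1 / 2)⁻¹ with hu
  set D : ℝ → ℝ := fun x => 1 - 13 / 50 * u x with hD
  set Bq : ℝ → ℝ := fun x => 1 - 39 / 50 * u x + 13 / 50 * u x ^ 2 with hBq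
  set a : ℝ → ℝ := fun x => x * (1 - 13 / 50 * u x - 39 / 50 * u x ^ 2 + 26 / 50 * u x ^ 3)
    + Bq x * (1 + ε * D x) / (2 * x) with ha
  have hud : ∀ x, HasDerivAt u (-2 * x * u x ^ 2) x := by
    intro x
    have e := ((hasDerivAt_pow 2 x).add_const (1 / 2 : ℝ)).inv (by positivity)
    refine e.congr_deriv ?_
    simp only [hu]; field_simp; norm_num; ring
  have hxu : ∀ x, x ^ 2 * u x = 1 - u x / 2 := by
    intro x; simp only [hu]; field_simp; ring
  have hDd : ∀ x, HasDerivAt D (26 / 50 * x * u x ^ 2) x := fun x =>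
    (((hud x).const_mul (13 / 50 : ℝ)).const_sub 1).congr_deriv (by ring)
  have hBd : ∀ x, HasDerivAt Bq (x * u x ^ 2 * (78 / 50 - 52 / 50 * u x)) x := fun x =>
    ((((hud x).const_mul (39 / 50 : ℝ)).const_sub 1).add
      (((hud x).pow 2).const_mul (13 / 50 : ℝ))).congr_deriv (by simp; ring)
  set a1 : ℝ → ℝ := fun x => (1 - 13 / 50 * u x - 39 / 50 * u x ^ 2 + 26 / 50 * u x ^ 3)
    + x * (-2 * x * u x ^ 2) * (-(13 / 50) - 78 / 50 * u x + 78 / 50 * u x ^ 2)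
    + (x * u x ^ 2 * (78 / 50 - 52 / 50 * u x) * (1 + ε * D x)
      + Bq x * (ε * (26 / 50 * x * u x ^ 2))) / (2 * x)
    - Bq x * (1 + ε * D x) / (2 * x ^ 2) with ha1
  have had : ∀ x, 0 < x → HasDerivAt a (a1 x) x := by
    intro x hx
    have e1 := (hasDerivAt_id x).mul (((((hud x).const_mul (13 / 50 : ℝ)).const_sub 1).sub
      (((hud x).pow 2).const_mul (39 / 50 : ℝ))).add (((hud x).pow 3).const_mul (26 / 50 : ℝ)))
    have e2 := ((hBd x).mul (((hDd x).const_mul ε).const_add 1)).div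
      ((hasDerivAt_id x).const_mul 2) (by simpa using hx.ne')
    refine (e1.add e2).congr_deriv ?_
    simp [ha1]
    field_simp
    ring
  -- The Riccati inequality. Multiplied by `x²`, and with `x²u = 1 - u/2`, it becomes a polynomial
  -- in `u`.
  have hapos : ∀ x, 3 / 4 ≤ x → 0 ≤ a1 x - Bq x - ε * Bq x ^ 2 / (4 * x ^ 2) := by
    intro x hx
    have hx0 : 0 < x := by linarith
    have hu0 : 0 ≤ u x := by simp only [hu]; positivity
    have hu1 : u x ≤ 16 / 17 := by
      simp only [hu]
      rw [inv_le_comm₀ (by positivity) (by norm_num)]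
      nlinarith
    have key := riccati_polynomial_nonneg hu0 hu1 hε hε'
    have e := hxu x
    have : x ^ 2 * (a1 x - Bq x - ε * Bq x ^ 2 / (4 * x ^ 2)) =
      (27 / 50 + 247 / 100 * u x - 611 / 100 * u x ^ 2 + 39 / 10 * u x ^ 3 - 39 / 50 * u x ^ 4)
      + ε * (-(3 / 4) + 39 / 20 * u x - 19591 / 10000 * u x ^ 2 + 2002 / 2500 * u x ^ 3
        - 1183 / 10000 * u x ^ 4) := by
      have e' : x ^ 2 * (a1 x - Bq x - ε * Bq x ^ 2 / (4 * x ^ 2)) =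
          x ^ 2 * ((1 - 13 / 50 * u x - 39 / 50 * u x ^ 2 + 26 / 50 * u x ^ 3)
            - 2 * u x * (x ^ 2 * u x) * (-(13 / 50) - 78 / 50 * u x + 78 / 50 * u x ^ 2)
            + u x ^ 2 * (39 / 50 - 26 / 50 * u x) * (1 + ε * D x)
            + Bq x * (ε * (13 / 50 * u x ^ 2)) - Bq x)
          - Bq x * (1 + ε * D x) / 2 - ε * Bq x ^ 2 / 4 := by
        simp only [ha1]
        clear_value u Bq D
        field_simp
        ring
      rw [e']
      simp only [hD, hBq]
      clear_value u
      linear_combination (-(13 / 50) - 39 / 50 * u x + 26 / 50 * u x ^ 2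
        + (-2 + u x) * (-(13 / 50) - 78 / 50 * u x + 78 / 50 * u x ^ 2)
        + u x * (39 / 50 - 26 / 50 * u x) * (1 + ε * (1 - 13 / 50 * u x))
        + (1 - 39 / 50 * u x + 13 / 50 * u x ^ 2) * (ε * (13 / 50 * u x))
        + 39 / 50 - 13 / 50 * u x
        - 2 * x ^ 2 * u x * (-(13 / 50) - 78 / 50 * u x + 78 / 50 * u x ^ 2)) * e
    rw [← this] at key
    exact nonneg_of_mul_nonneg_right key (by positivity)
  have main := sub_le_integral_of_deriv_le hX'
    (g := fun x => -(x * (w x ^ 2 + w1 x ^ 2)) -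
      ε * (a x * w x ^ 2 + Bq x * (w x * w1 x) + x * D x * w1 x ^ 2))
    (g' := fun x => -((w x ^ 2 + w1 x ^ 2) + x * (2 * w x * w1 x + 2 * w1 x * w2 x))
      - ε * ((a1 x * w x ^ 2 + a x * (2 * w x * w1 x))
        + (x * u x ^ 2 * (78 / 50 - 52 / 50 * u x) * (w x * w1 x)
          + Bq x * (w1 x * w1 x + w x * w2 x))
        + ((D x + x * (26 / 50 * x * u x ^ 2)) * w1 x ^ 2 + x * D x * (2 * w1 x * w2 x))))
    (φ := density (ε ^ 2) w w1 w2) ?_ (continuous_density h1 h2 h2c _).continuousOn ?_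
  rotate_left
  · intro x hx
    have hx0 : 0 < x := by linarith [hx.1]
    have e1 := ((hasDerivAt_id x).mul (((h1 x).pow 2).add ((h2 x).pow 2))).neg
    have e2 := ((((had x hx0).mul ((h1 x).pow 2)).add
      ((hBd x).mul ((h1 x).mul (h2 x)))).add
      (((hasDerivAt_id x).mul (hDd x)).mul ((h2 x).pow 2))).const_mul ε
    refine (e1.sub e2).congr_deriv ?_
    simp
  · intro x hx
    have hx0 : 0 < x := by linarith [hx.1]
    have hu0 : 0 ≤ u x := by simp only [hu]; positivity
    have hu1 : u x ≤ 2 := by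
      simp only [hu]
      rw [inv_le_comm₀ (by positivity) (by norm_num)]
      nlinarith
    have hA := hapos x hx.1
    have e := hxu x
    have hD1 : 0 ≤ 1 - D x ^ 2 := by simp only [hD]; nlinarith
    have key : density (ε ^ 2) w w1 w2 x - (-((w x ^ 2 + w1 x ^ 2) + x * (2 * w x * w1 x + 2 * w1 x * w2 x))
      - ε * ((a1 x * w x ^ 2 + a x * (2 * w x * w1 x))
        + (x * u x ^ 2 * (78 / 50 - 52 / 50 * u x) * (w x * w1 x)
          + Bq x * (w1 x * w1 x + w x * w2 x))
        + ((D x + x * (26 / 50 * x * u x ^ 2)) * w1 x ^ 2 + x * D x * (2 * w1 x * w2 x))))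
      = (x * w2 x + x * w x + w1 x + ε * (Bq x / (2 * x) * w x + D x * w1 x)) ^ 2
        + ε * (a1 x - Bq x - ε * Bq x ^ 2 / (4 * x ^ 2)) * w x ^ 2
        + ε ^ 2 * (1 - D x ^ 2) * w1 x ^ 2 := by
      clear_value a1
      have hB2 : Bq x = D x - 26 / 50 * x ^ 2 * u x ^ 2 := by
        simp only [hBq, hD]; linear_combination (26 / 50 * u x) * e
      obtain ⟨p, hp⟩ : ∃ p, Bq x / (2 * x) = p := ⟨_, rfl⟩
      have hp' : Bq x = 2 * x * p := by rw [← hp]; field_simp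
      have hp2 : ε * Bq x ^ 2 / (4 * x ^ 2) = ε * p ^ 2 := by rw [← hp]; field_simp; ring
      have ha2 : a x = x * D x - x * u x ^ 2 * (39 / 50 - 26 / 50 * u x)
          + p + ε * p * D x := by
        rw [← hp]; simp only [ha, hD]; ring
      rw [hp, hp2]
      clear_value Bq D a
      unfold density
      linear_combination (2 * ε * w x * w1 x) * ha2 + (ε * w1 x ^ 2) * hB2
        + (ε * w x * (w x + w2 x)) * hp'
    have : 0 ≤ (x * w2 x + x * w x + w1 x + ε * (Bq x / (2 * x) * w x + D x * w1 x)) ^ 2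
        + ε * (a1 x - Bq x - ε * Bq x ^ 2 / (4 * x ^ 2)) * w x ^ 2
        + ε ^ 2 * (1 - D x ^ 2) * w1 x ^ 2 := by
      positivity
    linarith
  have huR : u (3 / 4) = 16 / 17 := by simp only [hu]; norm_num
  have haR : a (3 / 4) = 345979 / 491300 + 153438 / 614125 * ε := by
    simp only [ha, hBq, hD, huR]; ring
  have hBR : Bq (3 / 4) = 717 / 1445 := by simp only [hBq, huR]; norm_num
  have hDR : D (3 / 4) = 321 / 425 := by simp only [hD, huR]; norm_num
  simp only [haR, hBR, hDR, hX, hX1] at main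
  clear_value u D Bq a a1
  refine le_trans ?_ main
  generalize w (3 / 4) = p
  generalize w1 (3 / 4) = q
  -- The quadratic form at `x = 3/4` is minimized over `q`, which leaves slightly more than 0.595 as
  -- the constant part of the coefficient.
  have : (595 / 1000 + 249 / 1000 * ε) * p ^ 2 ≤ (345979 / 491300 + 153438 / 614125 * ε) * p ^ 2
      + 717 / 1445 * (p * q) + 3 / 4 * (321 / 425) * q ^ 2 := by
    nlinarith [sq_nonneg (q + 717 / 1445 / (3 / 2 * (321 / 425)) * p), mul_nonneg hε (sq_nonneg p)]
  linarith [mul_le_mul_of_nonneg_left this hε]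

end

section

variable {w w1 w2 : ℝ → ℝ}

set_option maxHeartbeats 1000000 in
/-- The function `w` near the origin, where the density is controlled by `(x w')' + x w`. -/
theorem abs_le_of_logarithmic_test (h1 : ∀ x, HasDerivAt w (w1 x) x)
    (h2 : ∀ x, HasDerivAt w1 (w2 x) x) (h2c : Continuous w2)
    {L R v M x₀ t σ : ℝ} (hL : 0 < L) (hx₀ : L ≤ x₀) (hx₀R : x₀ ≤ R)
    (hv : 0 < v) (hM : ∀ x ∈ Icc L R, |w x| ≤ M) (hσ : |σ| = 1) (hσM : σ * w x₀ = M)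
    (ht : 0 ≤ t) :
    2 * t * M * (1 - R ^ 2 / 4) ≤ t ^ 2 * (1 / v + 2 * R) + v * w R ^ 2 + L * w1 L ^ 2
      + ∫ x in L..R, (x * w2 x + x * w x + w1 x) ^ 2 := by
  have c0 : Continuous w := continuous_iff_continuousAt.2 fun x => (h1 x).continuousAt
  have c1 : Continuous w1 := continuous_iff_continuousAt.2 fun x => (h2 x).continuousAt
  have hx0 : 0 < x₀ := hL.trans_le hx₀
  have hR : 0 < R := hx0.trans_le hx₀R
  have hM0 : 0 ≤ M := (abs_nonneg _).trans (hM L ⟨le_rfl, hx₀.trans hx₀R⟩)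
  have hσ2 : σ ^ 2 = 1 := by rw [← sq_abs, hσ, one_pow]
  have hZc : Continuous fun x => (x * w2 x + x * w x + w1 x) ^ 2 := by fun_prop
  -- The test function is `log (R/x)`, frozen at its value at `x₀` for `x ≤ x₀`. Since `x l' = -1`,
  -- integrating `l (xw')'` by parts produces `w(x₀)` itself. The constants come from the integrals
  -- of `l²` and `x l` over `(0, R)`, which are `2R` and `R²/4`, so nothing degenerates as `L → 0`.
  set l : ℝ → ℝ := fun x => Real.log R - Real.log x with hl
  have hld : ∀ x, 0 < x → HasDerivAt l (-x⁻¹) x := fun x hx =>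
    (Real.hasDerivAt_log hx.ne').const_sub _
  have hl0 : ∀ x, 0 < x → x ≤ R → 0 ≤ l x := fun x hx hxR =>
    sub_nonneg.2 (Real.log_le_log hx hxR)
  have young : ∀ x m : ℝ, 0 ≤ x → 0 ≤ m → |w x| ≤ M →
      -2 * t * σ * (m * (w1 x + x * w2 x)) - t ^ 2 * m ^ 2 - 2 * t * M * (m * x) ≤
        (x * w2 x + x * w x + w1 x) ^ 2 := by
    intro x m hx hm hw
    have hsw : σ * w x ≤ M := (le_abs_self _).trans (by rw [abs_mul, hσ, one_mul]; exact hw)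
    have := mul_le_mul_of_nonneg_left hsw (by positivity : 0 ≤ 2 * t * (m * x))
    have hs : (t * σ * m) ^ 2 = t ^ 2 * m ^ 2 := by rw [mul_pow, mul_pow, hσ2]; ring
    nlinarith [sq_nonneg ((x * w2 x + x * w x + w1 x) + t * σ * m)]
  have right := sub_le_integral_of_deriv_le hx₀R
    (g := fun x => -2 * t * σ * (w x + l x * (x * w1 x)) - t ^ 2 * (x * l x ^ 2 + 2 * x * l x + 2 * x)
      - 2 * t * M * (x ^ 2 * l x / 2 + x ^ 2 / 4))
    (g' := fun x => -2 * t * σ * (l x * (w1 x + x * w2 x)) - t ^ 2 * l x ^ 2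
      - 2 * t * M * (l x * x)) ?_ hZc.continuousOn ?_
  rotate_left
  · intro x hx
    have hx' : 0 < x := hx0.trans_le hx.1
    have e0 := hld x hx'
    have ei := hasDerivAt_id x
    have e1 := ((h1 x).add (e0.mul (ei.mul (h2 x)))).const_mul (-2 * t * σ)
    have e2 := (((ei.mul (e0.pow 2)).add ((ei.const_mul 2).mul e0)).add
      (ei.const_mul 2)).const_mul (t ^ 2)
    have e3 := ((((ei.pow 2).mul e0).div_const 2).add ((ei.pow 2).div_const 4)).const_mul (2 * t * M)
    refine ((e1.sub e2).sub e3).congr_deriv ?_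
    simp
    field_simp
    ring
  · intro x hx
    have hx' : 0 < x := hx0.trans_le hx.1
    exact young x (l x) hx'.le (hl0 x hx' hx.2) (hM x ⟨hx₀.trans hx.1, hx.2⟩)
  have left := sub_le_integral_of_deriv_le hx₀
    (g := fun x => -2 * t * σ * (l x₀ * (x * w1 x)) - t ^ 2 * l x₀ ^ 2 * x
      - 2 * t * M * (l x₀ * x ^ 2 / 2))
    (g' := fun x => -2 * t * σ * (l x₀ * (w1 x + x * w2 x)) - t ^ 2 * l x₀ ^ 2
      - 2 * t * M * (l x₀ * x)) ?_ hZc.continuousOn ?_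
  rotate_left
  · intro x hx
    have ei := hasDerivAt_id x
    have e1 := ((ei.mul (h2 x)).const_mul (l x₀)).const_mul (-2 * t * σ)
    have e2 := ei.const_mul (t ^ 2 * l x₀ ^ 2)
    have e3 := (((ei.pow 2).const_mul (l x₀)).div_const 2).const_mul (2 * t * M)
    refine ((e1.sub e2).sub e3).congr_deriv ?_
    simp only [one_mul, id, mul_one, Nat.cast_ofNat]
    ring
  · intro x hx
    have hx' : 0 < x := hL.trans_le hx.1
    exact young x (l x₀) hx'.le (hl0 x₀ hx0 hx₀R) (hM x ⟨hx.1, hx.2.trans hx₀R⟩)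
  have hsplit := intervalIntegral.integral_add_adjacent_intervals
    (hZc.intervalIntegrable (μ := volume) L x₀) (hZc.intervalIntegrable x₀ R)
  have hlR : l R = 0 := by simp [hl]
  have hl00 := hl0 x₀ hx0 hx₀R
  simp only [hlR] at right
  rw [← hsplit]
  clear_value l
  clear young hld hl0 hlR hM hsplit hZc
  generalize l x₀ = m at *
  generalize (∫ x in x₀..R, (x * w2 x + x * w x + w1 x) ^ 2) = i1 at *
  generalize (∫ x in L..x₀, (x * w2 x + x * w x + w1 x) ^ 2) = i2 at *
  -- The boundary terms in `w(R)` and `w'(L)` are absorbed by completing squares. This uses up `v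
  -- w(R)²`, at the cost `t²/v`, and `L w'(L)²`.
  have s1 : 0 ≤ v * w R ^ 2 - 2 * t * σ * w R + t ^ 2 / v := by
    have : v * w R ^ 2 - 2 * t * σ * w R + t ^ 2 / v = v * (w R - t * σ / v) ^ 2 := by
      field_simp; rw [← mul_one (t ^ 2), ← hσ2]; ring
    rw [this]; positivity
  have s2 : 0 ≤ L * w1 L ^ 2 + 2 * t * σ * m * (L * w1 L) + t ^ 2 * m ^ 2 * L := by
    have : L * w1 L ^ 2 + 2 * t * σ * m * (L * w1 L) + t ^ 2 * m ^ 2 * L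
        = L * (w1 L + t * σ * m) ^ 2 := by
      linear_combination (-(t ^ 2 * m ^ 2 * L)) * hσ2
    rw [this]; positivity
  have s3 : 0 ≤ t * M * (m * L ^ 2) := by positivity
  have s3' : 0 ≤ t * M * x₀ ^ 2 := by positivity
  have s4 : 0 ≤ t ^ 2 * (x₀ * m + x₀) := by positivity
  have s5 : t ^ 2 * (1 / v + 2 * R) = t ^ 2 / v + t ^ 2 * (2 * R) := by ring
  have s6 : 2 * t * M = 2 * t * σ * w x₀ := by rw [← hσM]; ring
  linarith

set_option maxHeartbeats 1000000 in
-- Three regimes of `c = βL²`. For `c ≥ 20` the multiplier with `μ = 1 + κ` works; for `9/20 ≤ c ≤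
-- 20` the quadratic test function; for `c ≤ 9/20` the Riccati form on `[3/4, X]` combined with the
-- logarithmic test on `[L, 3/4]`. In the last two the surplus to be found is `κL ≤ (3/10)√c`, by
-- the hypothesis on `κ²`.
theorem one_dimensional_inequality (h1 : ∀ x, HasDerivAt w (w1 x) x)
    (h2 : ∀ x, HasDerivAt w1 (w2 x) x) (h2c : Continuous w2)
    {β κ L X : ℝ} (hβ : 55 ≤ β) (hκ : 0 ≤ κ) (hκ4 : κ ≤ 4)
    (hκβ : κ ^ 2 ≤ 9 / 100 * β) (hL : 0 < L) (hLX : L ≤ X) (hX4 : 4 ≤ X)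
    (hX : w X = 0) (hX1 : w1 X = 0) :
    (1 + κ) * (L * w L ^ 2) ≤ ∫ x in L..X, density (β * L ^ 2) w w1 w2 x := by
  have hβ0 : 0 < β := by linarith
  set c := β * L ^ 2 with hc
  have hc0 : 0 < c := by positivity
  rcases le_total 20 c with hc20 | hc20
  -- Here `μ² - μ = κ(1 + κ) ≤ 20` because `κ ≤ 4`.
  · have := integral_density_ge_multiplier h1 h2 h2c (c := c) (μ := 1 + κ) (by linarith)
      (by nlinarith) hLX hX hX1
    nlinarith [mul_nonneg hL.le (sq_nonneg (w1 L)), mul_nonneg hκ (mul_nonneg hL.le (sq_nonneg (w1 L)))]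
  set ε := Real.sqrt c with hε
  have hε0 : 0 < ε := Real.sqrt_pos.2 hc0
  have hε2 : ε ^ 2 = c := Real.sq_sqrt hc0.le
  clear_value ε c
  have hκL : κ * L ≤ 3 / 10 * ε := by
    apply le_of_sq_le_sq _ (by positivity)
    rw [mul_pow, mul_pow, hε2, hc]
    nlinarith [mul_le_mul_of_nonneg_right hκβ (sq_nonneg L)]
  have hL2 : 55 * L ^ 2 ≤ ε ^ 2 := by rw [hε2, hc]; nlinarith [sq_nonneg L]
  rcases le_total (9 / 20) c with hc45 | hc45
  · have hL1 : L ≤ 61 / 100 := by nlinarith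
    refine integral_density_ge_test h1 h2 h2c hc0 hL (by linarith) (by linarith) hX hX1 ?_
    rw [← hε2] at hc20 hc45
    have hεl : 67 / 100 ≤ ε := by nlinarith
    have hεu : ε ≤ 448 / 100 := by nlinarith
    have hLε : L ≤ 135 / 1000 * ε := by nlinarith
    -- The coefficients 0.561 and 5.823 are 3/10 of 1.87 and 19.41. The right-hand side is the
    -- Bernoulli bound `(49/16)²(1 - 4z)`, where `z = 4L²/49` and `55L² ≤ ε²`.
    have poly : 561 / 1000 * ε ^ 2 + 5823 / 1000 + 41 / 1000 * ε ^ 3 ≤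
        (9378 / 1000 - 56 / 1000 * ε ^ 2) * ε := by
      nlinarith [mul_nonneg (sub_nonneg.2 hεl) (sub_nonneg.2 hεu),
        mul_nonneg (mul_nonneg (sub_nonneg.2 hεl) (sub_nonneg.2 hεu)) hε0.le]
    calc κ * L * (187 / 100 + 1941 / 100 / c + L)
        ≤ 3 / 10 * ε * (187 / 100 + 1941 / 100 / ε ^ 2 + 135 / 1000 * ε) := by
          rw [hε2]; gcongr
      _ = (561 / 1000 * ε ^ 2 + 5823 / 1000 + 405 / 10000 * ε ^ 3) / ε := by
          field_simp; ring
      _ ≤ 9378 / 1000 - 56 / 1000 * ε ^ 2 := by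
          rw [div_le_iff₀ hε0]; nlinarith [pow_pos hε0 3]
      _ ≤ ((7 / 2) ^ 2 / 4 * (1 - L ^ 2 / (7 / 2) ^ 2) ^ 2) ^ 2 := by
          obtain ⟨z, hz⟩ : ∃ z, L ^ 2 / (7 / 2) ^ 2 = z := ⟨_, rfl⟩
          have hz' : z = 4 / 49 * L ^ 2 := by rw [← hz]; ring
          have hz2 : L ^ 2 ≤ 4 / 10 := by nlinarith
          have hb := one_add_mul_le_pow (a := -z) (by linarith) 4
          have e : ((7 / 2) ^ 2 / 4 * (1 - z) ^ 2) ^ 2 = (49 / 16) ^ 2 * (1 + -z) ^ 4 := by ring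
          rw [hz, e]
          norm_num at hb
          generalize (1 + -z) ^ 4 = y at *
          linarith
  · have hε9 : ε ^ 2 ≤ 9 / 20 := by rwa [hε2]
    have hε' : ε ≤ 671 / 1000 := by nlinarith
    have hL1 : L ≤ 3 / 4 := by nlinarith
    have far := integral_density_ge_riccati h1 h2 h2c hε0.le hε' (by linarith) hX hX1
    rw [hε2] at far
    have c0 : Continuous w := continuous_iff_continuousAt.2 fun x => (h1 x).continuousAt
    have c1 : Continuous w1 := continuous_iff_continuousAt.2 fun x => (h2 x).continuousAt
    have hdc := continuous_density h1 h2 h2c c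
    have hZc : Continuous fun x => (x * w2 x + x * w x + w1 x) ^ 2 := by fun_prop
    -- On `[L, 3/4]` the multiplier with `μ = 1` is used keeping the square `Z²`, where `Z = xw'' +
    -- xw + w'`, and dropping `cw'²`. Its boundary term at `3/4` cancels against that of the Riccati
    -- estimate. The logarithmic test then converts `∫ Z²`, `L w'(L)²` and `ε v1 w(3/4)²` into a
    -- multiple of the square of the maximum of `|w|`.
    have near := sub_le_integral_of_deriv_le hL1 (g := fun x => -(x * (w x ^ 2 + w1 x ^ 2)))
      (g' := fun x => -((w x ^ 2 + w1 x ^ 2) + x * (2 * w x * w1 x + 2 * w1 x * w2 x)))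
      (φ := fun x => density c w w1 w2 x - (x * w2 x + x * w x + w1 x) ^ 2) ?_
      (hdc.sub hZc).continuousOn ?_
    rotate_left
    · intro x _
      refine ((hasDerivAt_id x).mul (((h1 x).pow 2).add ((h2 x).pow 2))).neg.congr_deriv ?_
      simp
    · intro x _
      unfold density
      nlinarith [mul_nonneg hc0.le (sq_nonneg (w1 x))]
    rw [intervalIntegral.integral_sub (hdc.intervalIntegrable _ _) (hZc.intervalIntegrable _ _)]
      at near
    obtain ⟨x₀, hx₀, hmax⟩ := isCompact_Icc.exists_isMaxOn (nonempty_Icc.2 hL1)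
      (c0.abs.continuousOn)
    obtain ⟨σ, hσ, hσM⟩ : ∃ σ : ℝ, |σ| = 1 ∧ σ * w x₀ = |w x₀| := by
      rcases le_total 0 (w x₀) with h | h
      · exact ⟨1, by simp, by rw [abs_of_nonneg h, one_mul]⟩
      · exact ⟨-1, by simp, by rw [abs_of_nonpos h]; ring⟩
    set v1 : ℝ := 595 / 1000 + 249 / 1000 * ε with hv1
    have hv10 : 0 < v1 := by positivity
    set S : ℝ := 1 / (ε * v1) + 2 * (3 / 4) with hS
    have hS0 : 0 < S := by positivity
    set q : ℝ := 1 - (3 / 4) ^ 2 / 4 with hq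
    have hq0 : 0 < q := by rw [hq]; norm_num
    clear_value S q v1
    -- This `t` maximizes `2tMq - t²S` with `M = |w x₀|`, giving `q²M²/S`. Since `S` grows like
    -- `1/ε` as `ε → 0`, the gain is of order `ε`, as needed for `κL`.
    have test := abs_le_of_logarithmic_test h1 h2 h2c hL hx₀.1 hx₀.2 (mul_pos hε0 hv10)
      (fun x hx => hmax hx) hσ hσM (t := |w x₀| * q / S) (by positivity)
    have tv : 2 * (|w x₀| * q / S) * |w x₀| * q - (|w x₀| * q / S) ^ 2 * S = q ^ 2 / S * w x₀ ^ 2 := by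
      rw [← sq_abs (w x₀)]; field_simp; ring
    have cond : κ * L ≤ q ^ 2 / S := by
      rw [le_div_iff₀ hS0]
      calc κ * L * S ≤ 3 / 10 * ε * S := by gcongr
        _ = (3 / 10 + 45 / 100 * ε * v1) / v1 := by rw [hS]; field_simp; ring
        _ ≤ q ^ 2 := by
          rw [div_le_iff₀ hv10, hq, hv1]; nlinarith
    have wL : w L ^ 2 ≤ w x₀ ^ 2 := sq_le_sq.2 (hmax (left_mem_Icc.2 hL1))
    have hsplit := intervalIntegral.integral_add_adjacent_intervals
      (hdc.intervalIntegrable (μ := volume) L (3 / 4)) (hdc.intervalIntegrable (3 / 4) X)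
    have hfin : κ * L * w L ^ 2 ≤ q ^ 2 / S * w x₀ ^ 2 :=
      mul_le_mul cond wL (sq_nonneg _) (by positivity)
    rw [← hsplit]
    simp only [← hS, ← hq] at test
    linarith

end

/-! ### Inequalities on a vertical column -/

/-- Expand the square of `f - φ`, where `φ = A e + B k 1_[0,s]`. Choosing `A` and `B` later gives
sharp Cauchy–Schwarz bounds from two moments of `f` at once. -/
theorem integral_sq_ge_of_test {f e k : ℝ → ℝ} (hf : Continuous f) (he : Continuous e)
    (hk : Continuous k) {s T : ℝ} (hs : 0 ≤ s) (hsT : s ≤ T) (A B : ℝ) :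
    2 * (A * (∫ y in 0..T, e y * f y) + B * ∫ y in 0..s, k y * f y)
      - (A ^ 2 * (∫ y in 0..T, e y ^ 2) + 2 * A * B * (∫ y in 0..s, e y * k y)
        + B ^ 2 * ∫ y in 0..s, k y ^ 2) ≤ ∫ y in 0..T, f y ^ 2 := by
  have i1 : 0 ≤ ∫ y in 0..s, (f y - (A * e y + B * k y)) ^ 2 :=
    intervalIntegral.integral_nonneg hs fun y _ => sq_nonneg _
  have i2 : 0 ≤ ∫ y in s..T, (f y - A * e y) ^ 2 :=
    intervalIntegral.integral_nonneg hsT fun y _ => sq_nonneg _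
  have e1 : (fun y => (f y - (A * e y + B * k y)) ^ 2) = fun y => f y ^ 2 - 2 * A * (e y * f y)
      - 2 * B * (k y * f y) + A ^ 2 * e y ^ 2 + 2 * A * B * (e y * k y) + B ^ 2 * k y ^ 2 := by
    funext y; ring
  have e2 : (fun y => (f y - A * e y) ^ 2) = fun y => f y ^ 2 - 2 * A * (e y * f y)
      + A ^ 2 * e y ^ 2 := by
    funext y; ring
  have s1 := intervalIntegral.integral_add_adjacent_intervals (a := 0) (b := s) (c := T)
    (μ := volume) (f := fun y => e y * f y)
    (Continuous.intervalIntegrable (by fun_prop) _ _) (Continuous.intervalIntegrable (by fun_prop) _ _)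
  have s2 := intervalIntegral.integral_add_adjacent_intervals (a := 0) (b := s) (c := T)
    (μ := volume) (f := fun y => e y ^ 2)
    (Continuous.intervalIntegrable (by fun_prop) _ _) (Continuous.intervalIntegrable (by fun_prop) _ _)
  have s3 := intervalIntegral.integral_add_adjacent_intervals (a := 0) (b := s) (c := T)
    (μ := volume) (f := fun y => f y ^ 2)
    (Continuous.intervalIntegrable (by fun_prop) _ _) (Continuous.intervalIntegrable (by fun_prop) _ _)
  rw [e1, intervalIntegral.integral_add, intervalIntegral.integral_add,
    intervalIntegral.integral_add, intervalIntegral.integral_sub, intervalIntegral.integral_sub] at i1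
  · rw [e2, intervalIntegral.integral_add, intervalIntegral.integral_sub] at i2
    · simp only [intervalIntegral.integral_const_mul] at i1 i2
      rw [← s1, ← s2, ← s3]
      linarith
    all_goals exact Continuous.intervalIntegrable (by fun_prop) _ _
  all_goals exact Continuous.intervalIntegrable (by fun_prop) _ _

theorem hasDerivAt_exp_neg (y : ℝ) : HasDerivAt (fun y : ℝ => Real.exp (-y)) (-Real.exp (-y)) y := by
  simpa using (hasDerivAt_neg y).exp

theorem integral_exp_neg_sq_le (T : ℝ) : ∫ y in 0..T, Real.exp (-y) ^ 2 ≤ 1 / 2 := by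
  have : ∫ y in 0..T, Real.exp (-y) ^ 2 = -(Real.exp (-T) ^ 2 / 2) - -(Real.exp (-0) ^ 2 / 2) := by
    refine intervalIntegral.integral_eq_sub_of_hasDerivAt (f := fun y => -(Real.exp (-y) ^ 2 / 2))
      (fun y _ => ?_) (Continuous.intervalIntegrable (by fun_prop) _ _)
    refine (((hasDerivAt_exp_neg y).pow 2).div_const 2).neg.congr_deriv ?_
    simp; ring
  rw [this]
  have := sq_nonneg (Real.exp (-T))
  norm_num
  linarith

/-- `1` minus the mean of `exp (-y)` on `[0, s]`. -/
noncomputable def expDefect (s : ℝ) : ℝ := 1 - (1 - Real.exp (-s)) / s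

theorem integral_exp_mul_hat {s : ℝ} (hs : 0 < s) :
    ∫ y in 0..s, Real.exp (-y) * (1 - y / s) = expDefect s := by
  rw [intervalIntegral.integral_eq_sub_of_hasDerivAt
    (f := fun y => -(Real.exp (-y) * (1 - y / s)) + Real.exp (-y) / s)
    (fun y _ => ?_) (Continuous.intervalIntegrable (by fun_prop) _ _)]
  · simp [expDefect]; field_simp; ring
  · have e := hasDerivAt_exp_neg y
    refine ((e.mul (((hasDerivAt_id y).div_const s).const_sub 1)).neg.add
      (e.div_const s)).congr_deriv ?_
    simp only [id]; ring

theorem integral_hat_sq {s : ℝ} (hs : 0 < s) : ∫ y in 0..s, (1 - y / s) ^ 2 = s / 3 := by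
  rw [intervalIntegral.integral_eq_sub_of_hasDerivAt
    (f := fun y => -(s / 3 * (1 - y / s) ^ 3))
    (fun y _ => ?_) (Continuous.intervalIntegrable (by fun_prop) _ _)]
  · rw [div_self hs.ne']; simp
  · refine (((((hasDerivAt_id y).div_const s).const_sub 1).pow 3).const_mul
      (s / 3)).neg.congr_deriv ?_
    simp only [id]; field_simp; norm_num; field_simp

theorem integral_exp_mul_inv {s : ℝ} (hs : 0 < s) :
    ∫ y in 0..s, Real.exp (-y) * s⁻¹ = 1 - expDefect s := by
  rw [intervalIntegral.integral_eq_sub_of_hasDerivAt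
    (f := fun y => -(Real.exp (-y) * s⁻¹))
    (fun y _ => ?_) (Continuous.intervalIntegrable (by fun_prop) _ _)]
  · simp [expDefect]; field_simp; ring
  · refine ((hasDerivAt_exp_neg y).mul_const s⁻¹).neg.congr_deriv ?_
    ring

section

variable {u u' : ℝ → ℝ}

theorem integral_hat_mul_deriv (hu : ∀ y, HasDerivAt u (u' y) y) (hu' : Continuous u') {s : ℝ}
    (hs : 0 < s) : ∫ y in 0..s, (1 - y / s) * u' y = (∫ y in 0..s, s⁻¹ * u y) - u 0 := by
  have c0 : Continuous u := continuous_iff_continuousAt.2 fun x => (hu x).continuousAt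
  have : ∫ y in 0..s, ((1 - y / s) * u' y - s⁻¹ * u y) = (1 - s / s) * u s - (1 - 0 / s) * u 0 := by
    refine intervalIntegral.integral_eq_sub_of_hasDerivAt (f := fun y => (1 - y / s) * u y)
      (fun y _ => ?_) (Continuous.intervalIntegrable (by fun_prop) _ _)
    refine ((((hasDerivAt_id y).div_const s).const_sub 1).mul (hu y)).congr_deriv ?_
    simp only [id]; ring
  rw [intervalIntegral.integral_sub (Continuous.intervalIntegrable (by fun_prop) _ _)
    (Continuous.intervalIntegrable (by fun_prop) _ _), div_self hs.ne'] at this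
  simp only [zero_div] at this
  linarith

theorem integral_exp_mul_deriv (hu : ∀ y, HasDerivAt u (u' y) y) (hu' : Continuous u') {T : ℝ}
    (hT : u T = 0) : ∫ y in 0..T, Real.exp (-y) * u' y
      = (∫ y in 0..T, Real.exp (-y) * u y) - u 0 := by
  have c0 : Continuous u := continuous_iff_continuousAt.2 fun x => (hu x).continuousAt
  have : ∫ y in 0..T, (Real.exp (-y) * u' y - Real.exp (-y) * u y)
      = Real.exp (-T) * u T - Real.exp (-0) * u 0 := by
    refine intervalIntegral.integral_eq_sub_of_hasDerivAt (f := fun y => Real.exp (-y) * u y)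
      (fun y _ => ?_) (Continuous.intervalIntegrable (by fun_prop) _ _)
    refine ((hasDerivAt_exp_neg y).mul (hu y)).congr_deriv ?_
    ring
  rw [intervalIntegral.integral_sub (Continuous.intervalIntegrable (by fun_prop) _ _)
    (Continuous.intervalIntegrable (by fun_prop) _ _), hT] at this
  simp at this
  linarith

/-- The trace on a short column. -/
theorem trace_sq_le_short_column (hu : ∀ y, HasDerivAt u (u' y) y) (hu' : Continuous u') {s : ℝ}
    (hs : 0 < s) (hs' : s < 9 / 4) :
    4 * u 0 ^ 2 ≤ 36 / (9 - 4 * s) * (∫ y in 0..s, s⁻¹ * u y) ^ 2 + 3 * ∫ y in 0..s, u' y ^ 2 := by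
  have hat := integral_hat_mul_deriv hu hu' hs
  have t := integral_sq_ge_of_test hu' continuous_const (e := fun _ => 0)
    (k := fun y => 1 - y / s) (by fun_prop) hs.le le_rfl 0
    (3 * ((∫ y in 0..s, s⁻¹ * u y) - u 0) / s)
  rw [hat, integral_hat_sq hs] at t
  generalize (∫ y in 0..s, s⁻¹ * u y) = P at *
  generalize (∫ y in 0..s, u' y ^ 2) = N at *
  generalize u 0 = p at *
  have h9 : 0 < 9 - 4 * s := by linarith
  -- Cauchy–Schwarz with the hat `1 - y/s`: its moment of `u'` is `P - u(0)` and its squared norm is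
  -- `s/3`. Three times this bound combines with `P²` into a perfect square, which determines `36/(9
  -- - 4s)`.
  have t' : 3 * (P - p) ^ 2 / s ≤ N := by
    refine le_trans (le_of_eq ?_) t
    simp; field_simp; ring
  have : 4 * p ^ 2 ≤ 36 / (9 - 4 * s) * P ^ 2 + 3 * (3 * (P - p) ^ 2 / s) := by
    have e : 36 / (9 - 4 * s) * P ^ 2 + 3 * (3 * (P - p) ^ 2 / s) - 4 * p ^ 2
      = ((9 - 4 * s) * p - 9 * P) ^ 2 / (s * (9 - 4 * s)) := by
      field_simp; ring
    have : 0 ≤ ((9 - 4 * s) * p - 9 * P) ^ 2 / (s * (9 - 4 * s)) := by positivity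
    linarith
  linarith

/-- The moments of `u'` against `e^{-y}` and against the hat on `[0, s]` are `w - u(0)` and `P -
u(0)`. The first alone gives `4u(0)² ≤ 3∫ u'² + 12w²`, with defect `2(3w - u(0))²`. The second adds
a term that vanishes together with this defect only when `P = (3 - 4i)w`, where `i = expDefect s`;
this is the distance between `P` and `w` gained on the left. -/
theorem trace_sq_le_long_column (hu : ∀ y, HasDerivAt u (u' y) y) (hu' : Continuous u') {s T : ℝ}
    (hs : 0 < s) (hsT : s ≤ T) (hT : u T = 0)
    (hq : 0 < s / 3 - 2 * expDefect s ^ 2) :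
    4 * u 0 ^ 2 + ((1 - 2 * expDefect s) ^ 2 / 2 + (s / 3 - 2 * expDefect s ^ 2) / 3)⁻¹ *
        ((∫ y in 0..s, s⁻¹ * u y)
          - (3 - 4 * expDefect s) * ∫ y in 0..T, Real.exp (-y) * u y) ^ 2
      ≤ 3 * (∫ y in 0..T, u' y ^ 2) + 12 * (∫ y in 0..T, Real.exp (-y) * u y) ^ 2 := by
  have hat := integral_hat_mul_deriv hu hu' hs
  have hexp := integral_exp_mul_deriv hu hu' hT
  set P := ∫ y in 0..s, s⁻¹ * u y
  set w := ∫ y in 0..T, Real.exp (-y) * u y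
  set i := expDefect s with hi
  set q := s / 3 - 2 * i ^ 2 with hqd
  set b := (P - u 0 - 2 * i * (w - u 0)) / q with hb
  have t := integral_sq_ge_of_test hu' (e := fun y => Real.exp (-y)) (by fun_prop)
    (k := fun y => 1 - y / s) (by fun_prop) hs.le hsT (2 * (w - u 0) - 2 * i * b) b
  rw [hat, hexp, integral_hat_sq hs, integral_exp_mul_hat hs, ← hi] at t
  have hE := integral_exp_neg_sq_le T
  generalize (∫ y in 0..T, Real.exp (-y) ^ 2) = E at *
  generalize (∫ y in 0..T, u' y ^ 2) = N at *
  generalize u 0 = p at *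
  clear_value P w i
  have hbq : b * q = P - p - 2 * i * (w - p) := by rw [hb]; field_simp
  have hs3 : s / 3 = q + 2 * i ^ 2 := by rw [hqd]; ring
  clear_value b q
  -- The hat is orthogonalized against `e^{-y}`, whose squared norm is taken as 1/2; then `q = s/3 -
  -- 2i²` is the squared norm of the remainder.
  have t1 : 2 * (w - p) ^ 2 + b ^ 2 * q ≤ N := by
    have := mul_le_mul_of_nonneg_left hE (sq_nonneg (2 * (w - p) - 2 * i * b))
    have key : 2 * (w - p) ^ 2 + b ^ 2 * q = 2 * ((2 * (w - p) - 2 * i * b) * (w - p) + b * (P - p)) -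
      ((2 * (w - p) - 2 * i * b) ^ 2 * (1 / 2) + 2 * (2 * (w - p) - 2 * i * b) * b * i
        + b ^ 2 * (s / 3)) := by
      rw [hs3]; linear_combination 2 * b * hbq
    linarith
  have hden : 0 < (1 - 2 * i) ^ 2 / 2 + q / 3 := by positivity
  -- Weighted Cauchy–Schwarz, since `P - (3 - 4i)w = bq - (1 - 2i)(3w - p)`. The statement then
  -- follows from `6(w - p)² = 4p² - 12w² + 2(3w - p)²`.
  have key : ((1 - 2 * i) ^ 2 / 2 + q / 3)⁻¹ * (P - (3 - 4 * i) * w) ^ 2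
      ≤ 2 * (3 * w - p) ^ 2 + 3 * (b ^ 2 * q) := by
    have hd : P - (3 - 4 * i) * w = b * q - (1 - 2 * i) * (3 * w - p) := by rw [hbq]; ring
    rw [hd, inv_mul_le_iff₀ hden]
    have : ((1 - 2 * i) ^ 2 / 2 + q / 3) * (2 * (3 * w - p) ^ 2 + 3 * (b ^ 2 * q))
        - (b * q - (1 - 2 * i) * (3 * w - p)) ^ 2
        = q * (2 / 3 * (3 * w - p) ^ 2 + 3 / 2 * ((1 - 2 * i) * b) ^ 2
          + 2 * b * ((1 - 2 * i) * (3 * w - p))) := by ring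
    have h2 : 2 / 3 * (3 * w - p) ^ 2 + 3 / 2 * ((1 - 2 * i) * b) ^ 2
          + 2 * b * ((1 - 2 * i) * (3 * w - p))
          = 2 / 3 * ((3 * w - p) + 3 / 2 * ((1 - 2 * i) * b)) ^ 2 := by ring
    rw [h2] at this
    have : 0 ≤ q * (2 / 3 * ((3 * w - p) + 3 / 2 * ((1 - 2 * i) * b)) ^ 2) := by positivity
    linarith
  nlinarith

/-- The test functions `s⁻¹1_[0,s] - (3 - 4i)e^{-y}` and `e^{-y}` have squared norms `g = 1/s - 3/2
+ 2i` and 1/2 and inner product `i - 1/2`, in the limit `T = ∞`. They are not quite orthogonal, and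
`θ` bounds their normalized correlation; the factor `(1 + θ)⁻¹` is the price. -/
theorem moments_sq_le {f : ℝ → ℝ} (hf : Continuous f) {s T θ : ℝ} (hs : 0 < s) (hsT : s ≤ T)
    (hθ : 0 ≤ θ) (hg : 0 < 1 / s - 3 / 2 + 2 * expDefect s)
    (hθ' : 2 * (expDefect s - 1 / 2) ^ 2 ≤ θ ^ 2 * (1 / s - 3 / 2 + 2 * expDefect s)) :
    (1 + θ)⁻¹ * (((∫ y in 0..s, s⁻¹ * f y)
        - (3 - 4 * expDefect s) * ∫ y in 0..T, Real.exp (-y) * f y) ^ 2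
          / (1 / s - 3 / 2 + 2 * expDefect s)
        + 2 * (∫ y in 0..T, Real.exp (-y) * f y) ^ 2) ≤ ∫ y in 0..T, f y ^ 2 := by
  set P := ∫ y in 0..s, s⁻¹ * f y
  set w := ∫ y in 0..T, Real.exp (-y) * f y
  set i := expDefect s with hi
  set g := 1 / s - 3 / 2 + 2 * i with hgd
  set a := (P - (3 - 4 * i) * w) / g / (1 + θ) with ha
  set b := 2 * w / (1 + θ) with hb
  have t := integral_sq_ge_of_test hf (e := fun y => Real.exp (-y)) (by fun_prop)
    (k := fun _ => s⁻¹) (by fun_prop) hs.le hsT (b - (3 - 4 * i) * a) a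
  have hconst : ∫ _ in (0:ℝ)..s, s⁻¹ ^ 2 = 1 / s := by
    simp; field_simp
  rw [integral_exp_mul_inv hs, hconst, ← hi] at t
  have hE := integral_exp_neg_sq_le T
  generalize (∫ y in 0..T, Real.exp (-y) ^ 2) = E at *
  have hP : (∫ y in 0..s, s⁻¹ * f y) = P := rfl
  have hw : (∫ y in 0..T, Real.exp (-y) * f y) = w := rfl
  rw [hP, hw] at t
  generalize (∫ y in 0..T, f y ^ 2) = N at *
  clear_value P w i
  have h1θ : 0 < 1 + θ := by linarith
  obtain ⟨d, hd⟩ : ∃ d, P - (3 - 4 * i) * w = d := ⟨_, rfl⟩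
  have hPd : P = d + (3 - 4 * i) * w := by linarith
  have hs1 : 1 / s = g + 3 / 2 - 2 * i := by rw [hgd]; ring
  rw [hs1, hPd] at t
  rw [hd] at ha
  rw [hd]
  clear_value g
  have t1 : 2 * (a * d + b * w) - (a ^ 2 * g + 2 * a * b * (i - 1 / 2) + b ^ 2 / 2) ≤ N := by
    have := mul_le_mul_of_nonneg_left hE (sq_nonneg (b - (3 - 4 * i) * a))
    refine le_trans ?_ t
    nlinarith
  have t2 : 2 * a * b * (i - 1 / 2) ≤ θ * (a ^ 2 * g + b ^ 2 / 2) := by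
    have h4 : (2 * a * b * (i - 1 / 2)) ^ 2 ≤ (θ * (a ^ 2 * g + b ^ 2 / 2)) ^ 2 := by
      have e1 : (2 * a * b * (i - 1 / 2)) ^ 2 = 2 * (a ^ 2 * b ^ 2) * (2 * (i - 1 / 2) ^ 2) := by ring
      have e2 := mul_le_mul_of_nonneg_left hθ' (by positivity : 0 ≤ 2 * (a ^ 2 * b ^ 2))
      rw [e1]
      refine e2.trans ?_
      have : (θ * (a ^ 2 * g + b ^ 2 / 2)) ^ 2 - 2 * (a ^ 2 * b ^ 2) * (θ ^ 2 * g)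
        = (θ * (a ^ 2 * g - b ^ 2 / 2)) ^ 2 := by ring
      nlinarith [sq_nonneg (θ * (a ^ 2 * g - b ^ 2 / 2))]
    exact (abs_le_of_sq_le_sq' h4 (by positivity)).2
  have fin : (1 + θ)⁻¹ * (d ^ 2 / g + 2 * w ^ 2)
      = 2 * (a * d + b * w) - (1 + θ) * (a ^ 2 * g + b ^ 2 / 2) := by
    rw [ha, hb]; field_simp; ring
  rw [fin]
  linarith

/-- The functional `∫ e^{-y} f + g` has squared norm at most `1/2 + 1 = 3/2` on pairs `(f, g)`. -/
theorem residual_sq_le {f : ℝ → ℝ} (hf : Continuous f) {T : ℝ} (hT : 0 ≤ T) (g : ℝ) :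
    2 / 3 * ((∫ y in 0..T, Real.exp (-y) * f y) + g) ^ 2 ≤ (∫ y in 0..T, f y ^ 2) + g ^ 2 := by
  have t := integral_sq_ge_of_test hf (e := fun y => Real.exp (-y)) (by fun_prop)
    (k := fun _ => 0) continuous_const hT le_rfl
    (2 / 3 * ((∫ y in 0..T, Real.exp (-y) * f y) + g)) 0
  have hE := integral_exp_neg_sq_le T
  generalize (∫ y in 0..T, Real.exp (-y) * f y) = a at *
  generalize (∫ y in 0..T, Real.exp (-y) ^ 2) = E at *
  generalize (∫ y in 0..T, f y ^ 2) = N at *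
  simp at t
  nlinarith [mul_le_mul_of_nonneg_left hE (sq_nonneg (a + g)), sq_nonneg (g - 2 / 3 * (a + g))]

end

/-! ### Numerical parameters for the strip of depth `s` -/

theorem expDefect_bounds {s : ℝ} (hs : 0 < s) (hs' : s ≤ 2 / 5) :
    s / 2 - s ^ 2 / 6 ≤ expDefect s ∧ expDefect s ≤ s / 2 - s ^ 2 / 6 + s ^ 3 / 24 := by
  have h := Real.exp_bound (x := -s) (by rw [abs_neg, abs_of_pos hs]; linarith) (n := 6) (by norm_num)
  rw [abs_neg, abs_of_pos hs, abs_le] at h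
  simp only [Finset.sum_range_succ, Finset.sum_range_zero] at h
  norm_num [Nat.factorial] at h
  obtain ⟨h1, h2⟩ := h
  have e : expDefect s = (s - 1 + Real.exp (-s)) / s := by
    unfold expDefect; field_simp; ring
  have s4 : 0 < s ^ 4 := by positivity
  rw [e, le_div_iff₀ hs, div_le_iff₀ hs]
  have : 0 ≤ s ^ 4 * (2 / 5 - s) := mul_nonneg s4.le (by linarith)
  have : 0 ≤ s ^ 5 * (2 / 5 - s) := mul_nonneg (by positivity) (by linarith)
  have : 0 < s ^ 5 := by positivity
  constructor <;> nlinarith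

/-- As in the other polynomial lemmas below, the difference of the sides is rewritten as a
homogeneous form in `s` and `z = 2/5 - s`; all its coefficients turn out to be nonnegative, which is
a certificate on `[0, 2/5]`. The form `s/2 - s²/6` stands for `expDefect s`. -/
theorem gram_polynomial {s : ℝ} (hs : 0 ≤ s) (hs' : s ≤ 2 / 5) :
    2 * s * (1 / 2 - (s / 2 - s ^ 2 / 6)) ^ 2 ≤
      (7 / 50 + 19 / 20 * s - 21 / 50 * s ^ 2) ^ 2 * (1 - 3 / 2 * s + 2 * s * (s / 2 - s ^ 2 / 6)) := by
  have key : ∀ z : ℝ, 0 ≤ z → 0 ≤ 6125 / 512 * z ^ 7 + 4975 / 256 * s * z ^ 6 + 675 / 256 * s ^ 2 * z ^ 5 + 3917 / 96 * s ^ 3 * z ^ 4 + 369557 / 2560 * s ^ 4 * z ^ 3 + 9545611 / 57600 * s ^ 5 * z ^ 2 + 11860169 / 144000 * s ^ 6 * z + 11018309 / 720000 * s ^ 7 := by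
    intro z hz; positivity
  have := key (2 / 5 - s) (by linarith)
  linarith

theorem outer_riccati_polynomial {s : ℝ} (hs : 0 ≤ s) (hs' : s ≤ 2 / 5) :
    (54 / 5 + 36 * s) ^ 2 *
      ((1 - 2 * (s / 2 - s ^ 2 / 6)) ^ 2 / 2 + (s / 3 - 2 * (s / 2 - s ^ 2 / 6) ^ 2) / 3) *
      ((1 + (7 / 50 + 19 / 20 * s - 21 / 50 * s ^ 2)) * (1 - 3 / 2 * s + 2 * s * (s / 2 - s ^ 2 / 6 + s ^ 3 / 24))) ≤
      (72 * (1 + 3 * s + 3 * s ^ 2)) := by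
  have key : ∀ z : ℝ, 0 ≤ z → 0 ≤ 1346484375 / 4096 * z ^ 12 + 1229765625 / 512 * s * z ^ 11 + 36320484375 / 4096 * s ^ 2 * z ^ 10 + 66269953125 / 2048 * s ^ 3 * z ^ 9 + 252688843125 / 2048 * s ^ 4 * z ^ 8 + 362774228625 / 1024 * s ^ 5 * z ^ 7 + 1407603781125 / 2048 * s ^ 6 * z ^ 6 + 461591960265 / 512 * s ^ 7 * z ^ 5 + 3300466808199 / 4096 * s ^ 8 * z ^ 4 + 497359113141 / 1024 * s ^ 9 * z ^ 3 + 19411462144343 / 102400 * s ^ 10 * z ^ 2 + 2220860280367 / 51200 * s ^ 11 * z + 56682495381 / 12800 * s ^ 12 := by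
    intro z hz; positivity
  have := key (2 / 5 - s) (by linarith)
  linarith

theorem inner_riccati_polynomial {s : ℝ} (hs : 0 ≤ s) (hs' : s ≤ 2 / 5) :
    36 * (51 / 50) ^ 2 ≤ 3 / 50 * (72 * (1 + 3 * s + 3 * s ^ 2)) * (9 - 4 * s) := by
  have key : ∀ z : ℝ, 0 ≤ z → 0 ≤ 891 / 40 * z ^ 3 + 27513 / 40 * s * z ^ 2 + 58833 / 40 * s ^ 2 * z + 150687 / 200 * s ^ 3 := by
    intro z hz; positivity
  have := key (2 / 5 - s) (by linarith)
  linarith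

theorem balance_polynomial {s : ℝ} (hs : 0 ≤ s) (hs' : s ≤ 2 / 5) :
    (3 - 4 * (s / 2 - s ^ 2 / 6)) ^ 2 * (36 * (51 / 50) * (54 / 5 + 36 * s)) ≤
      12 * (1 + (99 / 25 - 9 * s + 93 / 10 * s ^ 2)) * ((54 / 5 + 36 * s) * (9 - 4 * s) - 36 * (51 / 50)) := by
  have key : ∀ z : ℝ, 0 ≤ z → 0 ≤ 23895 / 8 * z ^ 5 + 1070415 / 8 * s * z ^ 4 + 805275 / 4 * s ^ 2 * z ^ 3 + 1291707 / 20 * s ^ 3 * z ^ 2 + 2736747 / 200 * s ^ 4 * z + 3802923 / 200 * s ^ 5 := by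
    intro z hz; positivity
  have := key (2 / 5 - s) (by linarith)
  linarith

theorem slope_polynomial {s : ℝ} (hs : 0 ≤ s) (hs' : s ≤ 2 / 5) :
    (99 / 25 - 9 * s + 93 / 10 * s ^ 2) ^ 2 * (6 * s * (1 + (7 / 50 + 19 / 20 * s - 21 / 50 * s ^ 2))) ≤
      9 / 100 * (72 * (1 + 3 * s + 3 * s ^ 2)) := by
  have key : ∀ z : ℝ, 0 ≤ z → 0 ≤ 31640625 / 512 * z ^ 10 + 144878625 / 512 * s * z ^ 9 + 206337375 / 512 * s ^ 2 * z ^ 8 + 10170765 / 128 * s ^ 3 * z ^ 7 + 21544785 / 256 * s ^ 4 * z ^ 6 + 357716493 / 256 * s ^ 5 * z ^ 5 + 751495455 / 256 * s ^ 6 * z ^ 4 + 1849031523 / 640 * s ^ 7 * z ^ 3 + 3982083201 / 2560 * s ^ 8 * z ^ 2 + 1134549801 / 2560 * s ^ 9 * z + 133273647 / 2560 * s ^ 10 := by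
    intro z hz; positivity
  have := key (2 / 5 - s) (by linarith)
  linarith

theorem weight_polynomial {s : ℝ} (hs : 0 ≤ s) (hs' : s ≤ 2 / 5) :
    330 * s * (1 + (7 / 50 + 19 / 20 * s - 21 / 50 * s ^ 2)) ≤ (72 * (1 + 3 * s + 3 * s ^ 2)) := by
  have key : ∀ z : ℝ, 0 ≤ z → 0 ≤ 1125 * z ^ 3 + 9495 / 4 * s * z ^ 2 + 4515 / 4 * s ^ 2 * z + 93 / 5 * s ^ 3 := by
    intro z hz; positivity
  have := key (2 / 5 - s) (by linarith)
  linarith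


/-- Admissible parameters for the comparison on the strip of depth `s`. -/
structure StripConstants (s θ r κ : ℝ) : Prop where
  θ_nonneg : 0 ≤ θ
  κ_nonneg : 0 ≤ κ
  κ_le : κ ≤ 4
  q_pos : 0 < s / 3 - 2 * expDefect s ^ 2
  g_pos : 0 < 1 / s - 3 / 2 + 2 * expDefect s
  gram : 2 * (expDefect s - 1 / 2) ^ 2 ≤ θ ^ 2 * (1 / s - 3 / 2 + 2 * expDefect s)
  outer : r ^ 2 * ((1 - 2 * expDefect s) ^ 2 / 2 + (s / 3 - 2 * expDefect s ^ 2) / 3) *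
    ((1 + θ) * (1 / s - 3 / 2 + 2 * expDefect s)) ≤ 72 * (1 / s + 3 + 3 * s)
  inner : 36 / (9 - 4 * s) * (51 / 50) ^ 2 ≤ 3 / 50 * (72 * (1 / s + 3 + 3 * s)) * s
  r_gt : 36 / (9 - 4 * s) * (51 / 50) < r
  balance : (3 - 4 * expDefect s) ^ 2 * (36 / (9 - 4 * s) * (51 / 50) * r) ≤
    12 * (1 + κ) * (r - 36 / (9 - 4 * s) * (51 / 50))
  slope : κ ^ 2 ≤ 9 / 100 * (72 * (1 / s + 3 + 3 * s) / (1 + θ) / 6)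
  weight : 55 ≤ 72 * (1 / s + 3 + 3 * s) / (1 + θ) / 6

set_option maxHeartbeats 1000000 in
-- Polynomials in `s` are taken for `θ`, `r` and `κ`. After multiplication by `s`, clearing of `9 -
-- 4s`, and insertion of the Taylor bounds for `expDefect s`, each remaining condition is one of the
-- polynomial inequalities above.
theorem exists_stripConstants {s : ℝ} (hs : 0 < s) (hs' : s ≤ 2 / 5) :
    ∃ θ r κ, StripConstants s θ r κ := by
  obtain ⟨hl, hu⟩ := expDefect_bounds hs hs'
  set i := expDefect s with hi
  clear_value i
  have hDs : s * (72 * (1 / s + 3 + 3 * s)) = 72 * (1 + 3 * s + 3 * s ^ 2) := by field_simp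
  have hg : s * (1 / s - 3 / 2 + 2 * i) = 1 - 3 / 2 * s + 2 * s * i := by field_simp
  have hl0 : 0 < s / 2 - s ^ 2 / 6 := by nlinarith
  have hi2 : i ≤ s / 2 := by nlinarith [pow_pos hs 2]
  have hi5 : i ≤ 1 / 5 := by linarith
  have h9 : 0 < 9 - 4 * s := by linarith
  have hq : 0 < s / 3 - 2 * i ^ 2 := by
    have : i * i ≤ 1 / 5 * (s / 2) := mul_le_mul hi5 hi2 (by linarith) (by norm_num)
    linarith
  have hgs : 0 < 1 - 3 / 2 * s + 2 * s * i := by nlinarith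
  have hg0 : 0 < 1 / s - 3 / 2 + 2 * i := by
    rw [← hg] at hgs; exact pos_of_mul_pos_right hgs hs.le
  obtain ⟨θ, hθ⟩ : ∃ θ, 7 / 50 + 19 / 20 * s - 21 / 50 * s ^ 2 = θ := ⟨_, rfl⟩
  obtain ⟨r, hr⟩ : ∃ r, 54 / 5 + 36 * s = r := ⟨_, rfl⟩
  obtain ⟨κ, hκ⟩ : ∃ κ, 99 / 25 - 9 * s + 93 / 10 * s ^ 2 = κ := ⟨_, rfl⟩
  have p2 := gram_polynomial hs.le hs'
  have p3 := outer_riccati_polynomial hs.le hs'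
  have p4 := inner_riccati_polynomial hs.le hs'
  have p5 := balance_polynomial hs.le hs'
  have p6 := slope_polynomial hs.le hs'
  have p7 := weight_polynomial hs.le hs'
  rw [hθ] at p2 p3 p6 p7
  rw [hr] at p3 p5
  rw [hκ] at p5 p6
  have hθ0 : 0 ≤ θ := by rw [← hθ]; nlinarith
  have hκ0 : 0 ≤ κ := by rw [← hκ]; nlinarith [sq_nonneg (s - 1 / 2)]
  have hκ4 : κ ≤ 4 := by rw [← hκ]; nlinarith
  have hr10 : 54 / 5 ≤ r := by rw [← hr]; linarith
  have hα : 36 / (9 - 4 * s) * (51 / 50) < r := by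
    rw [div_mul_eq_mul_div, div_lt_iff₀ h9]; nlinarith
  refine ⟨θ, r, κ, hθ0, hκ0, hκ4, ?_, hi ▸ hg0, ?_, ?_, ?_, hα, ?_, ?_, ?_⟩ <;>
    try simp only [← hi]
  · exact hq
  · refine le_of_mul_le_mul_left ?_ hs
    have e1 : (i - 1 / 2) ^ 2 ≤ (1 / 2 - (s / 2 - s ^ 2 / 6)) ^ 2 := by
      rw [sq_le_sq, abs_of_nonpos (by linarith), abs_of_nonneg (by linarith)]; linarith
    calc s * (2 * (i - 1 / 2) ^ 2) ≤ 2 * s * (1 / 2 - (s / 2 - s ^ 2 / 6)) ^ 2 := by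
          linarith [mul_le_mul_of_nonneg_left e1 hs.le]
      _ ≤ _ := p2
      _ ≤ θ ^ 2 * (1 - 3 / 2 * s + 2 * s * i) := by gcongr
      _ = _ := by rw [← hg]; ring
  · refine le_of_mul_le_mul_left ?_ hs
    -- This factor decreases in `i` on the relevant range, so the lower Taylor bound is used here,
    -- while the factor `1 - 3/2 s + 2si` takes the upper one.
    have e1 : (1 - 2 * i) ^ 2 / 2 + (s / 3 - 2 * i ^ 2) / 3 ≤
        (1 - 2 * (s / 2 - s ^ 2 / 6)) ^ 2 / 2 + (s / 3 - 2 * (s / 2 - s ^ 2 / 6) ^ 2) / 3 := by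
      nlinarith [mul_nonneg (sub_nonneg.2 hl) (by linarith : 0 ≤ 2 - 4 / 3 * (i + (s / 2 - s ^ 2 / 6)))]
    have e0 : 0 ≤ (1 - 2 * (s / 2 - s ^ 2 / 6)) ^ 2 / 2 + (s / 3 - 2 * (s / 2 - s ^ 2 / 6) ^ 2) / 3 := by
      nlinarith [sq_nonneg (1 - 2 * (s / 2 - s ^ 2 / 6))]
    calc s * (r ^ 2 * ((1 - 2 * i) ^ 2 / 2 + (s / 3 - 2 * i ^ 2) / 3) *
          ((1 + θ) * (1 / s - 3 / 2 + 2 * i)))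
        = r ^ 2 * ((1 - 2 * i) ^ 2 / 2 + (s / 3 - 2 * i ^ 2) / 3) *
          ((1 + θ) * (1 - 3 / 2 * s + 2 * s * i)) := by rw [← hg]; ring
      _ ≤ _ := by gcongr
      _ ≤ _ := p3
      _ = _ := hDs.symm
  · rw [mul_assoc, mul_comm (72 * (1 / s + 3 + 3 * s)) s, hDs, div_mul_eq_mul_div, div_le_iff₀ h9]
    linarith
  · have e1 : (3 - 4 * i) ^ 2 ≤ (3 - 4 * (s / 2 - s ^ 2 / 6)) ^ 2 :=
      pow_le_pow_left₀ (by linarith) (by linarith) 2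
    have e2 : (3 - 4 * i) ^ 2 * (36 * (51 / 50) * r) ≤
      (3 - 4 * (s / 2 - s ^ 2 / 6)) ^ 2 * (36 * (51 / 50) * r) := by gcongr
    have e3 := (div_le_div_iff_of_pos_right h9).2 (e2.trans p5)
    refine le_trans (le_of_eq ?_) (e3.trans (le_of_eq ?_))
    · field_simp
    · field_simp
  · have : 72 * (1 / s + 3 + 3 * s) = 72 * (1 + 3 * s + 3 * s ^ 2) / s := by
      rw [← hDs]; field_simp
    rw [this, div_div, div_div, ← mul_div_assoc, le_div_iff₀ (by positivity)]
    linarith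
  · have : 72 * (1 / s + 3 + 3 * s) = 72 * (1 + 3 * s + 3 * s ^ 2) / s := by
      rw [← hDs]; field_simp
    rw [this, div_div, div_div, le_div_iff₀ (by positivity)]
    linarith

/-! ### Partial derivatives on `ℝ × ℝ` and integrals over columns -/

/-- The derivative in the first variable. -/
noncomputable def dX (F : ℝ × ℝ → ℝ) (p : ℝ × ℝ) : ℝ := fderiv ℝ F p (1, 0)

/-- The derivative in the second variable. -/
noncomputable def dY (F : ℝ × ℝ → ℝ) (p : ℝ × ℝ) : ℝ := fderiv ℝ F p (0, 1)

section

variable {F : ℝ × ℝ → ℝ}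

theorem contDiff_dX (hF : ContDiff ℝ ∞ F) : ContDiff ℝ ∞ (dX F) :=
  (hF.fderiv_right (m := ∞) (by simp)).clm_apply contDiff_const

theorem contDiff_dY (hF : ContDiff ℝ ∞ F) : ContDiff ℝ ∞ (dY F) :=
  (hF.fderiv_right (m := ∞) (by simp)).clm_apply contDiff_const

theorem hasDerivAt_dX (hF : ContDiff ℝ ∞ F) (x y : ℝ) :
    HasDerivAt (fun x => F (x, y)) (dX F (x, y)) x := by
  have h := (hF.differentiable (by simp) (x, y)).hasFDerivAt
  exact h.comp_hasDerivAt x ((hasDerivAt_id x).prodMk (hasDerivAt_const x y))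

theorem hasDerivAt_dY (hF : ContDiff ℝ ∞ F) (x y : ℝ) :
    HasDerivAt (fun y => F (x, y)) (dY F (x, y)) y := by
  have h := (hF.differentiable (by simp) (x, y)).hasFDerivAt
  exact h.comp_hasDerivAt y ((hasDerivAt_const y x).prodMk (hasDerivAt_id y))

theorem tsupport_dX_subset : tsupport (dX F) ⊆ tsupport F :=
  (closure_mono fun p hp => by
    contrapose! hp
    simp only [Function.mem_support, not_not] at hp ⊢
    simp [dX, hp]).trans (tsupport_fderiv_subset ℝ (f := F))

theorem tsupport_dY_subset : tsupport (dY F) ⊆ tsupport F :=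
  (closure_mono fun p hp => by
    contrapose! hp
    simp only [Function.mem_support, not_not] at hp ⊢
    simp [dY, hp]).trans (tsupport_fderiv_subset ℝ (f := F))

theorem continuous_columnIntegral {k : ℝ → ℝ} (hk : Continuous k) {G : ℝ × ℝ → ℝ}
    (hG : Continuous G) (a b : ℝ) : Continuous fun x => ∫ y in a..b, k y * G (x, y) :=
  intervalIntegral.continuous_parametric_intervalIntegral_of_continuous'
    (by simp only [Function.uncurry_def]; fun_prop) a b

theorem hasDerivAt_columnIntegral {k : ℝ → ℝ} (hk : Continuous k) (hF : ContDiff ℝ ∞ F)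
    (a b x : ℝ) : HasDerivAt (fun x => ∫ y in a..b, k y * F (x, y))
      (∫ y in a..b, k y * dX F (x, y)) x := by
  have hFc := hF.continuous
  have hdc := (contDiff_dX hF).continuous
  obtain ⟨C, hC⟩ := ((isCompact_closedBall x 1).prod (isCompact_uIcc (a := a) (b := b))).exists_bound_of_continuousOn
    (f := fun q : ℝ × ℝ => k q.2 * dX F q) (by fun_prop)
  refine (intervalIntegral.hasDerivAt_integral_of_dominated_loc_of_deriv_le
    (F := fun x y => k y * F (x, y)) (F' := fun x y => k y * dX F (x, y))
    (bound := fun _ => C) (Metric.ball_mem_nhds x one_pos) ?_ ?_ ?_ ?_ ?_ ?_).2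
  · exact Filter.Eventually.of_forall fun x => Continuous.aestronglyMeasurable (by fun_prop)
  · exact Continuous.intervalIntegrable (by fun_prop) _ _
  · exact Continuous.aestronglyMeasurable (by fun_prop)
  · refine Filter.Eventually.of_forall fun y hy z hz => ?_
    exact hC (z, y) ⟨Metric.ball_subset_closedBall hz, uIoc_subset_uIcc hy⟩
  · exact intervalIntegrable_const
  · exact Filter.Eventually.of_forall fun y _ z _ => (hasDerivAt_dX hF z y).const_mul (k y)

end

/-! ### The inequality on a quarter plane -/

section

variable {F : ℝ × ℝ → ℝ}

/-- The short-column bound leaves `∫ α P²` with `α = 36/(9 - 4s)`. It is integrated with the weight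
`αx(1 + x²/(50L²))`, which vanishes at `x = 0` and is `51/50 αL` at `x = L`. The cubic part supplies
an extra `3/50 α(x/L)²P²`, so that the cross term in `P P'` can be absorbed by `s P'² ≤ ∫ u_x²`. -/
theorem inner_strip_inequality (hF : ContDiff ℝ ∞ F) {L s D : ℝ} (hL : 0 < L) (hs : 0 < s)
    (hs' : s ≤ 2 / 5) (hD : 0 < D) (hinner : 36 / (9 - 4 * s) * (51 / 50) ^ 2 ≤ 3 / 50 * D * s) :
    ∫ x in 0..L, 4 * F (x, 0) ^ 2 ≤ (∫ x in 0..L, (3 * (∫ y in 0..s, dY F (x, y) ^ 2)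
        + D * L ^ 2 * ∫ y in 0..s, dX F (x, y) ^ 2))
      + 36 / (9 - 4 * s) * (51 / 50) * L * (∫ y in 0..s, s⁻¹ * F (L, y)) ^ 2 := by
  have hFc := hF.continuous
  have hXc := (contDiff_dX hF).continuous
  have hYc := (contDiff_dY hF).continuous
  have h9 : 0 < 9 - 4 * s := by linarith
  set α := 36 / (9 - 4 * s) with hα
  have hα0 : 0 < α := by positivity
  have hn : Continuous fun x => ∫ y in 0..s, dY F (x, y) ^ 2 := by
    simpa using continuous_columnIntegral (k := fun _ => 1) continuous_const
      (G := fun q => dY F q ^ 2) (by fun_prop) 0 s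
  have hm : Continuous fun x => ∫ y in 0..s, dX F (x, y) ^ 2 := by
    simpa using continuous_columnIntegral (k := fun _ => 1) continuous_const
      (G := fun q => dX F q ^ 2) (by fun_prop) 0 s
  have hP := hasDerivAt_columnIntegral (k := fun _ => s⁻¹) continuous_const hF 0 s
  have main := sub_le_integral_of_deriv_le hL.le
    (g := fun x => -((α * x + α / 50 / L ^ 2 * x ^ 3) * (∫ y in 0..s, s⁻¹ * F (x, y)) ^ 2))
    (g' := fun x => -((α + α / 50 / L ^ 2 * (3 * x ^ 2)) * (∫ y in 0..s, s⁻¹ * F (x, y)) ^ 2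
      + (α * x + α / 50 / L ^ 2 * x ^ 3) * (2 * (∫ y in 0..s, s⁻¹ * F (x, y))
        * ∫ y in 0..s, s⁻¹ * dX F (x, y))))
    (φ := fun x => (3 * (∫ y in 0..s, dY F (x, y) ^ 2)
        + D * L ^ 2 * ∫ y in 0..s, dX F (x, y) ^ 2) - 4 * F (x, 0) ^ 2) ?_ (by fun_prop) ?_
  rotate_left
  · intro x _
    have e := ((((hasDerivAt_id x).const_mul α).add ((hasDerivAt_pow 3 x).const_mul
      (α / 50 / L ^ 2))).mul ((hP x).pow 2)).neg
    refine e.congr_deriv ?_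
    simp
  · intro x hx
    have t1 := trace_sq_le_short_column (u := fun y => F (x, y)) (u' := fun y => dY F (x, y))
      (hasDerivAt_dY hF x) (by fun_prop) hs (by linarith)
    have t2 := integral_sq_ge_of_test (f := fun y => dX F (x, y)) (by fun_prop)
      (continuous_const (y := (0 : ℝ))) (k := fun _ => s⁻¹) continuous_const hs.le le_rfl 0
      (s * ∫ y in 0..s, s⁻¹ * dX F (x, y))
    have hconst : ∫ _ in (0:ℝ)..s, s⁻¹ ^ 2 = 1 / s := by simp; field_simp
    rw [hconst] at t2
    rw [← hα] at t1
    generalize (∫ y in 0..s, s⁻¹ * F (x, y)) = P at *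
    generalize (∫ y in 0..s, s⁻¹ * dX F (x, y)) = P1 at *
    generalize (∫ y in 0..s, dX F (x, y) ^ 2) = m at *
    generalize (∫ y in 0..s, dY F (x, y) ^ 2) = n at *
    have t3 : s * P1 ^ 2 ≤ m := by
      refine le_trans (le_of_eq ?_) t2
      field_simp
      ring
    have t4 := mul_le_mul_of_nonneg_left t3 (by positivity : 0 ≤ D * L ^ 2)
    set ξ := x / L with hξ
    have hx' : x = ξ * L := by rw [hξ]; field_simp
    have hξ0 : 0 ≤ ξ := div_nonneg hx.1 hL.le
    have hξ1 : ξ ≤ 1 := (div_le_one hL).2 hx.2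
    clear_value ξ
    have e1 : α + α / 50 / L ^ 2 * (3 * x ^ 2) = α + 3 / 50 * α * ξ ^ 2 := by
      rw [hx']; field_simp
    have e2 : α * x + α / 50 / L ^ 2 * x ^ 3 = α * (1 + ξ ^ 2 / 50) * (ξ * L) := by
      rw [hx']; field_simp
    rw [e1, e2]
    have e3 : (1 + ξ ^ 2 / 50) ^ 2 ≤ (51 / 50) ^ 2 :=
      pow_le_pow_left₀ (by positivity) (by nlinarith) 2
    have e4 : α * (1 + ξ ^ 2 / 50) ^ 2 ≤ 3 / 50 * D * s :=
      (mul_le_mul_of_nonneg_left e3 hα0.le).trans hinner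
    have e5 : 0 ≤ D * L ^ 2 * (s * P1 ^ 2) + 3 / 50 * α * ξ ^ 2 * P ^ 2
        + α * (1 + ξ ^ 2 / 50) * (ξ * L) * (2 * P * P1) := by
      have := mul_le_mul_of_nonneg_right e4 (sq_nonneg (L * P1))
      have e6 : 0 ≤ α * (50 / 3 * ((1 + ξ ^ 2 / 50) * (L * P1)) ^ 2 + 3 / 50 * (ξ * P) ^ 2
        + 2 * ((1 + ξ ^ 2 / 50) * (L * P1)) * (ξ * P)) := by
        refine mul_nonneg hα0.le ?_
        nlinarith [sq_nonneg (50 / 3 * ((1 + ξ ^ 2 / 50) * (L * P1)) + (ξ * P))]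
      linarith
    linarith
  rw [intervalIntegral.integral_sub (Continuous.intervalIntegrable (by fun_prop) _ _)
    (Continuous.intervalIntegrable (by fun_prop) _ _)] at main
  have e : α * L + α / 50 / L ^ 2 * L ^ 3 = α * (51 / 50) * L := by field_simp; ring
  simp only [e] at main
  simp at main ⊢
  linarith

set_option maxHeartbeats 1000000 in
-- In each column the trace bound, `18x²` times the residual bound and `DL²` times the moment bound
-- are added, where `D = 72(1/s + 3 + 3s)`. The `w`-terms form twelve times the density of the
-- one-dimensional inequality with `β = D/(6(1 + θ))`. The terms in `δ = P - (3 - 4i)w` and `δ'`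
-- dominate the derivative of `-rLδ²`, which produces the boundary term at `x = L`.
theorem outer_strip_inequality (hF : ContDiff ℝ ∞ F) {L s T θ r κ : ℝ} (hL : 0 < L) (hs : 0 < s)
    (hc : StripConstants s θ r κ) (hT4 : 4 ≤ T) (hsT : s ≤ T) (hLT : L ≤ T)
    (hT : ∀ x y, (T ≤ |x| ∨ T ≤ |y|) → (x, y) ∉ tsupport F) :
    (∫ x in L..T, 4 * F (x, 0) ^ 2) + r * L * ((∫ y in 0..s, s⁻¹ * F (L, y))
          - (3 - 4 * expDefect s) * ∫ y in 0..T, Real.exp (-y) * F (L, y)) ^ 2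
        + 12 * ((1 + κ) * (L * (∫ y in 0..T, Real.exp (-y) * F (L, y)) ^ 2))
      ≤ ∫ x in L..T, (3 * (∫ y in 0..T, dY F (x, y) ^ 2)
        + 18 * (x ^ 2 * ((∫ y in 0..T, (dX (dX F) (x, y) + dY (dY F) (x, y)) ^ 2)
          + (dY F (x, 0) + F (x, 0)) ^ 2))
        + 72 * (1 / s + 3 + 3 * s) * L ^ 2 * ∫ y in 0..T, dX F (x, y) ^ 2) := by
  have hFc := hF.continuous
  have hX := contDiff_dX hF
  have hY := contDiff_dY hF
  have hXc := hX.continuous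
  have hYc := hY.continuous
  have hXXc := (contDiff_dX hX).continuous
  have hYYc := (contDiff_dY hY).continuous
  have hT0 : 0 < T := by linarith
  have zero : ∀ x y, (T ≤ |x| ∨ T ≤ |y|) → F (x, y) = 0 := fun x y h =>
    image_eq_zero_of_notMem_tsupport (hT x y h)
  have zeroX : ∀ x y, (T ≤ |x| ∨ T ≤ |y|) → dX F (x, y) = 0 := fun x y h =>
    image_eq_zero_of_notMem_tsupport fun h' => hT x y h (tsupport_dX_subset h')
  have zeroY : ∀ x y, (T ≤ |x| ∨ T ≤ |y|) → dY F (x, y) = 0 := fun x y h =>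
    image_eq_zero_of_notMem_tsupport fun h' => hT x y h (tsupport_dY_subset h')
  have hN : Continuous fun x => ∫ y in 0..T, dY F (x, y) ^ 2 := by
    simpa using continuous_columnIntegral (k := fun _ => 1) continuous_const
      (G := fun q => dY F q ^ 2) (by fun_prop) 0 T
  have hM : Continuous fun x => ∫ y in 0..T, dX F (x, y) ^ 2 := by
    simpa using continuous_columnIntegral (k := fun _ => 1) continuous_const
      (G := fun q => dX F q ^ 2) (by fun_prop) 0 T
  have hR : Continuous fun x => ∫ y in 0..T, (dX (dX F) (x, y) + dY (dY F) (x, y)) ^ 2 := by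
    simpa using continuous_columnIntegral (k := fun _ => 1) continuous_const
      (G := fun q => (dX (dX F) q + dY (dY F) q) ^ 2) (by fun_prop) 0 T
  have hexp : Continuous fun y : ℝ => Real.exp (-y) := by fun_prop
  have hw := hasDerivAt_columnIntegral hexp hF 0 T
  have hw1 := hasDerivAt_columnIntegral hexp hX 0 T
  have hw2 := continuous_columnIntegral hexp hXXc 0 T
  have hP := hasDerivAt_columnIntegral (k := fun _ => s⁻¹) continuous_const hF 0 s
  have hP1c := continuous_columnIntegral (k := fun _ => s⁻¹) continuous_const hXc 0 s
  set w := fun x => ∫ y in 0..T, Real.exp (-y) * F (x, y) with hwd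
  set w1 := fun x => ∫ y in 0..T, Real.exp (-y) * dX F (x, y) with hw1d
  set w2 := fun x => ∫ y in 0..T, Real.exp (-y) * dX (dX F) (x, y) with hw2d
  set P := fun x => ∫ y in 0..s, s⁻¹ * F (x, y) with hPd
  set P1 := fun x => ∫ y in 0..s, s⁻¹ * dX F (x, y) with hP1d
  replace hw : ∀ x, HasDerivAt w (w1 x) x := hw
  replace hw1 : ∀ x, HasDerivAt w1 (w2 x) x := hw1
  replace hP : ∀ x, HasDerivAt P (P1 x) x := hP
  have hTa : T ≤ |T| := le_abs_self T
  have wT : w T = 0 := by simp only [hwd, zero T _ (Or.inl hTa)]; simp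
  have w1T : w1 T = 0 := by simp only [hw1d, zeroX T _ (Or.inl hTa)]; simp
  have PT : P T = 0 := by simp only [hPd, zero T _ (Or.inl hTa)]; simp
  have wc : Continuous w := continuous_iff_continuousAt.2 fun x => (hw x).continuousAt
  have w1c : Continuous w1 := continuous_iff_continuousAt.2 fun x => (hw1 x).continuousAt
  have Pc : Continuous P := continuous_iff_continuousAt.2 fun x => (hP x).continuousAt
  have hq := hc.q_pos
  have hg := hc.g_pos
  have hgram := hc.gram
  have hslope := hc.slope
  have hθ := hc.θ_nonneg
  set D := 72 * (1 / s + 3 + 3 * s) with hD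
  set i := expDefect s with hi
  set g := 1 / s - 3 / 2 + 2 * i with hgd
  set lam := (1 - 2 * i) ^ 2 / 2 + (s / 3 - 2 * i ^ 2) / 3 with hlam
  have hlam0 : 0 < lam := by positivity
  set β := D / (1 + θ) / 6 with hβ
  have hone := one_dimensional_inequality hw hw1 hw2 (β := β) hc.weight hc.κ_nonneg hc.κ_le hslope
    hL hLT hT4 wT w1T
  have hdens := continuous_density hw hw1 hw2 (β * L ^ 2)
  -- The discriminant condition for the quadratic form in `δ` and `δ'`; it is the condition `outer`
  -- on `r`.
  have hdiff : (r * L) ^ 2 ≤ lam⁻¹ * (D * L ^ 2 / (1 + θ) / g) := by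
    have hout : r ^ 2 * lam * ((1 + θ) * g) ≤ D := hc.outer
    rw [inv_mul_eq_div, le_div_iff₀ hlam0, le_div_iff₀ hg, le_div_iff₀ (by linarith)]
    have := mul_le_mul_of_nonneg_right hout (sq_nonneg L)
    linarith
  have main := sub_le_integral_of_deriv_le hLT
    (g := fun x => -(r * L * (P x - (3 - 4 * i) * w x) ^ 2))
    (g' := fun x => -(r * L * (2 * (P x - (3 - 4 * i) * w x) * (P1 x - (3 - 4 * i) * w1 x))))
    (φ := fun x => (3 * (∫ y in 0..T, dY F (x, y) ^ 2)
        + 18 * (x ^ 2 * ((∫ y in 0..T, (dX (dX F) (x, y) + dY (dY F) (x, y)) ^ 2)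
          + (dY F (x, 0) + F (x, 0)) ^ 2))
        + D * L ^ 2 * ∫ y in 0..T, dX F (x, y) ^ 2) - 4 * F (x, 0) ^ 2
        - 12 * density (β * L ^ 2) w w1 w2 x) ?_ (by fun_prop) ?_
  rotate_left
  · intro x _
    have e := ((((hP x).sub ((hw x).const_mul (3 - 4 * i))).pow 2).const_mul (r * L)).neg
    refine e.congr_deriv ?_
    simp
  · intro x hx
    have t1 := trace_sq_le_long_column (u := fun y => F (x, y)) (u' := fun y => dY F (x, y))
      (hasDerivAt_dY hF x) (by fun_prop) hs hsT (zero x T (Or.inr hTa)) hq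
    have t2 := moments_sq_le (f := fun y => dX F (x, y)) (by fun_prop) hs hsT hθ hg hgram
    have t3 := residual_sq_le (f := fun y => dX (dX F) (x, y) + dY (dY F) (x, y)) (by fun_prop)
      hT0.le (dY F (x, 0) + F (x, 0))
    have p1 := integral_exp_mul_deriv (hasDerivAt_dY hF x) (by fun_prop) (zero x T (Or.inr hTa))
    have p2 := integral_exp_mul_deriv (hasDerivAt_dY hY x) (by fun_prop) (zeroY x T (Or.inr hTa))
    have p3 : (∫ y in 0..T, Real.exp (-y) * (dX (dX F) (x, y) + dY (dY F) (x, y)))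
        = w2 x + ∫ y in 0..T, Real.exp (-y) * dY (dY F) (x, y) := by
      simp only [mul_add]
      exact intervalIntegral.integral_add (Continuous.intervalIntegrable (by fun_prop) _ _)
        (Continuous.intervalIntegrable (by fun_prop) _ _)
    have p4 : (∫ y in 0..T, Real.exp (-y) * (dX (dX F) (x, y) + dY (dY F) (x, y)))
        + (dY F (x, 0) + F (x, 0)) = w2 x + w x := by
      rw [p3, p2, p1]; ring
    rw [p4] at t3
    have hwx : (∫ y in 0..T, Real.exp (-y) * F (x, y)) = w x := rfl
    have hw1x : (∫ y in 0..T, Real.exp (-y) * dX F (x, y)) = w1 x := rfl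
    have hPx : (∫ y in 0..s, s⁻¹ * F (x, y)) = P x := rfl
    have hP1x : (∫ y in 0..s, s⁻¹ * dX F (x, y)) = P1 x := rfl
    rw [hwx, hPx, ← hi, ← hlam] at t1
    rw [hw1x, hP1x, ← hi, ← hgd] at t2
    unfold density
    clear p1 p2 p3 p4 hwx hw1x hPx hP1x hone
    generalize (∫ y in 0..T, (dX (dX F) (x, y) + dY (dY F) (x, y)) ^ 2) = R at *
    generalize (∫ y in 0..T, dY F (x, y) ^ 2) = N at *
    generalize (∫ y in 0..T, dX F (x, y) ^ 2) = M at *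
    have hDp : 0 < D := by positivity
    have t3' := mul_le_mul_of_nonneg_left t3 (by positivity : 0 ≤ 18 * x ^ 2)
    have t2' := mul_le_mul_of_nonneg_left t2 (by positivity : 0 ≤ D * L ^ 2)
    have b1 : 12 * (β * L ^ 2 * w1 x ^ 2) = D * L ^ 2 * ((1 + θ)⁻¹ * (2 * w1 x ^ 2)) := by
      rw [hβ]; field_simp; ring
    generalize P x - (3 - 4 * i) * w x = δ at *
    generalize P1 x - (3 - 4 * i) * w1 x = δ1 at *
    have t4 : 0 ≤ lam⁻¹ * δ ^ 2 + D * L ^ 2 / (1 + θ) / g * δ1 ^ 2 + r * L * (2 * δ * δ1) := by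
      have h5 : 0 ≤ lam⁻¹ * δ ^ 2 + r * L * (2 * δ * δ1) + (r * L) ^ 2 * lam * δ1 ^ 2 := by
        have : lam⁻¹ * δ ^ 2 + r * L * (2 * δ * δ1) + (r * L) ^ 2 * lam * δ1 ^ 2
          = lam⁻¹ * (δ + r * L * lam * δ1) ^ 2 := by field_simp; ring
        rw [this]; positivity
      have h6 := mul_le_mul_of_nonneg_right hdiff (by positivity : 0 ≤ lam * δ1 ^ 2)
      have h7 : lam⁻¹ * (D * L ^ 2 / (1 + θ) / g) * (lam * δ1 ^ 2)
        = D * L ^ 2 / (1 + θ) / g * δ1 ^ 2 := by field_simp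
      rw [h7] at h6
      linarith
    have b2 : D * L ^ 2 / (1 + θ) / g * δ1 ^ 2 = D * L ^ 2 * ((1 + θ)⁻¹ * (δ1 ^ 2 / g)) := by
      field_simp
    rw [b2] at t4
    linarith
  rw [intervalIntegral.integral_sub (Continuous.intervalIntegrable (by fun_prop) _ _)
    (Continuous.intervalIntegrable (by fun_prop) _ _),
    intervalIntegral.integral_sub (Continuous.intervalIntegrable (by fun_prop) _ _)
    (Continuous.intervalIntegrable (by fun_prop) _ _), intervalIntegral.integral_const_mul] at main
  simp only [PT, wT] at main
  change _ + r * L * (P L - (3 - 4 * i) * w L) ^ 2 + 12 * ((1 + κ) * (L * w L ^ 2)) ≤ _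
  simp only [intervalIntegral.integral_const_mul] at main hone ⊢
  linarith

/-- The inner and outer estimates are glued at `x = L`. The boundary terms there form a quadratic
form in `P(L)` and `w(L)` with the right sign, by the condition `balance`. -/
theorem quarter_plane_inequality (hF : ContDiff ℝ ∞ F) {L h T : ℝ} (hL : 0 < L) (hh : 0 < h)
    (hT4 : 4 ≤ T) (hhT : h ≤ T) (hLT : L ≤ T)
    (hT : ∀ x y, (T ≤ |x| ∨ T ≤ |y|) → (x, y) ∉ tsupport F) :
    ∫ x in 0..T, 4 * F (x, 0) ^ 2 ≤
      (∫ x in 0..L, (3 * (∫ y in 0..h, dY F (x, y) ^ 2)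
        + 72 * (L ^ 2 / h) * (1 + h) ^ 3 * ∫ y in 0..h, dX F (x, y) ^ 2))
      + ∫ x in L..T, (3 * (∫ y in 0..T, dY F (x, y) ^ 2)
        + 18 * (x ^ 2 * ((∫ y in 0..T, (dX (dX F) (x, y) + dY (dY F) (x, y)) ^ 2)
          + (dY F (x, 0) + F (x, 0)) ^ 2))
        + 72 * (L ^ 2 / h) * (1 + h) ^ 3 * ∫ y in 0..T, dX F (x, y) ^ 2) := by
  have hFc := hF.continuous
  have hX := contDiff_dX hF
  have hY := contDiff_dY hF
  have hXc := hX.continuous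
  have hYc := hY.continuous
  have hXXc := (contDiff_dX hX).continuous
  have hYYc := (contDiff_dY hY).continuous
  -- The constant improves with the depth only up to a point: `(1 + h)³/h = 1/h + 3 + 3h + h²` is
  -- least at `h = 1/2`, with value `27/4`. The value of `1/s + 3 + 3s` at `s = 2/5` is 6.7, already
  -- below this, so deeper strips need not be used.
  set s := min h (2 / 5) with hs
  have hs0 : 0 < s := lt_min hh (by norm_num)
  have hs25 : s ≤ 2 / 5 := min_le_right _ _
  have hsh : s ≤ h := min_le_left _ _
  obtain ⟨θ, r, κ, hc⟩ := exists_stripConstants hs0 hs25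
  set D := 72 * (1 / s + 3 + 3 * s) with hD
  have hD0 : 0 < D := by positivity
  have hDC : D * L ^ 2 ≤ 72 * (L ^ 2 / h) * (1 + h) ^ 3 := by
    have e : 72 * (L ^ 2 / h) * (1 + h) ^ 3 = 72 * (1 / h + 3 + 3 * h + h ^ 2) * L ^ 2 := by
      field_simp; ring
    rw [e]
    refine mul_le_mul_of_nonneg_right ?_ (sq_nonneg L)
    rw [hD]
    rcases le_total h (2 / 5) with h1 | h1
    · rw [hs, min_eq_left h1]; nlinarith
    · rw [hs, min_eq_right h1]
      have : 27 / 4 ≤ 1 / h + 3 + 3 * h + h ^ 2 := by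
        have e2 : 1 / h + 3 + 3 * h + h ^ 2 = (1 + h) ^ 3 / h := by field_simp; ring
        rw [e2, le_div_iff₀ hh]
        nlinarith [mul_nonneg (by linarith : 0 ≤ h + 4) (sq_nonneg (h - 1 / 2))]
      norm_num
      norm_num at this
      linarith
  have inner := inner_strip_inequality hF hL hs0 hs25 hD0 hc.inner
  have outer := outer_strip_inequality hF hL hs0 hc hT4 (hsh.trans hhT) hLT hT
  have hcol : ∀ {G : ℝ × ℝ → ℝ}, Continuous G → ∀ a b : ℝ, Continuous fun x => ∫ y in a..b, G (x, y) ^ 2 := by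
    intro G hG a b
    simpa using continuous_columnIntegral (k := fun _ => 1) continuous_const
      (G := fun q => G q ^ 2) (by fun_prop) a b
  have c1 := hcol hXc 0 s
  have c2 := hcol hYc 0 s
  have c3 := hcol hXc 0 h
  have c4 := hcol hYc 0 h
  have c5 := hcol hXc 0 T
  have c6 := hcol hYc 0 T
  have c7 := hcol (G := fun q => dX (dX F) q + dY (dY F) q) (by fun_prop) 0 T
  have mono : ∀ {G : ℝ × ℝ → ℝ}, Continuous G → ∀ x : ℝ,
      ∫ y in 0..s, G (x, y) ^ 2 ≤ ∫ y in 0..h, G (x, y) ^ 2 := by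
    intro G hG x
    exact intervalIntegral.integral_mono_interval le_rfl hs0.le hsh
      (Filter.Eventually.of_forall fun y => sq_nonneg _)
      (Continuous.intervalIntegrable (by fun_prop) _ _)
  have i1 : (∫ x in 0..L, (3 * (∫ y in 0..s, dY F (x, y) ^ 2)
        + D * L ^ 2 * ∫ y in 0..s, dX F (x, y) ^ 2)) ≤
      ∫ x in 0..L, (3 * (∫ y in 0..h, dY F (x, y) ^ 2)
        + 72 * (L ^ 2 / h) * (1 + h) ^ 3 * ∫ y in 0..h, dX F (x, y) ^ 2) := by
    refine intervalIntegral.integral_mono_on hL.le (Continuous.intervalIntegrable (by fun_prop) _ _)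
      (Continuous.intervalIntegrable (by fun_prop) _ _) fun x _ => ?_
    have h0 : 0 ≤ ∫ y in 0..s, dX F (x, y) ^ 2 :=
      intervalIntegral.integral_nonneg hs0.le fun y _ => sq_nonneg _
    have := mono hYc x
    have := mul_le_mul hDC (mono hXc x) h0 (by positivity)
    linarith
  have i2 : (∫ x in L..T, (3 * (∫ y in 0..T, dY F (x, y) ^ 2)
        + 18 * (x ^ 2 * ((∫ y in 0..T, (dX (dX F) (x, y) + dY (dY F) (x, y)) ^ 2)
          + (dY F (x, 0) + F (x, 0)) ^ 2))
        + D * L ^ 2 * ∫ y in 0..T, dX F (x, y) ^ 2)) ≤ ∫ x in L..T, (3 * (∫ y in 0..T, dY F (x, y) ^ 2)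
        + 18 * (x ^ 2 * ((∫ y in 0..T, (dX (dX F) (x, y) + dY (dY F) (x, y)) ^ 2)
          + (dY F (x, 0) + F (x, 0)) ^ 2))
        + 72 * (L ^ 2 / h) * (1 + h) ^ 3 * ∫ y in 0..T, dX F (x, y) ^ 2) := by
    refine intervalIntegral.integral_mono_on hLT (Continuous.intervalIntegrable (by fun_prop) _ _)
      (Continuous.intervalIntegrable (by fun_prop) _ _) fun x _ => ?_
    have h0 : 0 ≤ ∫ y in 0..T, dX F (x, y) ^ 2 :=
      intervalIntegral.integral_nonneg (by linarith) fun y _ => sq_nonneg _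
    have := mul_le_mul_of_nonneg_right hDC h0
    linarith
  have hsplit := intervalIntegral.integral_add_adjacent_intervals (μ := volume)
    (f := fun x => 4 * F (x, 0) ^ 2) (a := 0) (b := L) (c := T)
    (Continuous.intervalIntegrable (by fun_prop) _ _)
    (Continuous.intervalIntegrable (by fun_prop) _ _)
  rw [← hsplit]
  have hbal := hc.balance
  have hr := hc.r_gt
  have hκ := hc.κ_nonneg
  generalize (∫ y in 0..s, s⁻¹ * F (L, y)) = P at *
  generalize (∫ y in 0..T, Real.exp (-y) * F (L, y)) = w at *
  have h94 : 0 < 9 - 4 * s := by linarith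
  -- Multiplied by `r - k`, the difference of the sides is `((r - k)(P - χw) - kχw)²` plus a
  -- multiple of `w²` that is nonnegative by `balance`.
  have fin : 36 / (9 - 4 * s) * (51 / 50) * P ^ 2 ≤ r * (P - (3 - 4 * expDefect s) * w) ^ 2
      + 12 * ((1 + κ) * w ^ 2) := by
    have hk0 : 0 < 36 / (9 - 4 * s) * (51 / 50) := by positivity
    generalize 36 / (9 - 4 * s) * (51 / 50) = k at *
    generalize 3 - 4 * expDefect s = χ at *
    have hrk : 0 < r - k := by linarith
    have h1 := mul_le_mul_of_nonneg_right hbal (sq_nonneg w)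
    have h2 := sq_nonneg ((r - k) * (P - χ * w) - k * χ * w)
    have h3 : 0 ≤ (r - k) * (r * (P - χ * w) ^ 2 + 12 * ((1 + κ) * w ^ 2) - k * P ^ 2) := by
      nlinarith
    have := nonneg_of_mul_nonneg_right h3 hrk
    linarith
  have := mul_le_mul_of_nonneg_left fin hL.le
  linarith

end

/-! ### Scaling, reflection and the trace inequality for compactly supported fields -/

section

variable {F : ℝ × ℝ → ℝ}

theorem dX_comp_div (hF : ContDiff ℝ ∞ F) (ν : ℝ) (p : ℝ × ℝ) :
    dX (fun q => F (q.1 / ν, q.2 / ν)) p = dX F (p.1 / ν, p.2 / ν) / ν := by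
  have hc : ContDiff ℝ ∞ fun q : ℝ × ℝ => F (q.1 / ν, q.2 / ν) := by fun_prop
  have h1 := hasDerivAt_dX hc p.1 p.2
  have h2 := (hasDerivAt_dX hF (p.1 / ν) (p.2 / ν)).comp p.1 ((hasDerivAt_id p.1).div_const ν)
  simpa [div_eq_mul_inv] using h1.unique h2

theorem dY_comp_div (hF : ContDiff ℝ ∞ F) (ν : ℝ) (p : ℝ × ℝ) :
    dY (fun q => F (q.1 / ν, q.2 / ν)) p = dY F (p.1 / ν, p.2 / ν) / ν := by
  have hc : ContDiff ℝ ∞ fun q : ℝ × ℝ => F (q.1 / ν, q.2 / ν) := by fun_prop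
  have h1 := hasDerivAt_dY hc p.1 p.2
  have h2 := (hasDerivAt_dY hF (p.1 / ν) (p.2 / ν)).comp p.2 ((hasDerivAt_id p.2).div_const ν)
  simpa [div_eq_mul_inv] using h1.unique h2

theorem dX_reflect (hF : ContDiff ℝ ∞ F) (p : ℝ × ℝ) :
    dX (fun q => F (-q.1, q.2)) p = -dX F (-p.1, p.2) := by
  have hc : ContDiff ℝ ∞ fun q : ℝ × ℝ => F (-q.1, q.2) := by fun_prop
  have h1 := hasDerivAt_dX hc p.1 p.2
  have h2 := (hasDerivAt_dX hF (-p.1) p.2).comp p.1 (hasDerivAt_neg p.1)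
  simpa using h1.unique h2

theorem dY_reflect (hF : ContDiff ℝ ∞ F) (p : ℝ × ℝ) :
    dY (fun q => F (-q.1, q.2)) p = dY F (-p.1, p.2) := by
  have hc : ContDiff ℝ ∞ fun q : ℝ × ℝ => F (-q.1, q.2) := by fun_prop
  exact (hasDerivAt_dY hc p.1 p.2).unique (hasDerivAt_dY hF (-p.1) p.2)

theorem dX_div (c : ℝ) (hF : ContDiff ℝ ∞ F) (p : ℝ × ℝ) :
    dX (fun q => F q / c) p = dX F p / c := by
  have hc : ContDiff ℝ ∞ fun q : ℝ × ℝ => F q / c := by fun_prop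
  exact (hasDerivAt_dX hc p.1 p.2).unique ((hasDerivAt_dX hF p.1 p.2).div_const c)

theorem dY_div (c : ℝ) (hF : ContDiff ℝ ∞ F) (p : ℝ × ℝ) :
    dY (fun q => F q / c) p = dY F p / c := by
  have hc : ContDiff ℝ ∞ fun q : ℝ × ℝ => F q / c := by fun_prop
  exact (hasDerivAt_dY hc p.1 p.2).unique ((hasDerivAt_dY hF p.1 p.2).div_const c)

theorem integral_scale {ν : ℝ} (hν : 0 < ν) (f : ℝ → ℝ) (a b : ℝ) :
    ∫ x in (ν * a)..(ν * b), f (x / ν) = ν * ∫ x in a..b, f x := by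
  rw [intervalIntegral.integral_comp_div f hν.ne']
  simp [hν.ne']

theorem quarter_plane_inequality_scaled (hF : ContDiff ℝ ∞ F) {ν L h T : ℝ} (hν : 0 < ν)
    (hL : 0 < L) (hh : 0 < h) (hT4 : 4 ≤ ν * T) (hhT : h ≤ T) (hLT : L ≤ T)
    (hT : ∀ x y, (T ≤ |x| ∨ T ≤ |y|) → (x, y) ∉ tsupport F) :
    ∫ x in 0..T, 4 * ν * F (x, 0) ^ 2 ≤
      (∫ x in 0..L, ∫ y in 0..h, (3 * dY F (x, y) ^ 2
        + 72 * (ν * L ^ 2 / h) * (1 + ν * h) ^ 3 * dX F (x, y) ^ 2))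
      + (∫ x in L..T, ∫ y in 0..T, (3 * dY F (x, y) ^ 2
        + 18 * (x ^ 2 * (dX (dX F) (x, y) + dY (dY F) (x, y)) ^ 2)
        + 72 * (ν * L ^ 2 / h) * (1 + ν * h) ^ 3 * dX F (x, y) ^ 2))
      + ∫ x in L..T, 18 * ν * (x ^ 2 * (dY F (x, 0) + ν * F (x, 0)) ^ 2) := by
  have hFc := hF.continuous
  have hX := contDiff_dX hF
  have hY := contDiff_dY hF
  have hXc := hX.continuous
  have hYc := hY.continuous
  have hXXc := (contDiff_dX hX).continuous
  have hYYc := (contDiff_dY hY).continuous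
  have hG : ContDiff ℝ ∞ fun q : ℝ × ℝ => F (q.1 / ν, q.2 / ν) := by fun_prop
  have q := quarter_plane_inequality hG (L := ν * L) (h := ν * h) (T := ν * T) (by positivity)
    (by positivity) hT4 (by gcongr) (by gcongr) ?_
  rotate_left
  · intro x y hxy hmem
    refine hT (x / ν) (y / ν) ?_ ?_
    · rwa [abs_div, abs_div, abs_of_pos hν, le_div_iff₀ hν, le_div_iff₀ hν, mul_comm T ν]
    · exact tsupport_comp_subset_preimage F (f := fun q : ℝ × ℝ => (q.1 / ν, q.2 / ν)) (by fun_prop) hmem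
  have eX : dX (fun q : ℝ × ℝ => F (q.1 / ν, q.2 / ν)) = fun q => dX F (q.1 / ν, q.2 / ν) / ν :=
    funext (dX_comp_div hF ν)
  have eY : dY (fun q : ℝ × ℝ => F (q.1 / ν, q.2 / ν)) = fun q => dY F (q.1 / ν, q.2 / ν) / ν :=
    funext (dY_comp_div hF ν)
  have eXX : dX (fun q : ℝ × ℝ => dX F (q.1 / ν, q.2 / ν) / ν)
      = fun q => dX (dX F) (q.1 / ν, q.2 / ν) / ν / ν := funext fun p => by
    rw [dX_div ν (F := fun q : ℝ × ℝ => dX F (q.1 / ν, q.2 / ν)) (by fun_prop), dX_comp_div hX]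
  have eYY : dY (fun q : ℝ × ℝ => dY F (q.1 / ν, q.2 / ν) / ν)
      = fun q => dY (dY F) (q.1 / ν, q.2 / ν) / ν / ν := funext fun p => by
    rw [dY_div ν (F := fun q : ℝ × ℝ => dY F (q.1 / ν, q.2 / ν)) (by fun_prop), dY_comp_div hY]
  rw [eX, eY, eXX, eYY] at q
  simp only [zero_div] at q
  have z : ∀ b : ℝ, (0 : ℝ) = ν * 0 := by simp
  have sY : ∀ x b : ℝ, ∫ y in 0..ν * b, (dY F (x, y / ν) / ν) ^ 2
      = (∫ y in 0..b, dY F (x, y) ^ 2) / ν := fun x b => by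
    have := integral_scale hν (fun y => (dY F (x, y) / ν) ^ 2) 0 b
    simp only [mul_zero, div_pow, intervalIntegral.integral_div] at this ⊢
    rw [this]; field_simp
  have sX : ∀ x b : ℝ, ∫ y in 0..ν * b, (dX F (x, y / ν) / ν) ^ 2
      = (∫ y in 0..b, dX F (x, y) ^ 2) / ν := fun x b => by
    have := integral_scale hν (fun y => (dX F (x, y) / ν) ^ 2) 0 b
    simp only [mul_zero, div_pow, intervalIntegral.integral_div] at this ⊢
    rw [this]; field_simp
  have sL : ∀ x b : ℝ, ∫ y in 0..ν * b, (dX (dX F) (x, y / ν) / ν / ν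
        + dY (dY F) (x, y / ν) / ν / ν) ^ 2
      = (∫ y in 0..b, (dX (dX F) (x, y) + dY (dY F) (x, y)) ^ 2) / ν ^ 3 := fun x b => by
    have := integral_scale hν (fun y => ((dX (dX F) (x, y) + dY (dY F) (x, y)) / ν / ν) ^ 2) 0 b
    simp only [mul_zero, div_pow, intervalIntegral.integral_div, ← add_div] at this ⊢
    rw [this]; field_simp
  simp only [sX, sY, sL] at q
  have q1 := integral_scale hν (fun x => 4 * F (x, 0) ^ 2) 0 T
  have q2 := integral_scale hν (fun x => 3 * ((∫ y in 0..h, dY F (x, y) ^ 2) / ν)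
        + 72 * ((ν * L) ^ 2 / (ν * h)) * (1 + ν * h) ^ 3 * ((∫ y in 0..h, dX F (x, y) ^ 2) / ν)) 0 L
  have q3 := integral_scale hν (fun x => 3 * ((∫ y in 0..T, dY F (x, y) ^ 2) / ν)
        + 18 * ((ν * x) ^ 2 * ((∫ y in 0..T, (dX (dX F) (x, y) + dY (dY F) (x, y)) ^ 2) / ν ^ 3
          + (dY F (x, 0) / ν + F (x, 0)) ^ 2))
        + 72 * ((ν * L) ^ 2 / (ν * h)) * (1 + ν * h) ^ 3 * ((∫ y in 0..T, dX F (x, y) ^ 2) / ν)) L T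
  simp only [mul_zero, mul_div_cancel₀ _ hν.ne'] at q1 q2 q3
  rw [q1, q2, q3] at q
  simp only [← intervalIntegral.integral_const_mul ν] at q
  have ii : ∀ {G : ℝ × ℝ → ℝ} (x a b : ℝ), Continuous G →
      IntervalIntegrable (fun y => G (x, y)) volume a b := fun x a b hG =>
    Continuous.intervalIntegrable (by fun_prop) _ _
  have e2 : ∀ x, (∫ y in 0..h, (3 * dY F (x, y) ^ 2
        + 72 * (ν * L ^ 2 / h) * (1 + ν * h) ^ 3 * dX F (x, y) ^ 2)) =
      ν * (3 * ((∫ y in 0..h, dY F (x, y) ^ 2) / ν)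
        + 72 * ((ν * L) ^ 2 / (ν * h)) * (1 + ν * h) ^ 3 * ((∫ y in 0..h, dX F (x, y) ^ 2) / ν)) := by
    intro x
    rw [intervalIntegral.integral_add (Continuous.intervalIntegrable (by fun_prop) _ _)
      (Continuous.intervalIntegrable (by fun_prop) _ _), intervalIntegral.integral_const_mul,
      intervalIntegral.integral_const_mul]
    field_simp
  have hcol : ∀ {G : ℝ × ℝ → ℝ}, Continuous G → ∀ a b : ℝ, Continuous fun x => ∫ y in a..b, G (x, y) := by
    intro G hG a b
    simpa using continuous_columnIntegral (k := fun _ => 1) continuous_const (G := G) hG a b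
  have c5 := hcol (G := fun q : ℝ × ℝ => 3 * dY F q ^ 2
        + 18 * (q.1 ^ 2 * (dX (dX F) q + dY (dY F) q) ^ 2)
        + 72 * (ν * L ^ 2 / h) * (1 + ν * h) ^ 3 * dX F q ^ 2) (by fun_prop) 0 T
  have e3 : (∫ x in L..T, ∫ y in 0..T, (3 * dY F (x, y) ^ 2
        + 18 * (x ^ 2 * (dX (dX F) (x, y) + dY (dY F) (x, y)) ^ 2)
        + 72 * (ν * L ^ 2 / h) * (1 + ν * h) ^ 3 * dX F (x, y) ^ 2))
      + (∫ x in L..T, 18 * ν * (x ^ 2 * (dY F (x, 0) + ν * F (x, 0)) ^ 2))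
      = ∫ x in L..T, ν * (3 * ((∫ y in 0..T, dY F (x, y) ^ 2) / ν)
        + 18 * ((ν * x) ^ 2 * ((∫ y in 0..T, (dX (dX F) (x, y) + dY (dY F) (x, y)) ^ 2) / ν ^ 3
          + (dY F (x, 0) / ν + F (x, 0)) ^ 2))
        + 72 * ((ν * L) ^ 2 / (ν * h)) * (1 + ν * h) ^ 3 * ((∫ y in 0..T, dX F (x, y) ^ 2) / ν)) := by
    rw [← intervalIntegral.integral_add (Continuous.intervalIntegrable c5 _ _)
      (Continuous.intervalIntegrable (by fun_prop) _ _)]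
    congr 1
    funext x
    rw [intervalIntegral.integral_add (Continuous.intervalIntegrable (by fun_prop) _ _)
      (Continuous.intervalIntegrable (by fun_prop) _ _),
      intervalIntegral.integral_add (Continuous.intervalIntegrable (by fun_prop) _ _)
      (Continuous.intervalIntegrable (by fun_prop) _ _)]
    simp only [intervalIntegral.integral_const_mul]
    field_simp
    ring
  simp only [e2]
  rw [add_assoc, e3]
  refine le_trans (le_of_eq ?_) q
  congr 1
  funext x
  ring

end

/-- The density `3 F_y² + 18 r² (ΔF)² + C F_x²`. -/
noncomputable def boundDensity (C : ℝ) (F : ℝ × ℝ → ℝ) (q : ℝ × ℝ) : ℝ :=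
  3 * dY F q ^ 2 + 18 * ((q.1 ^ 2 + q.2 ^ 2) * (dX (dX F) q + dY (dY F) q) ^ 2) + C * dX F q ^ 2

section

variable {F : ℝ × ℝ → ℝ}

theorem boundDensity_nonneg {C : ℝ} (hC : 0 ≤ C) (q : ℝ × ℝ) : 0 ≤ boundDensity C F q := by
  unfold boundDensity; positivity

theorem continuous_boundDensity (hF : ContDiff ℝ ∞ F) (C : ℝ) : Continuous (boundDensity C F) := by
  have hXc := (contDiff_dX hF).continuous
  have hYc := (contDiff_dY hF).continuous
  have hXXc := (contDiff_dX (contDiff_dX hF)).continuous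
  have hYYc := (contDiff_dY (contDiff_dY hF)).continuous
  unfold boundDensity
  fun_prop

theorem integrable_boundDensity (hF : ContDiff ℝ ∞ F) (hc : HasCompactSupport F) (C : ℝ) :
    Integrable (boundDensity C F) := by
  refine (continuous_boundDensity hF C).integrable_of_hasCompactSupport ?_
  refine HasCompactSupport.of_support_subset_isCompact hc fun q hq => ?_
  by_contra h
  have hX : dX F q = 0 := image_eq_zero_of_notMem_tsupport fun h' => h (tsupport_dX_subset h')
  have hY : dY F q = 0 := image_eq_zero_of_notMem_tsupport fun h' => h (tsupport_dY_subset h')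
  have hXX : dX (dX F) q = 0 :=
    image_eq_zero_of_notMem_tsupport fun h' => h (tsupport_dX_subset (tsupport_dX_subset h'))
  have hYY : dY (dY F) q = 0 :=
    image_eq_zero_of_notMem_tsupport fun h' => h (tsupport_dY_subset (tsupport_dY_subset h'))
  exact hq (by simp [boundDensity, hX, hY, hXX, hYY])

/-- The two rectangles of the quarter-plane inequality, above the body and beyond `x = L`, are
disjoint parts of `A`; the density is nonnegative, so integrating it over all of `A` with `x > 0`
only increases the bound. The weight `x²` is enlarged to `r²`. -/
theorem half_trace_inequality (hF : ContDiff ℝ ∞ F) (hc : HasCompactSupport F) {ν L h : ℝ}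
    (hν : 0 < ν) (hL : 0 < L) (hh : 0 < h) {A : Set (ℝ × ℝ)}
    (hA1 : ∀ x y, 0 < y → L < x → (x, y) ∈ A) (hA2 : ∀ x y, 0 < x → 0 < y → y < h → (x, y) ∈ A) :
    4 * ν * ∫ x in Ioi 0, F (x, 0) ^ 2 ≤
      (∫ q in A ∩ {q | 0 < q.1}, boundDensity (72 * (ν * L ^ 2 / h) * (1 + ν * h) ^ 3) F q)
      + 18 * (ν * ∫ x in Ioi 0, (x * (dY F (x, 0) + ν * F (x, 0))) ^ 2) := by
  have hFc := hF.continuous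
  have hX := contDiff_dX hF
  have hY := contDiff_dY hF
  have hXc := hX.continuous
  have hYc := hY.continuous
  have hXXc := (contDiff_dX hX).continuous
  have hYYc := (contDiff_dY hY).continuous
  set C := 72 * (ν * L ^ 2 / h) * (1 + ν * h) ^ 3 with hC
  have hC0 : 0 ≤ C := by positivity
  obtain ⟨r, hr⟩ := hc.isCompact.isBounded.subset_ball (0 : ℝ × ℝ)
  -- Beyond the support of `F`, and so large that the scaled interval reaches 4, as the
  -- one-dimensional inequality requires.
  set T := max (max r (4 / ν)) (max h L) with hTd
  have hhT : h ≤ T := (le_max_left _ _).trans (le_max_right _ _)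
  have hLT : L ≤ T := (le_max_right _ _).trans (le_max_right _ _)
  have hrT : r ≤ T := (le_max_left _ _).trans (le_max_left _ _)
  have hT4 : 4 ≤ ν * T := by
    have : 4 / ν ≤ T := (le_max_right _ _).trans (le_max_left _ _)
    rwa [div_le_iff₀' hν] at this
  have hT0 : 0 < T := hL.trans_le hLT
  have hT : ∀ x y, (T ≤ |x| ∨ T ≤ |y|) → (x, y) ∉ tsupport F := by
    intro x y hxy hmem
    have := hr hmem
    rw [mem_ball_zero_iff, Prod.norm_def, max_lt_iff] at this
    simp only [Real.norm_eq_abs] at this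
    rcases hxy with h' | h' <;> linarith [this.1, this.2]
  have key := quarter_plane_inequality_scaled hF hν hL hh hT4 hhT hLT hT
  have cut : ∀ G : ℝ → ℝ, (∀ x, T ≤ |x| → G x = 0) → ∫ x in Ioi 0, G x = ∫ x in 0..T, G x := by
    intro G hG
    rw [intervalIntegral.integral_of_le hT0.le]
    refine (setIntegral_eq_of_subset_of_forall_sdiff_eq_zero measurableSet_Ioi Ioc_subset_Ioi_self
      fun x hx => hG x ?_)
    have : T < x := by
      by_contra hle
      exact hx.2 ⟨hx.1, not_lt.1 hle⟩
    exact this.le.trans (le_abs_self x)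
  have zero : ∀ x y, (T ≤ |x| ∨ T ≤ |y|) → F (x, y) = 0 := fun x y h =>
    image_eq_zero_of_notMem_tsupport (hT x y h)
  have zeroY : ∀ x y, (T ≤ |x| ∨ T ≤ |y|) → dY F (x, y) = 0 := fun x y h =>
    image_eq_zero_of_notMem_tsupport fun h' => hT x y h (tsupport_dY_subset h')
  rw [cut _ fun x hx => by rw [zero x 0 (Or.inl hx)]; simp,
    cut _ fun x hx => by rw [zero x 0 (Or.inl hx), zeroY x 0 (Or.inl hx)]; simp]
  have hint := integrable_boundDensity hF hc C
  have hQ0 : ∀ q, 0 ≤ boundDensity C F q := boundDensity_nonneg hC0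
  have rect1 : ∫ q in Ioc 0 L ×ˢ Ioo 0 h, boundDensity C F q
      = ∫ x in 0..L, ∫ y in 0..h, boundDensity C F (x, y) := by
    rw [Measure.volume_eq_prod, setIntegral_prod _ hint.integrableOn,
      intervalIntegral.integral_of_le hL.le]
    simp only [intervalIntegral.integral_of_le hh.le, integral_Ioc_eq_integral_Ioo]
  have rect2 : ∫ q in Ioc L T ×ˢ Ioc 0 T, boundDensity C F q
      = ∫ x in L..T, ∫ y in 0..T, boundDensity C F (x, y) := by
    rw [Measure.volume_eq_prod, setIntegral_prod _ hint.integrableOn,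
      intervalIntegral.integral_of_le hLT]
    simp only [intervalIntegral.integral_of_le hT0.le]
  have hQc := continuous_boundDensity hF C
  have hcol : ∀ {G : ℝ × ℝ → ℝ}, Continuous G → ∀ a b : ℝ, Continuous fun x => ∫ y in a..b, G (x, y) := by
    intro G hG a b
    simpa using continuous_columnIntegral (k := fun _ => 1) continuous_const (G := G) hG a b
  have m1 : (∫ x in 0..L, ∫ y in 0..h, (3 * dY F (x, y) ^ 2 + C * dX F (x, y) ^ 2))
      ≤ ∫ x in 0..L, ∫ y in 0..h, boundDensity C F (x, y) := by
    refine intervalIntegral.integral_mono_on hL.le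
      (Continuous.intervalIntegrable (hcol (G := fun q => 3 * dY F q ^ 2 + C * dX F q ^ 2)
        (by fun_prop) _ _) _ _) (Continuous.intervalIntegrable (hcol hQc _ _) _ _) fun x _ => ?_
    refine intervalIntegral.integral_mono_on hh.le (Continuous.intervalIntegrable (by fun_prop) _ _)
      (Continuous.intervalIntegrable (by fun_prop) _ _) fun y _ => ?_
    have : 0 ≤ (x ^ 2 + y ^ 2) * (dX (dX F) (x, y) + dY (dY F) (x, y)) ^ 2 := by positivity
    simp only [boundDensity]
    linarith
  have m2 : (∫ x in L..T, ∫ y in 0..T, (3 * dY F (x, y) ^ 2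
        + 18 * (x ^ 2 * (dX (dX F) (x, y) + dY (dY F) (x, y)) ^ 2) + C * dX F (x, y) ^ 2))
      ≤ ∫ x in L..T, ∫ y in 0..T, boundDensity C F (x, y) := by
    refine intervalIntegral.integral_mono_on hLT
      (Continuous.intervalIntegrable (hcol (G := fun q => 3 * dY F q ^ 2
        + 18 * (q.1 ^ 2 * (dX (dX F) q + dY (dY F) q) ^ 2) + C * dX F q ^ 2)
        (by fun_prop) _ _) _ _) (Continuous.intervalIntegrable (hcol hQc _ _) _ _) fun x _ => ?_
    refine intervalIntegral.integral_mono_on hT0.le (Continuous.intervalIntegrable (by fun_prop) _ _)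
      (Continuous.intervalIntegrable (by fun_prop) _ _) fun y _ => ?_
    have : 0 ≤ y ^ 2 * (dX (dX F) (x, y) + dY (dY F) (x, y)) ^ 2 := by positivity
    simp only [boundDensity]
    linarith
  have hdisj : Disjoint (Ioc 0 L ×ˢ Ioo 0 h) (Ioc L T ×ˢ Ioc 0 T) := by
    rw [Set.disjoint_left]
    rintro ⟨x, y⟩ ⟨hx, _⟩ ⟨hx', _⟩
    exact absurd hx.2 (not_le.2 hx'.1)
  have m3 : (∫ q in Ioc 0 L ×ˢ Ioo 0 h, boundDensity C F q) + (∫ q in Ioc L T ×ˢ Ioc 0 T, boundDensity C F q)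
      ≤ ∫ q in A ∩ {q | 0 < q.1}, boundDensity C F q := by
    rw [← setIntegral_union hdisj (measurableSet_Ioc.prod measurableSet_Ioc) hint.integrableOn
      hint.integrableOn]
    refine setIntegral_mono_set hint.integrableOn (Filter.Eventually.of_forall hQ0)
      (LE.le.eventuallyLE ?_)
    rintro ⟨x, y⟩ (⟨hx, hy⟩ | ⟨hx, hy⟩)
    · exact ⟨hA2 x y hx.1 hy.1 hy.2, hx.1⟩
    · exact ⟨hA1 x y hy.1 hx.1, hL.trans hx.1⟩
  have m4 : ∫ x in L..T, 18 * ν * (x ^ 2 * (dY F (x, 0) + ν * F (x, 0)) ^ 2) ≤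
      18 * (ν * ∫ x in 0..T, (x * (dY F (x, 0) + ν * F (x, 0))) ^ 2) := by
    rw [← mul_assoc, ← intervalIntegral.integral_const_mul]
    refine le_trans (le_of_eq ?_) (intervalIntegral.integral_mono_interval hL.le hLT le_rfl
      (Filter.Eventually.of_forall fun x => by positivity)
      (Continuous.intervalIntegrable (by fun_prop) _ _))
    congr 1; funext x; ring
  rw [intervalIntegral.integral_const_mul] at key
  linarith

/-- The quarter-plane bound is applied to `F` and to its reflection in the vertical axis. No
symmetry of the body is needed, since the hypotheses on `A` are symmetric in `x`. -/
theorem trace_inequality_of_hasCompactSupport (hF : ContDiff ℝ ∞ F) (hc : HasCompactSupport F)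
    {ν L h : ℝ} (hν : 0 < ν) (hL : 0 < L) (hh : 0 < h) {A : Set (ℝ × ℝ)} (hA : MeasurableSet A)
    (hA1 : ∀ x y, 0 < y → L < |x| → (x, y) ∈ A) (hA2 : ∀ x y, 0 < y → y < h → (x, y) ∈ A) :
    4 * ν * ∫ x, F (x, 0) ^ 2 ≤
      (∫ q in A, boundDensity (72 * (ν * L ^ 2 / h) * (1 + ν * h) ^ 3) F q)
      + 18 * (ν * ∫ x, (x * (dY F (x, 0) + ν * F (x, 0))) ^ 2) := by
  have hFc := hF.continuous
  have hX := contDiff_dX hF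
  have hY := contDiff_dY hF
  have hYc := hY.continuous
  set C := 72 * (ν * L ^ 2 / h) * (1 + ν * h) ^ 3 with hC
  have hC0 : 0 ≤ C := by positivity
  let e : ℝ × ℝ ≃ᵐ ℝ × ℝ := (MeasurableEquiv.neg ℝ).prodCongr (MeasurableEquiv.refl ℝ)
  have he : ∀ q, e q = (-q.1, q.2) := fun q => rfl
  have hmp : MeasurePreserving e := by
    rw [Measure.volume_eq_prod]
    exact (Measure.measurePreserving_neg volume).prod (MeasurePreserving.id volume)
  have hcl : Topology.IsClosedEmbedding (fun q : ℝ × ℝ => ((-q.1, q.2) : ℝ × ℝ)) :=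
    ((Homeomorph.neg ℝ).prodCongr (Homeomorph.refl ℝ)).isClosedEmbedding
  have hG : ContDiff ℝ ∞ fun q : ℝ × ℝ => F (-q.1, q.2) := by fun_prop
  have right := half_trace_inequality hF hc hν hL hh
    (fun x y hy hx => hA1 x y hy (hx.trans_le (le_abs_self x))) (fun x y _ hy hy' => hA2 x y hy hy')
  have left := half_trace_inequality hG (hc.comp_isClosedEmbedding hcl) hν hL hh
    (A := e ⁻¹' A)
    (fun x y hy hx => hA1 (-x) y hy (by rw [abs_neg]; exact hx.trans_le (le_abs_self x)))
    (fun x y _ hy hy' => hA2 (-x) y hy hy')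
  rw [← hC] at left right
  have hdens : ∀ q, boundDensity C (fun q : ℝ × ℝ => F (-q.1, q.2)) q = boundDensity C F (e q) := by
    intro q
    have eX : dX (fun q : ℝ × ℝ => F (-q.1, q.2)) = fun q => -dX F (-q.1, q.2) :=
      funext (dX_reflect hF)
    have eY : dY (fun q : ℝ × ℝ => F (-q.1, q.2)) = fun q => dY F (-q.1, q.2) :=
      funext (dY_reflect hF)
    have eXX : dX (fun q : ℝ × ℝ => -dX F (-q.1, q.2)) q = dX (dX F) (-q.1, q.2) := by
      have := dX_reflect (F := fun q => -dX F q) (by fun_prop) q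
      rw [this]
      simp [dX, fderiv_fun_neg]
      rfl
    have eYY : dY (fun q : ℝ × ℝ => dY F (-q.1, q.2)) q = dY (dY F) (-q.1, q.2) := dY_reflect hY q
    simp only [boundDensity, eX, eY, eXX, eYY, he]
    ring
  have l1 : ∫ q in e ⁻¹' A ∩ {q | 0 < q.1}, boundDensity C (fun q : ℝ × ℝ => F (-q.1, q.2)) q
      = ∫ q in A ∩ {q | q.1 < 0}, boundDensity C F q := by
    simp only [hdens]
    rw [← hmp.setIntegral_preimage_emb e.measurableEmbedding (boundDensity C F)]
    congr 2
    ext q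
    simp [he]
  have l2 : ∀ f : ℝ → ℝ, ∫ x in Ioi 0, f (-x) = ∫ x in Iio 0, f x := fun f => by
    rw [integral_comp_neg_Ioi, neg_zero, integral_Iic_eq_integral_Iio]
  have l3 := l2 fun x => F (x, 0) ^ 2
  have l4 := l2 fun x => (x * (dY F (x, 0) + ν * F (x, 0))) ^ 2
  have eY : dY (fun q : ℝ × ℝ => F (-q.1, q.2)) = fun q => dY F (-q.1, q.2) :=
    funext (dY_reflect hF)
  rw [l1, eY] at left
  simp only [neg_mul, neg_sq] at left l4
  rw [l3, l4] at left
  have hint := integrable_boundDensity hF hc C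
  have isurf : ∀ G : ℝ → ℝ, Continuous G → (∀ x, (x, (0:ℝ)) ∉ tsupport F → G x = 0) → Integrable G := by
    intro G hG h0
    refine hG.integrable_of_hasCompactSupport ?_
    refine HasCompactSupport.of_support_subset_isCompact (hc.isCompact.image continuous_fst)
      fun x hx => ?_
    by_contra hn
    exact hx (h0 x fun hm => hn ⟨_, hm, rfl⟩)
  have i1 := isurf (fun x => F (x, 0) ^ 2) (by fun_prop) fun x hx => by
    simp [image_eq_zero_of_notMem_tsupport hx]
  have i2 := isurf (fun x => (x * (dY F (x, 0) + ν * F (x, 0))) ^ 2) (by fun_prop) fun x hx => by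
    simp [image_eq_zero_of_notMem_tsupport hx,
      image_eq_zero_of_notMem_tsupport fun h' => hx (tsupport_dY_subset h')]
  have s1 := intervalIntegral.integral_Iio_add_Ici (b := 0) i1.integrableOn i1.integrableOn
  have s2 := intervalIntegral.integral_Iio_add_Ici (b := 0) i2.integrableOn i2.integrableOn
  rw [integral_Ici_eq_integral_Ioi] at s1 s2
  have s3 : (∫ q in A ∩ {q | q.1 < 0}, boundDensity C F q) + (∫ q in A ∩ {q | 0 < q.1}, boundDensity C F q)
      ≤ ∫ q in A, boundDensity C F q := by
    rw [← setIntegral_union ?_ (hA.inter (measurableSet_lt measurable_const measurable_fst))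
      hint.integrableOn hint.integrableOn]
    · exact setIntegral_mono_set hint.integrableOn
        (Filter.Eventually.of_forall (boundDensity_nonneg hC0))
        (LE.le.eventuallyLE (union_subset inter_subset_left inter_subset_left))
    · rw [Set.disjoint_left]
      rintro q ⟨_, h1⟩ ⟨_, h2⟩
      exact lt_asymm (show q.1 < 0 from h1) h2
  rw [← s1, ← s2]
  linarith

end

/-! ### Hardy's inequality on columns -/

/-- The difference `4u'² - u²/(1+y)² - (2u²/(1+y))'` is the square of `2u' - u/(1+y)`. The shift to
`1 + y` keeps the weight bounded at the surface. -/
theorem hardy_interval {u u' : ℝ → ℝ} (hu : ∀ y, HasDerivAt u (u' y) y) (hu' : Continuous u')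
    {a b : ℝ} (ha : 0 ≤ a) (hab : a ≤ b) :
    ∫ y in a..b, u y ^ 2 / (1 + y) ^ 2 ≤ 2 * u a ^ 2 + 4 * ∫ y in a..b, u' y ^ 2 := by
  have c0 : Continuous u := continuous_iff_continuousAt.2 fun x => (hu x).continuousAt
  have hpos : ∀ y ∈ Icc a b, 0 < 1 + y := fun y hy => by linarith [hy.1]
  have hcont : ContinuousOn (fun y => u y ^ 2 / (1 + y) ^ 2) (Icc a b) := by
    refine ContinuousOn.div (by fun_prop) (by fun_prop) fun y hy => ?_
    have := hpos y hy
    positivity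
  have hcu : ContinuousOn (fun y => 4 * u' y ^ 2) (Icc a b) := by fun_prop
  have main := sub_le_integral_of_deriv_le hab (g := fun y => 2 * u y ^ 2 / (1 + y))
    (g' := fun y => (2 * (2 * u y * u' y) * (1 + y) - 2 * u y ^ 2 * 1) / (1 + y) ^ 2)
    (φ := fun y => 4 * u' y ^ 2 - u y ^ 2 / (1 + y) ^ 2) ?_ (hcu.sub hcont) ?_
  · rw [intervalIntegral.integral_sub (hcu.intervalIntegrable_of_Icc hab)
      (hcont.intervalIntegrable_of_Icc hab), intervalIntegral.integral_const_mul] at main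
    have h1 : 0 ≤ 2 * u b ^ 2 / (1 + b) := by
      have := hpos b ⟨hab, le_rfl⟩
      positivity
    have h2 : 2 * u a ^ 2 / (1 + a) ≤ 2 * u a ^ 2 := div_le_self (by positivity) (by linarith)
    linarith
  · intro y hy
    refine ((((hu y).pow 2).const_mul 2).div ((hasDerivAt_id y).const_add 1)
      (hpos y hy).ne').congr_deriv ?_
    simp
  · intro y hy
    have h := hpos y hy
    have : 4 * u' y ^ 2 - u y ^ 2 / (1 + y) ^ 2 -
        (2 * (2 * u y * u' y) * (1 + y) - 2 * u y ^ 2 * 1) / (1 + y) ^ 2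
        = (2 * u' y - u y / (1 + y)) ^ 2 := by
      field_simp; ring
    nlinarith [sq_nonneg (2 * u' y - u y / (1 + y))]

/-- Stated for extended nonnegative integrals so that no integrability along a single column is
required; the half-line is a monotone union of intervals. -/
theorem hardy_lintegral {u u' : ℝ → ℝ} (hu : ∀ y, HasDerivAt u (u' y) y) (hu' : Continuous u')
    {a : ℝ} (ha : 0 ≤ a) :
    ∫⁻ y in Ioi a, ENNReal.ofReal (u y ^ 2 / (1 + y) ^ 2) ≤
      ENNReal.ofReal (2 * u a ^ 2) + ENNReal.ofReal 4 * ∫⁻ y in Ioi a, ENNReal.ofReal (u' y ^ 2) := by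
  have c0 : Continuous u := continuous_iff_continuousAt.2 fun x => (hu x).continuousAt
  have hU : Ioi a = ⋃ n : ℕ, Ioc a (a + n) := by
    ext y
    simp only [mem_Ioi, mem_iUnion, mem_Ioc]
    refine ⟨fun h => ?_, fun ⟨n, h, _⟩ => h⟩
    obtain ⟨n, hn⟩ := exists_nat_ge (y - a)
    exact ⟨n, h, by linarith⟩
  have hmono : Monotone fun n : ℕ => Ioc a (a + n) := fun m n hmn =>
    Ioc_subset_Ioc_right (by gcongr)
  conv_lhs => rw [hU]
  rw [setLIntegral_iUnion_of_directed _ hmono.directed_le]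
  refine iSup_le fun n => ?_
  have hab : a ≤ a + n := by simp
  have hcont : ContinuousOn (fun y => u y ^ 2 / (1 + y) ^ 2) (Icc a (a + n)) := by
    refine ContinuousOn.div (by fun_prop) (by fun_prop) fun y hy => ?_
    have : 0 < 1 + y := by linarith [hy.1]
    positivity
  rw [← ofReal_integral_eq_lintegral_ofReal
    ((hcont.integrableOn_compact isCompact_Icc).mono_set Ioc_subset_Icc_self)
    (Filter.Eventually.of_forall fun y => by positivity), ← intervalIntegral.integral_of_le hab]
  refine (ENNReal.ofReal_le_ofReal (hardy_interval hu hu' ha hab)).trans ?_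
  have h0 : 0 ≤ ∫ y in a..a + n, u' y ^ 2 :=
    intervalIntegral.integral_nonneg hab fun y _ => sq_nonneg _
  rw [ENNReal.ofReal_add (by positivity) (by positivity), ENNReal.ofReal_mul (p := 4) (by norm_num)]
  gcongr
  rw [intervalIntegral.integral_of_le hab, ofReal_integral_eq_lintegral_ofReal
    ((Continuous.integrableOn_Icc (by fun_prop)).mono_set Ioc_subset_Icc_self)
    (Filter.Eventually.of_forall fun y => by positivity)]
  exact lintegral_mono_set Ioc_subset_Ioi_self

theorem integrableOn_hardy {F : ℝ × ℝ → ℝ} (hF : ContDiff ℝ ∞ F) {X : Set ℝ} {a : ℝ} (ha : 0 ≤ a)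

    (htrace : IntegrableOn (fun x => F (x, a) ^ 2) X)
    (hgrad : IntegrableOn (fun q => dY F q ^ 2) (X ×ˢ Ioi a)) :
    IntegrableOn (fun q => F q ^ 2 / (1 + q.2) ^ 2) (X ×ˢ Ioi a) := by
  have hFc := hF.continuous
  have hYc := (contDiff_dY hF).continuous
  have hmeas : Measurable fun q : ℝ × ℝ => F q ^ 2 / (1 + q.2) ^ 2 := by fun_prop
  refine ⟨hmeas.aestronglyMeasurable, ?_⟩
  rw [hasFiniteIntegral_iff_ofReal (Filter.Eventually.of_forall fun q => by positivity)]
  have h1 := htrace.2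
  have h2 := hgrad.2
  rw [hasFiniteIntegral_iff_ofReal (Filter.Eventually.of_forall fun q => by positivity)] at h1 h2
  rw [Measure.volume_eq_prod, ← Measure.prod_restrict, lintegral_prod _ (by fun_prop)] at h2 ⊢
  calc ∫⁻ x in X, ∫⁻ y in Ioi a, ENNReal.ofReal (F (x, y) ^ 2 / (1 + y) ^ 2)
      ≤ ∫⁻ x in X, (ENNReal.ofReal (2 * F (x, a) ^ 2) +
          ENNReal.ofReal 4 * ∫⁻ y in Ioi a, ENNReal.ofReal (dY F (x, y) ^ 2)) := by
        refine lintegral_mono fun x => ?_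
        exact hardy_lintegral (hasDerivAt_dY hF x) (by fun_prop) ha
    _ = ENNReal.ofReal 2 * (∫⁻ x in X, ENNReal.ofReal (F (x, a) ^ 2)) +
          ENNReal.ofReal 4 * ∫⁻ x in X, ∫⁻ y in Ioi a, ENNReal.ofReal (dY F (x, y) ^ 2) := by
        rw [lintegral_add_left (by fun_prop), lintegral_const_mul' _ _ (by simp)]
        simp only [ENNReal.ofReal_mul (by norm_num : (0:ℝ) ≤ 2)]
        rw [lintegral_const_mul' _ _ (by simp)]
    _ < ⊤ := by
        exact ENNReal.add_lt_top.2 ⟨ENNReal.mul_lt_top (by simp) h1, ENNReal.mul_lt_top (by simp) h2⟩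

/-! ### Cutting off at infinity -/

/-- A smooth bump function on the line with its first two derivatives. -/
structure BumpData (θ θ1 θ2 : ℝ → ℝ) (c : ℝ) : Prop where
  smooth : ContDiff ℝ ∞ θ
  deriv1 : ∀ t, HasDerivAt θ (θ1 t) t
  deriv2 : ∀ t, HasDerivAt θ1 (θ2 t) t
  c_nonneg : 0 ≤ c
  abs_le_one : ∀ t, |θ t| ≤ 1
  abs_le1 : ∀ t, |θ1 t| ≤ c
  abs_le2 : ∀ t, |θ2 t| ≤ c
  eq_one : ∀ t, |t| ≤ 1 → θ t = 1
  eq_zero : ∀ t, 2 < |t| → θ t = 0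
  eq_zero1 : ∀ t, |t| < 1 → θ1 t = 0
  eq_zero2 : ∀ t, |t| < 1 → θ2 t = 0
  eq_zero1' : ∀ t, 2 < |t| → θ1 t = 0
  eq_zero2' : ∀ t, 2 < |t| → θ2 t = 0

theorem exists_bumpData : ∃ θ θ1 θ2 c, BumpData θ θ1 θ2 c := by
  let b : ContDiffBump (0 : ℝ) := ⟨1, 2, by norm_num, by norm_num⟩
  have hs : ContDiff ℝ ∞ b := b.contDiff
  have hs1 : ContDiff ℝ ∞ (deriv b) := (contDiff_infty_iff_deriv.1 hs).2
  have hs2 : ContDiff ℝ ∞ (deriv (deriv b)) := (contDiff_infty_iff_deriv.1 hs1).2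
  have hc0 : HasCompactSupport b := b.hasCompactSupport
  have hc1 : HasCompactSupport (deriv b) := hc0.deriv
  have hc2 : HasCompactSupport (deriv (deriv b)) := hc1.deriv
  obtain ⟨c1, h1⟩ := hc1.exists_bound_of_continuous hs1.continuous
  obtain ⟨c2, h2⟩ := hc2.exists_bound_of_continuous hs2.continuous
  have one : ∀ t : ℝ, |t| ≤ 1 → b t = 1 := fun t ht =>
    b.one_of_mem_closedBall (by simpa [b] using ht)
  have zero : ∀ t : ℝ, 2 < |t| → b t = 0 := fun t ht =>
    b.zero_of_le_dist (by simpa [b] using ht.le)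
  have in1 : ∀ t : ℝ, |t| < 1 → deriv b t = 0 := fun t ht => by
    have : b =ᶠ[nhds t] fun _ => 1 := by
      filter_upwards [(isOpen_lt continuous_abs continuous_const).mem_nhds ht] with u hu
      exact one u (le_of_lt hu)
    rw [this.deriv_eq]; simp
  have out1 : ∀ t : ℝ, 2 < |t| → deriv b t = 0 := fun t ht => by
    have : b =ᶠ[nhds t] fun _ => 0 := by
      filter_upwards [(isOpen_lt continuous_const continuous_abs).mem_nhds ht] with u hu
      exact zero u hu
    rw [this.deriv_eq]; simp
  have in2 : ∀ t : ℝ, |t| < 1 → deriv (deriv b) t = 0 := fun t ht => by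
    have : deriv b =ᶠ[nhds t] fun _ => 0 := by
      filter_upwards [(isOpen_lt continuous_abs continuous_const).mem_nhds ht] with u hu
      exact in1 u hu
    rw [this.deriv_eq]; simp
  have out2 : ∀ t : ℝ, 2 < |t| → deriv (deriv b) t = 0 := fun t ht => by
    have : deriv b =ᶠ[nhds t] fun _ => 0 := by
      filter_upwards [(isOpen_lt continuous_const continuous_abs).mem_nhds ht] with u hu
      exact out1 u hu
    rw [this.deriv_eq]; simp
  refine ⟨b, deriv b, deriv (deriv b), max c1 c2, hs,
    fun t => (hs.differentiable (by simp) t).hasDerivAt,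
    fun t => (hs1.differentiable (by simp) t).hasDerivAt,
    (norm_nonneg _).trans ((h1 0).trans (le_max_left _ _)), fun t => ?_,
    fun t => (h1 t).trans (le_max_left _ _), fun t => (h2 t).trans (le_max_right _ _),
    one, zero, in1, in2, out1, out2⟩
  rw [abs_of_nonneg b.nonneg]
  exact b.le_one

/-- The product cutoff at scale `R`. -/
noncomputable def cut (θ : ℝ → ℝ) (R : ℝ) (F : ℝ × ℝ → ℝ) (q : ℝ × ℝ) : ℝ :=
  θ (q.1 / R) * θ (q.2 / R) * F q

section

variable {F : ℝ × ℝ → ℝ} {θ θ1 θ2 : ℝ → ℝ} {c : ℝ}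

theorem BumpData.contDiff_cut (hb : BumpData θ θ1 θ2 c) (hF : ContDiff ℝ ∞ F) (R : ℝ) :
    ContDiff ℝ ∞ (cut θ R F) := by
  have := hb.smooth
  unfold cut
  fun_prop

theorem BumpData.hasCompactSupport_cut (hb : BumpData θ θ1 θ2 c) {R : ℝ} (hR : 0 < R)
    (F : ℝ × ℝ → ℝ) : HasCompactSupport (cut θ R F) := by
  refine HasCompactSupport.of_support_subset_isCompact
    ((isCompact_Icc (a := -(2 * R)) (b := 2 * R)).prod (isCompact_Icc (a := -(2 * R)) (b := 2 * R)))
    fun q hq => ?_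
  have key : ∀ t, θ (t / R) ≠ 0 → t ∈ Icc (-(2 * R)) (2 * R) := by
    intro t ht
    by_contra hn
    refine ht (hb.eq_zero _ ?_)
    rw [abs_div, abs_of_pos hR, lt_div_iff₀ hR]
    by_contra hle
    exact hn (abs_le.1 (not_lt.1 hle))
  simp only [Function.mem_support, cut, ne_eq, mul_eq_zero, not_or] at hq
  exact ⟨key _ hq.1.1, key _ hq.1.2⟩

theorem BumpData.dX_cut (hb : BumpData θ θ1 θ2 c) (hF : ContDiff ℝ ∞ F) (R : ℝ) (q : ℝ × ℝ) :
    dX (cut θ R F) q = θ1 (q.1 / R) / R * θ (q.2 / R) * F q + cut θ R (dX F) q := by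
  have h := (((hb.deriv1 (q.1 / R)).comp q.1 ((hasDerivAt_id q.1).div_const R)).mul_const
    (θ (q.2 / R))).mul (hasDerivAt_dX hF q.1 q.2)
  refine (hasDerivAt_dX (hb.contDiff_cut hF R) q.1 q.2).unique (h.congr_deriv ?_)
  simp only [cut, Function.comp, id]; ring

theorem BumpData.dY_cut (hb : BumpData θ θ1 θ2 c) (hF : ContDiff ℝ ∞ F) (R : ℝ) (q : ℝ × ℝ) :
    dY (cut θ R F) q = θ (q.1 / R) * (θ1 (q.2 / R) / R) * F q + cut θ R (dY F) q := by
  have h := (((hb.deriv1 (q.2 / R)).comp q.2 ((hasDerivAt_id q.2).div_const R)).const_mul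
    (θ (q.1 / R))).mul (hasDerivAt_dY hF q.1 q.2)
  refine (hasDerivAt_dY (hb.contDiff_cut hF R) q.1 q.2).unique (h.congr_deriv ?_)
  simp only [cut, Function.comp, id]; ring

theorem BumpData.dXX_cut (hb : BumpData θ θ1 θ2 c) (hF : ContDiff ℝ ∞ F) (R : ℝ) (q : ℝ × ℝ) :
    dX (dX (cut θ R F)) q = θ2 (q.1 / R) / R / R * θ (q.2 / R) * F q
      + 2 * (θ1 (q.1 / R) / R * θ (q.2 / R) * dX F q) + cut θ R (dX (dX F)) q := by
  have hX := contDiff_dX hF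
  have e : dX (cut θ R F) = fun q => θ1 (q.1 / R) / R * θ (q.2 / R) * F q + cut θ R (dX F) q :=
    funext (hb.dX_cut hF R)
  have d := (hasDerivAt_id q.1).div_const R
  have h1 := ((((hb.deriv2 (q.1 / R)).comp q.1 d).div_const R).mul_const
    (θ (q.2 / R))).mul (hasDerivAt_dX hF q.1 q.2)
  have h2 := (((hb.deriv1 (q.1 / R)).comp q.1 d).mul_const
    (θ (q.2 / R))).mul (hasDerivAt_dX hX q.1 q.2)
  have h0 := hasDerivAt_dX (contDiff_dX (hb.contDiff_cut hF R)) q.1 q.2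
  rw [e] at h0
  rw [e]
  refine h0.unique ((h1.add h2).congr_deriv ?_)
  simp only [cut, Function.comp, id]; ring

theorem BumpData.dYY_cut (hb : BumpData θ θ1 θ2 c) (hF : ContDiff ℝ ∞ F) (R : ℝ) (q : ℝ × ℝ) :
    dY (dY (cut θ R F)) q = θ (q.1 / R) * (θ2 (q.2 / R) / R / R) * F q
      + 2 * (θ (q.1 / R) * (θ1 (q.2 / R) / R) * dY F q) + cut θ R (dY (dY F)) q := by
  have hY := contDiff_dY hF
  have e : dY (cut θ R F) = fun q => θ (q.1 / R) * (θ1 (q.2 / R) / R) * F q + cut θ R (dY F) q :=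
    funext (hb.dY_cut hF R)
  have d := (hasDerivAt_id q.2).div_const R
  have h1 := ((((hb.deriv2 (q.2 / R)).comp q.2 d).div_const R).const_mul
    (θ (q.1 / R))).mul (hasDerivAt_dY hF q.1 q.2)
  have h2 := (((hb.deriv1 (q.2 / R)).comp q.2 d).const_mul
    (θ (q.1 / R))).mul (hasDerivAt_dY hY q.1 q.2)
  have h0 := hasDerivAt_dY (contDiff_dY (hb.contDiff_cut hF R)) q.1 q.2
  rw [e] at h0
  rw [e]
  refine h0.unique ((h1.add h2).congr_deriv ?_)
  simp only [cut, Function.comp, id]; ring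

/-- `|F| / (1 + y)` outside a box. -/
noncomputable def tail (R₀ : ℝ) (F : ℝ × ℝ → ℝ) : ℝ × ℝ → ℝ :=
  indicator {q | R₀ ≤ |q.1| ∨ R₀ ≤ q.2} fun q => |F q| / (1 + q.2)

theorem tail_nonneg {R₀ : ℝ} {q : ℝ × ℝ} (hq : 0 < q.2) : 0 ≤ tail R₀ F q := by
  refine indicator_apply_nonneg fun _ => ?_
  positivity

/-- On the support of a derivative of the cutoff one has `y ≤ 2R`, hence `1/R ≤ 3/(1 + y)`. So the
commutator terms are bounded, uniformly in `R`, by the function that Hardy's inequality controls. -/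
theorem abs_mul_div_le_tail {R₀ R : ℝ} (hR₀ : 1 ≤ R₀) (hR : R₀ ≤ R) {q : ℝ × ℝ} (hq : 0 < q.2)
    {m : ℝ} (hc : 0 ≤ c) (hm : |m| ≤ c)
    (hm0 : m ≠ 0 → (R ≤ |q.1| ∨ R ≤ q.2) ∧ q.2 ≤ 2 * R) :
    |m / R * F q| ≤ 3 * c * tail R₀ F q := by
  have hR0 : 0 < R := by linarith
  by_cases h : m = 0
  · simp only [h, zero_div, zero_mul, abs_zero]
    have := tail_nonneg (F := F) (R₀ := R₀) hq
    positivity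
  · obtain ⟨h1, h2⟩ := hm0 h
    have hmem : q ∈ {q : ℝ × ℝ | R₀ ≤ |q.1| ∨ R₀ ≤ q.2} := by
      rcases h1 with h1 | h1
      · exact Or.inl (hR.trans h1)
      · exact Or.inr (hR.trans h1)
    rw [tail, indicator_of_mem hmem, abs_mul, abs_div, abs_of_pos hR0]
    have h3 : 1 / R ≤ 3 / (1 + q.2) := by
      rw [div_le_div_iff₀ hR0 (by linarith)]; linarith
    calc |m| / R * |F q| ≤ c / R * |F q| := by gcongr
      _ = c * |F q| * (1 / R) := by ring
      _ ≤ c * |F q| * (3 / (1 + q.2)) := by gcongr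
      _ = _ := by ring

theorem BumpData.range_of_ne_zero (hb : BumpData θ θ1 θ2 c) {R t : ℝ} (hR : 0 < R)
    (h : θ (t / R) ≠ 0) : |t| ≤ 2 * R := by
  by_contra hn
  refine h (hb.eq_zero _ ?_)
  rw [abs_div, abs_of_pos hR, lt_div_iff₀ hR]
  exact not_le.1 hn

theorem BumpData.range_of_ne_zero1 (hb : BumpData θ θ1 θ2 c) {R t : ℝ} (hR : 0 < R)
    (h : θ1 (t / R) ≠ 0) : R ≤ |t| ∧ |t| ≤ 2 * R := by
  constructor
  · by_contra hn
    refine h (hb.eq_zero1 _ ?_)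
    rw [abs_div, abs_of_pos hR, div_lt_one hR]
    exact not_le.1 hn
  · by_contra hn
    refine h (hb.eq_zero1' _ ?_)
    rw [abs_div, abs_of_pos hR, lt_div_iff₀ hR]
    exact not_le.1 hn

theorem BumpData.range_of_ne_zero2 (hb : BumpData θ θ1 θ2 c) {R t : ℝ} (hR : 0 < R)
    (h : θ2 (t / R) ≠ 0) : R ≤ |t| ∧ |t| ≤ 2 * R := by
  constructor
  · by_contra hn
    refine h (hb.eq_zero2 _ ?_)
    rw [abs_div, abs_of_pos hR, div_lt_one hR]
    exact not_le.1 hn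
  · by_contra hn
    refine h (hb.eq_zero2' _ ?_)
    rw [abs_div, abs_of_pos hR, lt_div_iff₀ hR]
    exact not_le.1 hn

theorem abs_mul_le_mul_of_abs_le_one {a b c : ℝ} (ha : |a| ≤ c) (hb : |b| ≤ 1) : |a * b| ≤ c := by
  rw [abs_mul]
  exact (mul_le_of_le_one_right (abs_nonneg _) hb).trans ha

theorem BumpData.abs_cut_le (hb : BumpData θ θ1 θ2 c) (R : ℝ) (G : ℝ × ℝ → ℝ) (q : ℝ × ℝ) :
    |cut θ R G q| ≤ |G q| := by
  unfold cut
  rw [abs_mul]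
  exact mul_le_of_le_one_left (abs_nonneg _)
    (abs_mul_le_mul_of_abs_le_one (hb.abs_le_one _) (hb.abs_le_one _))

theorem BumpData.abs_dX_cut_sub_le (hb : BumpData θ θ1 θ2 c) (hF : ContDiff ℝ ∞ F) {R₀ R : ℝ}
    (hR₀ : 1 ≤ R₀) (hR : R₀ ≤ R) {q : ℝ × ℝ} (hq : 0 < q.2) :
    |dX (cut θ R F) q - cut θ R (dX F) q| ≤ 3 * c * tail R₀ F q := by
  have hR0 : 0 < R := by linarith
  have e : dX (cut θ R F) q - cut θ R (dX F) q = θ1 (q.1 / R) * θ (q.2 / R) / R * F q := by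
    rw [hb.dX_cut hF]; ring
  rw [e]
  refine abs_mul_div_le_tail hR₀ hR hq hb.c_nonneg
    (abs_mul_le_mul_of_abs_le_one (hb.abs_le1 _) (hb.abs_le_one _)) fun h => ?_
  exact ⟨Or.inl (hb.range_of_ne_zero1 hR0 (left_ne_zero_of_mul h)).1,
    (le_abs_self _).trans (hb.range_of_ne_zero hR0 (right_ne_zero_of_mul h))⟩

theorem BumpData.abs_dY_cut_sub_le (hb : BumpData θ θ1 θ2 c) (hF : ContDiff ℝ ∞ F) {R₀ R : ℝ}
    (hR₀ : 1 ≤ R₀) (hR : R₀ ≤ R) {q : ℝ × ℝ} (hq : 0 < q.2) :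
    |dY (cut θ R F) q - cut θ R (dY F) q| ≤ 3 * c * tail R₀ F q := by
  have hR0 : 0 < R := by linarith
  have e : dY (cut θ R F) q - cut θ R (dY F) q = θ1 (q.2 / R) * θ (q.1 / R) / R * F q := by
    rw [hb.dY_cut hF]; ring
  rw [e]
  refine abs_mul_div_le_tail hR₀ hR hq hb.c_nonneg
    (abs_mul_le_mul_of_abs_le_one (hb.abs_le1 _) (hb.abs_le_one _)) fun h => ?_
  have := hb.range_of_ne_zero1 hR0 (left_ne_zero_of_mul h)
  rw [abs_of_pos hq] at this
  exact ⟨Or.inr this.1, this.2⟩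

/-- On the support of the cutoff `r ≤ 3R`. The weight therefore cancels one factor `1/R` in each
commutator term: `∇θ·∇F` is bounded by `|∇F|` and `FΔθ` by `|F|/R`, hence by the tail. -/
theorem BumpData.norm_mul_abs_laplacian_cut_le (hb : BumpData θ θ1 θ2 c) (hF : ContDiff ℝ ∞ F)
    {R₀ R : ℝ} (hR₀ : 1 ≤ R₀) (hR : R₀ ≤ R) {q : ℝ × ℝ} (hq : 0 < q.2) :
    Real.sqrt (q.1 ^ 2 + q.2 ^ 2) * |dX (dX (cut θ R F)) q + dY (dY (cut θ R F)) q| ≤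
      Real.sqrt (q.1 ^ 2 + q.2 ^ 2) * |dX (dX F) q + dY (dY F) q|
        + 6 * c * (|dX F q| + |dY F q|) + 18 * c * tail R₀ F q := by
  have hR0 : 0 < R := by linarith
  set r := Real.sqrt (q.1 ^ 2 + q.2 ^ 2) with hr
  have hr0 : 0 ≤ r := Real.sqrt_nonneg _
  have hrR : |q.1| ≤ 2 * R → |q.2| ≤ 2 * R → r ≤ 3 * R := by
    intro h1 h2
    rw [hr]
    refine Real.sqrt_le_iff.2 ⟨by positivity, ?_⟩
    nlinarith [sq_abs q.1, sq_abs q.2, abs_nonneg q.1, abs_nonneg q.2]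
  have e : dX (dX (cut θ R F)) q + dY (dY (cut θ R F)) q
      = cut θ R (fun q => dX (dX F) q + dY (dY F) q) q
        + 2 * (θ1 (q.1 / R) * θ (q.2 / R) / R * dX F q)
        + 2 * (θ1 (q.2 / R) * θ (q.1 / R) / R * dY F q)
        + (θ2 (q.1 / R) * θ (q.2 / R) / R * F q) / R
        + (θ2 (q.2 / R) * θ (q.1 / R) / R * F q) / R := by
    rw [hb.dXX_cut hF, hb.dYY_cut hF]
    simp only [cut]
    ring
  have first : ∀ m G : ℝ, |m| ≤ c → (m ≠ 0 → r ≤ 3 * R) → r * |m / R * G| ≤ 3 * c * |G| := by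
    intro m G hm h0
    by_cases h : m = 0
    · simp only [h, zero_div, zero_mul, abs_zero, mul_zero]
      have := hb.c_nonneg
      positivity
    · rw [abs_mul, abs_div, abs_of_pos hR0]
      calc r * (|m| / R * |G|) ≤ 3 * R * (c / R * |G|) := by
            have := h0 h
            have := hb.c_nonneg
            gcongr
        _ = _ := by field_simp
  have second : ∀ m : ℝ, |m| ≤ c → (m ≠ 0 → (R ≤ |q.1| ∨ R ≤ q.2) ∧ |q.1| ≤ 2 * R ∧ |q.2| ≤ 2 * R) →
      r * |m / R * F q / R| ≤ 9 * c * tail R₀ F q := by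
    intro m hm h0
    by_cases h : m = 0
    · simp only [h, zero_div, zero_mul, abs_zero, mul_zero]
      have := tail_nonneg (F := F) (R₀ := R₀) hq
      have := hb.c_nonneg
      positivity
    · obtain ⟨h1, h2, h3⟩ := h0 h
      have t := abs_mul_div_le_tail (F := F) hR₀ hR hq hb.c_nonneg hm fun _ =>
        ⟨h1, (le_abs_self _).trans h3⟩
      rw [abs_div, abs_of_pos hR0]
      calc r * (|m / R * F q| / R) ≤ 3 * R * (3 * c * tail R₀ F q / R) := by
            have := hrR h2 h3
            gcongr
        _ = _ := by field_simp; ring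
  have b1 := first (θ1 (q.1 / R) * θ (q.2 / R)) (dX F q)
    (abs_mul_le_mul_of_abs_le_one (hb.abs_le1 _) (hb.abs_le_one _)) fun h =>
      hrR (hb.range_of_ne_zero1 hR0 (left_ne_zero_of_mul h)).2
        (hb.range_of_ne_zero hR0 (right_ne_zero_of_mul h))
  have b2 := first (θ1 (q.2 / R) * θ (q.1 / R)) (dY F q)
    (abs_mul_le_mul_of_abs_le_one (hb.abs_le1 _) (hb.abs_le_one _)) fun h =>
      hrR (hb.range_of_ne_zero hR0 (right_ne_zero_of_mul h))
        (hb.range_of_ne_zero1 hR0 (left_ne_zero_of_mul h)).2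
  have b3 := second (θ2 (q.1 / R) * θ (q.2 / R))
    (abs_mul_le_mul_of_abs_le_one (hb.abs_le2 _) (hb.abs_le_one _)) fun h =>
      ⟨Or.inl (hb.range_of_ne_zero2 hR0 (left_ne_zero_of_mul h)).1,
        (hb.range_of_ne_zero2 hR0 (left_ne_zero_of_mul h)).2,
        hb.range_of_ne_zero hR0 (right_ne_zero_of_mul h)⟩
  have b4 := second (θ2 (q.2 / R) * θ (q.1 / R))
    (abs_mul_le_mul_of_abs_le_one (hb.abs_le2 _) (hb.abs_le_one _)) fun h =>
      ⟨Or.inr (by simpa [abs_of_pos hq] using (hb.range_of_ne_zero2 hR0 (left_ne_zero_of_mul h)).1),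
        hb.range_of_ne_zero hR0 (right_ne_zero_of_mul h),
        (hb.range_of_ne_zero2 hR0 (left_ne_zero_of_mul h)).2⟩
  have b0 := mul_le_mul_of_nonneg_left
    (hb.abs_cut_le R (fun q => dX (dX F) q + dY (dY F) q) q) hr0
  rw [e]
  generalize cut θ R (fun q => dX (dX F) q + dY (dY F) q) q = z0 at *
  generalize θ1 (q.1 / R) * θ (q.2 / R) / R * dX F q = z1 at *
  generalize θ1 (q.2 / R) * θ (q.1 / R) / R * dY F q = z2 at *
  generalize θ2 (q.1 / R) * θ (q.2 / R) / R * F q / R = z3 at *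
  generalize θ2 (q.2 / R) * θ (q.1 / R) / R * F q / R = z4 at *
  have tri : |z0 + 2 * z1 + 2 * z2 + z3 + z4| ≤ |z0| + 2 * |z1| + 2 * |z2| + |z3| + |z4| := by
    refine (abs_add_le _ _).trans (add_le_add_left ((abs_add_le _ _).trans (add_le_add_left
      ((abs_add_le _ _).trans (add_le_add ((abs_add_le _ _).trans ?_) ?_)) _)) _)
    · rw [abs_mul, abs_two]
    · rw [abs_mul, abs_two]
  have := mul_le_mul_of_nonneg_left tri hr0
  linarith

end

/-! ### Fields of finite energy -/

/-- A smooth field of finite energy on a water domain `A` in the half-plane. -/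
structure EnergyField (ν L h H : ℝ) (A : Set (ℝ × ℝ)) (F : ℝ × ℝ → ℝ) : Prop where
  L_pos : 0 < L
  h_pos : 0 < h
  H_pos : 0 < H
  measurable : MeasurableSet A
  pos : ∀ q ∈ A, 0 < q.2
  side : ∀ x y, 0 < y → L < |x| → (x, y) ∈ A
  top : ∀ x y, 0 < y → y < h → (x, y) ∈ A
  deep : ∀ x y, H < y → (x, y) ∈ A
  smooth : ContDiff ℝ ∞ F
  gradX : IntegrableOn (fun q => dX F q ^ 2) A
  gradY : IntegrableOn (fun q => dY F q ^ 2) A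
  trace : Integrable fun x => F (x, 0) ^ 2
  laplacian : IntegrableOn (fun q => (q.1 ^ 2 + q.2 ^ 2) * (dX (dX F) q + dY (dY F) q) ^ 2) A
  surface : Integrable fun x => (x * (dY F (x, 0) + ν * F (x, 0))) ^ 2

section

variable {ν L h H : ℝ} {A : Set (ℝ × ℝ)} {F : ℝ × ℝ → ℝ}

/-- A box that contains the body. -/
def boxRadius (L H : ℝ) : ℝ := max L H + 1

theorem EnergyField.one_le_boxRadius (hE : EnergyField ν L h H A F) : 1 ≤ boxRadius L H := by
  have := hE.L_pos
  have := le_max_left L H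
  unfold boxRadius
  linarith

theorem EnergyField.mem_of_boxRadius_le (hE : EnergyField ν L h H A F) {q : ℝ × ℝ} (hq : 0 < q.2)
    (h : boxRadius L H ≤ |q.1| ∨ boxRadius L H ≤ q.2) : q ∈ A := by
  have h1 := le_max_left L H
  have h2 := le_max_right L H
  unfold boxRadius at h
  rcases h with h | h
  · exact hE.side q.1 q.2 hq (by linarith)
  · exact hE.deep q.1 q.2 (by linarith)

/-- Hardy's inequality on columns beside the box starts from the surface, where the trace is in
`L₂`. On columns passing through the box it starts below the body, where the trace is continuous
over a bounded interval. -/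
theorem EnergyField.integrableOn_tail_sq (hE : EnergyField ν L h H A F) :
    IntegrableOn (fun q => tail (boxRadius L H) F q ^ 2) A := by
  set R₀ := boxRadius L H with hR₀
  have h1 := le_max_left L H
  have h2 := le_max_right L H
  have hR : R₀ = max L H + 1 := rfl
  have hL := hE.L_pos
  have hF := hE.smooth
  have hFc := hF.continuous
  have i1 : IntegrableOn (fun q => F q ^ 2 / (1 + q.2) ^ 2) ({x | R₀ ≤ |x|} ×ˢ Ioi 0) := by
    refine integrableOn_hardy hF le_rfl hE.trace.integrableOn (hE.gradY.mono_set ?_)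
    rintro ⟨x, y⟩ ⟨hx, hy⟩
    exact hE.mem_of_boxRadius_le hy (Or.inl hx)
  have i2 : IntegrableOn (fun q => F q ^ 2 / (1 + q.2) ^ 2) (Icc (-R₀) R₀ ×ˢ Ioi (max L H)) := by
    refine integrableOn_hardy hF (hL.le.trans h1) (Continuous.integrableOn_Icc (by fun_prop))
      (hE.gradY.mono_set ?_)
    rintro ⟨x, y⟩ ⟨_, hy⟩
    exact hE.deep x y (h2.trans_lt hy)
  have e : (fun q => tail R₀ F q ^ 2) = indicator {q : ℝ × ℝ | R₀ ≤ |q.1| ∨ R₀ ≤ q.2}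
      fun q => F q ^ 2 / (1 + q.2) ^ 2 := by
    funext q
    by_cases hq : q ∈ {q : ℝ × ℝ | R₀ ≤ |q.1| ∨ R₀ ≤ q.2}
    · rw [tail, indicator_of_mem hq, indicator_of_mem hq, div_pow, sq_abs]
    · rw [tail, indicator_of_notMem hq, indicator_of_notMem hq]; norm_num
  have hS : MeasurableSet {q : ℝ × ℝ | R₀ ≤ |q.1| ∨ R₀ ≤ q.2} :=
    (measurableSet_le (f := fun _ => R₀) (g := fun q : ℝ × ℝ => |q.1|) measurable_const
      (continuous_fst.abs.measurable)).union
      (measurableSet_le (g := fun q : ℝ × ℝ => q.2) measurable_const measurable_snd)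
  rw [e, integrableOn_indicator_iff hS]
  refine (i1.union i2).mono_set ?_
  rintro ⟨x, y⟩ ⟨hq, hA⟩
  have hy : 0 < y := hE.pos _ hA
  by_cases hx : R₀ ≤ |x|
  · exact Or.inl ⟨hx, hy⟩
  · refine Or.inr ⟨abs_le.1 (not_le.1 hx).le, ?_⟩
    have : R₀ ≤ y := hq.resolve_left hx
    simp only [mem_Ioi]
    linarith

variable {θ θ1 θ2 : ℝ → ℝ} {c : ℝ}

theorem BumpData.eventually_eq (hb : BumpData θ θ1 θ2 c) (t : ℝ) :
    ∀ᶠ R in Filter.atTop, θ (t / R) = 1 ∧ θ1 (t / R) = 0 ∧ θ2 (t / R) = 0 := by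
  filter_upwards [Filter.eventually_gt_atTop |t|] with R hR
  have hR0 : 0 < R := (abs_nonneg t).trans_lt hR
  have : |t / R| < 1 := by rwa [abs_div, abs_of_pos hR0, div_lt_one hR0]
  exact ⟨hb.eq_one _ this.le, hb.eq_zero1 _ this, hb.eq_zero2 _ this⟩

theorem BumpData.eventually_cut (hb : BumpData θ θ1 θ2 c) (hF : ContDiff ℝ ∞ F) (q : ℝ × ℝ) :
    ∀ᶠ R in Filter.atTop, cut θ R F q = F q ∧ dX (cut θ R F) q = dX F q ∧
      dY (cut θ R F) q = dY F q ∧ dX (dX (cut θ R F)) q = dX (dX F) q ∧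
      dY (dY (cut θ R F)) q = dY (dY F) q := by
  filter_upwards [hb.eventually_eq q.1, hb.eventually_eq q.2] with R h1 h2
  refine ⟨?_, ?_, ?_, ?_, ?_⟩
  · simp [cut, h1, h2]
  · simp [hb.dX_cut hF, cut, h1, h2]
  · simp [hb.dY_cut hF, cut, h1, h2]
  · simp [hb.dXX_cut hF, cut, h1, h2]
  · simp [hb.dYY_cut hF, cut, h1, h2]

theorem BumpData.cut_surface (hb : BumpData θ θ1 θ2 c) (R x : ℝ) (G : ℝ × ℝ → ℝ) :
    cut θ R G (x, 0) = θ (x / R) * G (x, 0) := by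
  simp [cut, hb.eq_one 0 (by simp)]

/-- The vertical cutoff equals 1 near the surface, so the surface operator produces no commutator.
-/
theorem BumpData.dY_cut_surface (hb : BumpData θ θ1 θ2 c) (hF : ContDiff ℝ ∞ F) (R x : ℝ) :
    dY (cut θ R F) (x, 0) = θ (x / R) * dY F (x, 0) := by
  rw [hb.dY_cut hF, hb.cut_surface]
  simp [hb.eq_zero1 0 (by simp)]

/-- A majorant independent of `R`, for dominated convergence. Only its integrability matters, not
the size of the constants. -/
theorem BumpData.boundDensity_cut_le (hb : BumpData θ θ1 θ2 c) (hF : ContDiff ℝ ∞ F) {R₀ R C : ℝ}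
    (hC : 0 ≤ C) (hR₀ : 1 ≤ R₀) (hR : R₀ ≤ R) {q : ℝ × ℝ} (hq : 0 < q.2) :
    boundDensity C (cut θ R F) q ≤
      72 * ((q.1 ^ 2 + q.2 ^ 2) * (dX (dX F) q + dY (dY F) q) ^ 2)
        + (2592 * c ^ 2 + 2 * C) * dX F q ^ 2 + (2592 * c ^ 2 + 6) * dY F q ^ 2
        + (54 * c ^ 2 + 23328 * c ^ 2 + 18 * C * c ^ 2) * tail R₀ F q ^ 2 := by
  have h1 := hb.abs_dX_cut_sub_le hF hR₀ hR hq
  have h2 := hb.abs_dY_cut_sub_le hF hR₀ hR hq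
  have h3 := hb.norm_mul_abs_laplacian_cut_le hF hR₀ hR hq
  have g1 := hb.abs_cut_le R (dX F) q
  have g2 := hb.abs_cut_le R (dY F) q
  have hK := tail_nonneg (F := F) (R₀ := R₀) hq
  have hc := hb.c_nonneg
  have e0 : ∀ t : ℝ, (q.1 ^ 2 + q.2 ^ 2) * t ^ 2 = (Real.sqrt (q.1 ^ 2 + q.2 ^ 2) * |t|) ^ 2 :=
    fun t => by rw [mul_pow, Real.sq_sqrt (by positivity), sq_abs]
  unfold boundDensity
  rw [e0, e0]
  have hZ : 0 ≤ Real.sqrt (q.1 ^ 2 + q.2 ^ 2) * |dX (dX F) q + dY (dY F) q| := by positivity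
  have hZR : 0 ≤ Real.sqrt (q.1 ^ 2 + q.2 ^ 2) *
    |dX (dX (cut θ R F)) q + dY (dY (cut θ R F)) q| := by positivity
  generalize Real.sqrt (q.1 ^ 2 + q.2 ^ 2) * |dX (dX (cut θ R F)) q + dY (dY (cut θ R F)) q| = ZR at *
  generalize Real.sqrt (q.1 ^ 2 + q.2 ^ 2) * |dX (dX F) q + dY (dY F) q| = Z at *
  generalize tail R₀ F q = K at *
  generalize dX (cut θ R F) q = XR at *
  generalize dY (cut θ R F) q = YR at *
  generalize cut θ R (dX F) q = X' at *
  generalize cut θ R (dY F) q = Y' at *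
  have sq_le : ∀ a b d m : ℝ, |a - b| ≤ m → |b| ≤ |d| → a ^ 2 ≤ 2 * d ^ 2 + 2 * m ^ 2 := by
    intro a b d m hab hbd
    have h5 : (a - b) ^ 2 ≤ m ^ 2 := sq_le_sq' (by linarith [(abs_le.1 hab).1]) (abs_le.1 hab).2
    have h6 : b ^ 2 ≤ d ^ 2 := sq_le_sq.2 hbd
    nlinarith [sq_nonneg (a - 2 * b)]
  have s1 := sq_le XR X' _ _ h1 g1
  have s2 := sq_le YR Y' _ _ h2 g2
  have s3 : ZR ^ 2 ≤ 4 * (Z ^ 2 + 36 * c ^ 2 * dX F q ^ 2 + 36 * c ^ 2 * dY F q ^ 2 + 324 * c ^ 2 * K ^ 2) := by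
    refine (pow_le_pow_left₀ hZR h3 2).trans ?_
    rw [← sq_abs (dX F q), ← sq_abs (dY F q)]
    generalize |dX F q| = x
    generalize |dY F q| = y
    nlinarith [sq_nonneg (Z - 6 * c * x), sq_nonneg (Z - 6 * c * y), sq_nonneg (Z - 18 * c * K),
      sq_nonneg (6 * c * x - 6 * c * y), sq_nonneg (6 * c * x - 18 * c * K),
      sq_nonneg (6 * c * y - 18 * c * K)]
  have := mul_le_mul_of_nonneg_left s1 hC
  linarith

/-- Limit `R → ∞` in the compactly supported case; at every fixed point the cut field and its
derivatives eventually agree with the original ones. -/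
theorem EnergyField.trace_inequality (hE : EnergyField ν L h H A F) (hν : 0 < ν) :
    4 * ν * ∫ x, F (x, 0) ^ 2 ≤
      (∫ q in A, boundDensity (72 * (ν * L ^ 2 / h) * (1 + ν * h) ^ 3) F q)
      + 18 * (ν * ∫ x, (x * (dY F (x, 0) + ν * F (x, 0))) ^ 2) := by
  obtain ⟨θ, θ1, θ2, c, hb⟩ := exists_bumpData
  have hF := hE.smooth
  have hFc := hF.continuous
  have hYc := (contDiff_dY hF).continuous
  have hθc := hb.smooth.continuous
  have hL := hE.L_pos
  have hh := hE.h_pos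
  have hR₀ := hE.one_le_boxRadius
  set C := 72 * (ν * L ^ 2 / h) * (1 + ν * h) ^ 3 with hC
  have hC0 : 0 ≤ C := by positivity
  have ev : ∀ᶠ R : ℝ in Filter.atTop, boxRadius L H ≤ R := Filter.eventually_ge_atTop _
  have key : ∀ᶠ R : ℝ in Filter.atTop, 4 * ν * ∫ x, cut θ R F (x, 0) ^ 2 ≤
      (∫ q in A, boundDensity C (cut θ R F) q)
      + 18 * (ν * ∫ x, (x * (dY (cut θ R F) (x, 0) + ν * cut θ R F (x, 0))) ^ 2) := by
    filter_upwards [ev] with R hR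
    exact trace_inequality_of_hasCompactSupport (hb.contDiff_cut hF R)
      (hb.hasCompactSupport_cut (by linarith) F) hν hL hh hE.measurable hE.side hE.top
  have hθsq : ∀ t a : ℝ, ‖(θ t * a) ^ 2‖ ≤ a ^ 2 := fun t a => by
    rw [Real.norm_eq_abs, abs_of_nonneg (sq_nonneg _), mul_pow]
    refine mul_le_of_le_one_left (sq_nonneg _) ?_
    rw [← sq_abs]
    exact pow_le_one₀ (abs_nonneg _) (hb.abs_le_one t)
  have t1 : Filter.Tendsto (fun R => ∫ x, cut θ R F (x, 0) ^ 2) Filter.atTop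
      (nhds (∫ x, F (x, 0) ^ 2)) := by
    simp only [hb.cut_surface]
    refine tendsto_integral_filter_of_dominated_convergence (fun x => F (x, 0) ^ 2) ?_ ?_ hE.trace ?_
    · exact Filter.Eventually.of_forall fun R => Continuous.aestronglyMeasurable (by fun_prop)
    · exact Filter.Eventually.of_forall fun R => Filter.Eventually.of_forall fun x => hθsq _ _
    · refine Filter.Eventually.of_forall fun x => tendsto_const_nhds.congr' ?_
      filter_upwards [hb.eventually_eq x] with R h
      rw [h.1, one_mul]
  have t2 : Filter.Tendsto (fun R => ∫ x, (x * (dY (cut θ R F) (x, 0) + ν * cut θ R F (x, 0))) ^ 2)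
      Filter.atTop (nhds (∫ x, (x * (dY F (x, 0) + ν * F (x, 0))) ^ 2)) := by
    have e : ∀ R x, x * (dY (cut θ R F) (x, 0) + ν * cut θ R F (x, 0))
        = θ (x / R) * (x * (dY F (x, 0) + ν * F (x, 0))) := fun R x => by
      rw [hb.cut_surface, hb.dY_cut_surface hF]; ring
    simp only [e]
    refine tendsto_integral_filter_of_dominated_convergence
      (fun x => (x * (dY F (x, 0) + ν * F (x, 0))) ^ 2) ?_ ?_ hE.surface ?_
    · exact Filter.Eventually.of_forall fun R => Continuous.aestronglyMeasurable (by fun_prop)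
    · exact Filter.Eventually.of_forall fun R => Filter.Eventually.of_forall fun x => hθsq _ _
    · refine Filter.Eventually.of_forall fun x => tendsto_const_nhds.congr' ?_
      filter_upwards [hb.eventually_eq x] with R h
      rw [h.1, one_mul]
  have t3 : Filter.Tendsto (fun R => ∫ q in A, boundDensity C (cut θ R F) q) Filter.atTop
      (nhds (∫ q in A, boundDensity C F q)) := by
    refine tendsto_integral_filter_of_dominated_convergence (fun q =>
      72 * ((q.1 ^ 2 + q.2 ^ 2) * (dX (dX F) q + dY (dY F) q) ^ 2)
        + (2592 * c ^ 2 + 2 * C) * dX F q ^ 2 + (2592 * c ^ 2 + 6) * dY F q ^ 2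
        + (54 * c ^ 2 + 23328 * c ^ 2 + 18 * C * c ^ 2) * tail (boxRadius L H) F q ^ 2) ?_ ?_ ?_ ?_
    · exact Filter.Eventually.of_forall fun R =>
        (continuous_boundDensity (hb.contDiff_cut hF R) C).aestronglyMeasurable
    · filter_upwards [ev] with R hR
      filter_upwards [ae_restrict_mem hE.measurable] with q hq
      rw [Real.norm_eq_abs, abs_of_nonneg (boundDensity_nonneg hC0 q)]
      exact hb.boundDensity_cut_le hF hC0 hR₀ hR (hE.pos q hq)
    · exact (((hE.laplacian.const_mul _).add (hE.gradX.const_mul _)).add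
        (hE.gradY.const_mul _)).add (hE.integrableOn_tail_sq.const_mul _)
    · refine Filter.Eventually.of_forall fun q => tendsto_const_nhds.congr' ?_
      filter_upwards [hb.eventually_cut hF q] with R h
      simp only [boundDensity, h]
  exact le_of_tendsto_of_tendsto (t1.const_mul _) (t3.add ((t2.const_mul ν).const_mul 18)) key

/-- Products of the field with functions of finite weighted norm are integrable. -/
theorem EnergyField.integrableOn_mul (hE : EnergyField ν L h H A F) {k : ℝ × ℝ → ℝ}
    (hk : Continuous k) (hkA : IntegrableOn (fun q => (q.1 ^ 2 + q.2 ^ 2) * k q ^ 2) A) :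
    IntegrableOn (fun q => k q * F q) A := by
  have hF := hE.smooth
  have hFc := hF.continuous
  set R₀ := boxRadius L H with hR₀d
  have hR₀ : 1 ≤ R₀ := hE.one_le_boxRadius
  have hbox : IntegrableOn (fun q => |k q * F q|)
      (Icc (-R₀) R₀ ×ˢ Icc (-R₀) R₀) :=
    Continuous.continuousOn (by fun_prop) |>.integrableOn_compact (isCompact_Icc.prod isCompact_Icc)
  have hdom : IntegrableOn (fun q => indicator (Icc (-R₀) R₀ ×ˢ Icc (-R₀) R₀)
      (fun q => |k q * F q|) q
      + (4 * ((q.1 ^ 2 + q.2 ^ 2) * k q ^ 2) + tail R₀ F q ^ 2)) A := by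
    refine Integrable.add ?_ ((hkA.const_mul 4).add hE.integrableOn_tail_sq)
    exact ((integrable_indicator_iff (measurableSet_Icc.prod measurableSet_Icc)).2 hbox).integrableOn
  refine Integrable.mono' hdom (Continuous.aestronglyMeasurable (by fun_prop)) ?_
  filter_upwards [ae_restrict_mem hE.measurable] with q hq
  have hq0 := hE.pos q hq
  rw [Real.norm_eq_abs]
  by_cases hin : q ∈ Icc (-R₀) R₀ ×ˢ Icc (-R₀) R₀
  · rw [indicator_of_mem hin]
    have : 0 ≤ 4 * ((q.1 ^ 2 + q.2 ^ 2) * k q ^ 2) + tail R₀ F q ^ 2 := by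
      positivity
    linarith
  · have hmem : q ∈ {q : ℝ × ℝ | R₀ ≤ |q.1| ∨ R₀ ≤ q.2} := by
      by_contra hn
      simp only [mem_ofPred_eq, not_or, not_le] at hn
      exact hin ⟨abs_le.1 hn.1.le, ⟨by linarith, hn.2.le⟩⟩
    rw [indicator_of_notMem hin, zero_add, tail, indicator_of_mem hmem, abs_mul, div_pow,
      ← sq_abs (k q)]
    -- Outside the box `r ≥ 1`, so `1 + y` is comparable to `r` from above, and `kF` is split as
    -- `((1+y)k)(F/(1+y))`.
    have hr : (1 + q.2) ^ 2 ≤ 4 * (4 * (q.1 ^ 2 + q.2 ^ 2)) := by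
      have h1 : 1 ≤ q.1 ^ 2 + q.2 ^ 2 := by
        rcases hmem with hm | hm
        · nlinarith [sq_abs q.1]
        · nlinarith [sq_nonneg q.1]
      nlinarith [sq_nonneg q.1, sq_nonneg (q.2 - 1)]
    generalize |k q| = a
    have hy : 0 < 1 + q.2 := by linarith
    have e : a * |F q| = ((1 + q.2) * a) * (|F q| / (1 + q.2)) := by field_simp
    rw [e, ← div_pow]
    have := mul_le_mul_of_nonneg_right hr (sq_nonneg a)
    nlinarith [sq_nonneg (1 / 2 * ((1 + q.2) * a) - (|F q| / (1 + q.2)))]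

theorem EnergyField.integrableOn_laplacian_mul (hE : EnergyField ν L h H A F) :
    IntegrableOn (fun q => (dX (dX F) q + dY (dY F) q) * F q) A := by
  have hXX := (contDiff_dX (contDiff_dX hE.smooth)).continuous
  have hYY := (contDiff_dY (contDiff_dY hE.smooth)).continuous
  exact hE.integrableOn_mul (k := fun q => dX (dX F) q + dY (dY F) q) (hXX.add hYY) hE.laplacian

theorem EnergyField.integrable_surface_mul (hE : EnergyField ν L h H A F)
    (hg : Integrable fun x => (dY F (x, 0) + ν * F (x, 0)) * F (x, 0)) :
    Integrable fun x => dY F (x, 0) * F (x, 0) := by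
  have := hg.sub (hE.trace.const_mul ν)
  refine this.congr (Filter.Eventually.of_forall fun x => ?_)
  simp only [Pi.sub_apply]
  ring

/-- The energy identity, from Green's formula for compactly supported test functions. -/
theorem EnergyField.energy_identity (hE : EnergyField ν L h H A F) {S : ℝ}
    (hg : Integrable fun x => (dY F (x, 0) + ν * F (x, 0)) * F (x, 0))
    (hgreen : ∀ φ : ℝ × ℝ → ℝ, ContDiff ℝ ∞ φ → HasCompactSupport φ →
      (∀ x y, |x| ≤ boxRadius L H → |y| ≤ boxRadius L H → φ (x, y) = F (x, y)) →
      ∫ q in A, (dX F q * dX φ q + dY F q * dY φ q + (dX (dX F) q + dY (dY F) q) * φ q)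
        = -(∫ x, dY F (x, 0) * φ (x, 0)) + S) :
    (∫ q in A, dX F q ^ 2) + (∫ q in A, dY F q ^ 2) =
      (∫ q in A, -(dX (dX F) q + dY (dY F) q) * F q) + S
        + (∫ x, (-dY F (x, 0) - ν * F (x, 0)) * F (x, 0)) + ν * ∫ x, F (x, 0) ^ 2 := by
  obtain ⟨θ, θ1, θ2, c, hb⟩ := exists_bumpData
  have hF := hE.smooth
  have hFc := hF.continuous
  have hX := contDiff_dX hF
  have hY := contDiff_dY hF
  have hXc := hX.continuous
  have hYc := hY.continuous
  have hXXc := (contDiff_dX hX).continuous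
  have hYYc := (contDiff_dY hY).continuous
  have hθc := hb.smooth.continuous
  set R₀ := boxRadius L H with hR₀d
  have hR₀ : 1 ≤ R₀ := hE.one_le_boxRadius
  have hs := hE.integrable_surface_mul hg
  have hl := hE.integrableOn_laplacian_mul
  have ev : ∀ᶠ R : ℝ in Filter.atTop, R₀ ≤ R := Filter.eventually_ge_atTop _
  -- For large `R` the cutoff is 1 on the box containing the body, so the body term `S` does not
  -- depend on `R`.
  have key : ∀ᶠ R : ℝ in Filter.atTop,
      ∫ q in A, (dX F q * dX (cut θ R F) q + dY F q * dY (cut θ R F) q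
        + (dX (dX F) q + dY (dY F) q) * cut θ R F q)
        = -(∫ x, dY F (x, 0) * cut θ R F (x, 0)) + S := by
    filter_upwards [ev] with R hR
    have hR0 : 0 < R := by linarith
    refine hgreen _ (hb.contDiff_cut hF R) (hb.hasCompactSupport_cut hR0 F) fun x y hx hy => ?_
    have : ∀ t : ℝ, |t| ≤ R₀ → θ (t / R) = 1 := fun t ht => hb.eq_one _ (by
      rw [abs_div, abs_of_pos hR0, div_le_one hR0]; exact ht.trans hR)
    simp [cut, this x hx, this y hy]
  have t1 : Filter.Tendsto (fun R => ∫ x, dY F (x, 0) * cut θ R F (x, 0)) Filter.atTop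
      (nhds (∫ x, dY F (x, 0) * F (x, 0))) := by
    simp only [hb.cut_surface]
    refine tendsto_integral_filter_of_dominated_convergence (fun x => |dY F (x, 0) * F (x, 0)|)
      ?_ ?_ hs.abs ?_
    · exact Filter.Eventually.of_forall fun R => Continuous.aestronglyMeasurable (by fun_prop)
    · refine Filter.Eventually.of_forall fun R => Filter.Eventually.of_forall fun x => ?_
      rw [Real.norm_eq_abs, mul_left_comm, abs_mul]
      exact mul_le_of_le_one_left (abs_nonneg _) (hb.abs_le_one _)
    · refine Filter.Eventually.of_forall fun x => tendsto_const_nhds.congr' ?_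
      filter_upwards [hb.eventually_eq x] with R h
      rw [h.1, one_mul]
  have t2 : Filter.Tendsto (fun R => ∫ q in A, (dX F q * dX (cut θ R F) q
        + dY F q * dY (cut θ R F) q + (dX (dX F) q + dY (dY F) q) * cut θ R F q)) Filter.atTop
      (nhds (∫ q in A, (dX F q ^ 2 + dY F q ^ 2 + (dX (dX F) q + dY (dY F) q) * F q))) := by
    refine tendsto_integral_filter_of_dominated_convergence (fun q =>
      2 * dX F q ^ 2 + 2 * dY F q ^ 2 + (9 * c ^ 2) * tail R₀ F q ^ 2
        + |(dX (dX F) q + dY (dY F) q) * F q|) ?_ ?_ ?_ ?_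
    · refine Filter.Eventually.of_forall fun R => Continuous.aestronglyMeasurable ?_
      have h1 := (contDiff_dX (hb.contDiff_cut hF R)).continuous
      have h2 := (contDiff_dY (hb.contDiff_cut hF R)).continuous
      have h3 := (hb.contDiff_cut hF R).continuous
      fun_prop
    · filter_upwards [ev] with R hR
      filter_upwards [ae_restrict_mem hE.measurable] with q hq
      have hq0 := hE.pos q hq
      have h1 := hb.abs_dX_cut_sub_le hF hR₀ hR hq0
      have h2 := hb.abs_dY_cut_sub_le hF hR₀ hR hq0
      have g1 := hb.abs_cut_le R (dX F) q
      have g2 := hb.abs_cut_le R (dY F) q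
      have g3 := hb.abs_cut_le R F q
      rw [Real.norm_eq_abs]
      have prod : ∀ a b d m : ℝ, |a - b| ≤ m → |b| ≤ |d| → |d * a| ≤ 2 * d ^ 2 + m ^ 2 / 2 := by
        intro a b d m hab hbd
        have h4 : |a| ≤ m + |d| := by
          calc |a| = |(a - b) + b| := by ring_nf
            _ ≤ |a - b| + |b| := abs_add_le _ _
            _ ≤ _ := add_le_add hab hbd
        rw [abs_mul]
        have := mul_le_mul_of_nonneg_left h4 (abs_nonneg d)
        nlinarith [sq_nonneg (|d| - m), sq_abs d]
      have p1 := prod _ _ _ _ h1 g1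
      have p2 := prod _ _ _ _ h2 g2
      have p3 : |(dX (dX F) q + dY (dY F) q) * cut θ R F q| ≤ |(dX (dX F) q + dY (dY F) q) * F q| := by
        rw [abs_mul, abs_mul]; gcongr
      refine (abs_add_le _ _).trans ?_
      refine (add_le_add (abs_add_le _ _) le_rfl).trans ?_
      linarith
    · exact (((hE.gradX.const_mul _).add (hE.gradY.const_mul _)).add
        (hE.integrableOn_tail_sq.const_mul _)).add hl.abs
    · refine Filter.Eventually.of_forall fun q => tendsto_const_nhds.congr' ?_
      filter_upwards [hb.eventually_cut hF q] with R h
      simp only [h]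
      ring
  have lim := tendsto_nhds_unique (t2.congr' key) (t1.neg.add_const S)
  have hadd : IntegrableOn (fun q => dX F q ^ 2 + dY F q ^ 2) A := hE.gradX.add hE.gradY
  rw [integral_add hadd hl, integral_add hE.gradX hE.gradY] at lim
  have e1 : ∫ q in A, -(dX (dX F) q + dY (dY F) q) * F q
      = -∫ q in A, (dX (dX F) q + dY (dY F) q) * F q := by
    rw [← integral_neg]; simp only [neg_mul]
  have e2 : ∫ x, (-dY F (x, 0) - ν * F (x, 0)) * F (x, 0)
      = -(∫ x, dY F (x, 0) * F (x, 0)) - ν * ∫ x, F (x, 0) ^ 2 := by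
    have hsn : Integrable fun x => -(dY F (x, 0) * F (x, 0)) := hs.neg
    rw [← integral_const_mul, ← integral_neg, ← integral_sub hsn (hE.trace.const_mul ν)]
    congr 1; funext x; ring
  rw [e1, e2]
  linarith

/-- The energy estimate for a real field. -/
theorem EnergyField.gradient_estimate (hE : EnergyField ν L h H A F) (hν : 0 < ν) {S : ℝ}
    (hg : Integrable fun x => (dY F (x, 0) + ν * F (x, 0)) * F (x, 0))
    (hgreen : ∀ φ : ℝ × ℝ → ℝ, ContDiff ℝ ∞ φ → HasCompactSupport φ →
      (∀ x y, |x| ≤ boxRadius L H → |y| ≤ boxRadius L H → φ (x, y) = F (x, y)) →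
      ∫ q in A, (dX F q * dX φ q + dY F q * dY φ q + (dX (dX F) q + dY (dY F) q) * φ q)
        = -(∫ x, dY F (x, 0) * φ (x, 0)) + S) :
    (∫ q in A, dX F q ^ 2) + (∫ q in A, dY F q ^ 2) ≤
      4 * ((∫ q in A, -(dX (dX F) q + dY (dY F) q) * F q) + S
        + (∫ x, (-dY F (x, 0) - ν * F (x, 0)) * F (x, 0)))
      + 18 * ((∫ q in A, (q.1 ^ 2 + q.2 ^ 2) * (dX (dX F) q + dY (dY F) q) ^ 2)
        + ν * ∫ x, (x * (-dY F (x, 0) - ν * F (x, 0))) ^ 2)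
      + (72 * (ν * L ^ 2 / h) * (1 + ν * h) ^ 3 - 3) * ∫ q in A, dX F q ^ 2 := by
  have e := hE.energy_identity hg hgreen
  have t := hE.trace_inequality hν
  have d : ∀ C, ∫ q in A, boundDensity C F q = 3 * (∫ q in A, dY F q ^ 2)
      + 18 * (∫ q in A, (q.1 ^ 2 + q.2 ^ 2) * (dX (dX F) q + dY (dY F) q) ^ 2)
      + C * ∫ q in A, dX F q ^ 2 := fun C => by
    unfold boundDensity
    have hadd : IntegrableOn (fun q => 3 * dY F q ^ 2
        + 18 * ((q.1 ^ 2 + q.2 ^ 2) * (dX (dX F) q + dY (dY F) q) ^ 2)) A :=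
      (hE.gradY.const_mul 3).add (hE.laplacian.const_mul 18)
    rw [integral_add hadd (hE.gradX.const_mul C),
      integral_add (hE.gradY.const_mul 3) (hE.laplacian.const_mul 18), integral_const_mul,
      integral_const_mul, integral_const_mul]
  rw [d] at t
  have s : ∀ x, (x * (-dY F (x, 0) - ν * F (x, 0))) ^ 2 = (x * (dY F (x, 0) + ν * F (x, 0))) ^ 2 :=
    fun x => by ring
  simp only [s]
  -- Four times the energy identity, the trace inequality for `4ν‖F‖²_Γ`, and subtraction of
  -- `3‖∇F‖²`; the `3‖F_y‖²` cancels and `3‖F_x‖²` is taken from the constant.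
  linarith

end

/-! ### Integration by parts under a graph -/

section

variable {Y : ℝ × ℝ → ℝ}

theorem hasDerivAt_fst_of_contDiff (hY : ContDiff ℝ 1 Y) (s t : ℝ) :
    HasDerivAt (fun s => Y (s, t)) (fderiv ℝ Y (s, t) (1, 0)) s :=
  (hY.differentiable (by simp) (s, t)).hasFDerivAt.comp_hasDerivAt s
    ((hasDerivAt_id s).prodMk (hasDerivAt_const s t))

theorem hasDerivAt_snd_of_contDiff (hY : ContDiff ℝ 1 Y) (s t : ℝ) :
    HasDerivAt (fun t => Y (s, t)) (fderiv ℝ Y (s, t) (0, 1)) t :=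
  (hY.differentiable (by simp) (s, t)).hasFDerivAt.comp_hasDerivAt t
    ((hasDerivAt_const t s).prodMk (hasDerivAt_id t))

theorem integrable_fderiv_apply (hY : ContDiff ℝ 1 Y) (hc : HasCompactSupport Y) (v : ℝ × ℝ) :
    Integrable fun q => fderiv ℝ Y q v := by
  refine Continuous.integrable_of_hasCompactSupport ?_ ?_
  · exact (hY.continuous_fderiv (by simp)).clm_apply continuous_const
  · exact hc.fderiv_apply (𝕜 := ℝ) v

theorem hasCompactSupport_slice_snd (hc : HasCompactSupport Y) (s : ℝ) :
    HasCompactSupport fun t => Y (s, t) := by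
  refine HasCompactSupport.of_support_subset_isCompact (hc.isCompact.image continuous_snd)
    fun t ht => ⟨(s, t), subset_tsupport _ ht, rfl⟩

theorem hasCompactSupport_slice_fst (hc : HasCompactSupport Y) (t : ℝ) :
    HasCompactSupport fun s => Y (s, t) := by
  refine HasCompactSupport.of_support_subset_isCompact (hc.isCompact.image continuous_fst)
    fun s hs => ⟨(s, t), subset_tsupport _ hs, rfl⟩

theorem integral_Iic_fderiv_snd (hY : ContDiff ℝ 1 Y) (hc : HasCompactSupport Y) (s b : ℝ) :
    ∫ t in Iic b, fderiv ℝ Y (s, t) (0, 1) = Y (s, b) := by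
  have h1 : ContDiff ℝ 1 fun t => Y (s, t) := by fun_prop
  have := (hasCompactSupport_slice_snd hc s).integral_Iic_deriv_eq h1 b
  simpa only [(hasDerivAt_snd_of_contDiff hY s _).deriv] using this

theorem integral_fderiv_fst (hY : ContDiff ℝ 1 Y) (hc : HasCompactSupport Y) (t : ℝ) :
    ∫ s, fderiv ℝ Y (s, t) (1, 0) = 0 := by
  have h1 : ContDiff ℝ 1 fun s => Y (s, t) := by fun_prop
  have := integral_eq_zero_of_hasDerivAt_of_integrable
    (fun s => hasDerivAt_fst_of_contDiff hY s t) ?_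
    (h1.continuous.integrable_of_hasCompactSupport (hasCompactSupport_slice_fst hc t))
  · exact this
  · refine Continuous.integrable_of_hasCompactSupport ?_ ?_
    · exact ((hY.continuous_fderiv (by simp)).comp (by fun_prop)).clm_apply continuous_const
    · exact hasCompactSupport_slice_fst (hc.fderiv_apply (𝕜 := ℝ) (1, 0)) t

theorem setIntegral_subgraph {γ : ℝ → ℝ} (hγ : Continuous γ) {f : ℝ × ℝ → ℝ} (hf : Integrable f) :
    ∫ q in {q : ℝ × ℝ | q.2 < γ q.1}, f q = ∫ s, ∫ t in Iic (γ s), f (s, t) := by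
  have hm : MeasurableSet {q : ℝ × ℝ | q.2 < γ q.1} :=
    measurableSet_lt measurable_snd (hγ.measurable.comp measurable_fst)
  rw [← integral_indicator hm, Measure.volume_eq_prod,
    integral_prod _ (by rw [← Measure.volume_eq_prod]; exact hf.indicator hm)]
  congr 1
  funext s
  rw [integral_Iic_eq_integral_Iio, ← integral_indicator measurableSet_Iio]
  rfl

theorem setIntegral_subgraph_fderiv_snd (hY : ContDiff ℝ 1 Y) (hc : HasCompactSupport Y)
    {γ : ℝ → ℝ} (hγ : Continuous γ) :
    ∫ q in {q : ℝ × ℝ | q.2 < γ q.1}, fderiv ℝ Y q (0, 1) = ∫ s, Y (s, γ s) := by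
  rw [setIntegral_subgraph hγ (integrable_fderiv_apply hY hc _)]
  simp only [integral_Iic_fderiv_snd hY hc]

/-- The shear `(s, u) ↦ (s, γ(s) + u)` straightens the graph. In the new variables `∂₁Y = ∂_sZ -
γ'∂_uZ`; the first term integrates to zero along horizontal lines and the second gives the value on
the graph. -/
theorem setIntegral_subgraph_fderiv_fst (hY : ContDiff ℝ 1 Y) (hc : HasCompactSupport Y)
    {γ : ℝ → ℝ} (hγ : ContDiff ℝ 1 γ) :
    ∫ q in {q : ℝ × ℝ | q.2 < γ q.1}, fderiv ℝ Y q (1, 0) = -∫ s, Y (s, γ s) * deriv γ s := by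
  have hγc := hγ.continuous
  have hγ' : Continuous (deriv γ) := hγ.continuous_deriv (by simp)
  let e : ℝ × ℝ ≃ₜ ℝ × ℝ :=
    { toFun := fun q => (q.1, γ q.1 + q.2)
      invFun := fun q => (q.1, q.2 - γ q.1)
      left_inv := fun q => by simp
      right_inv := fun q => by simp
      continuous_toFun := by fun_prop
      continuous_invFun := by fun_prop }
  set Z : ℝ × ℝ → ℝ := fun q => Y (q.1, γ q.1 + q.2) with hZ
  have hZ1 : ContDiff ℝ 1 Z := by fun_prop
  have hZc : HasCompactSupport Z := hc.comp_homeomorph e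
  have key : ∀ s u, fderiv ℝ Y (s, γ s + u) (1, 0)
      = fderiv ℝ Z (s, u) (1, 0) - deriv γ s * fderiv ℝ Z (s, u) (0, 1) := by
    intro s u
    have h1 := hasDerivAt_fst_of_contDiff hZ1 s u
    have h2 := hasDerivAt_snd_of_contDiff hZ1 s u
    have hYd := (hY.differentiable (by simp) (s, γ s + u)).hasFDerivAt
    have hγd := (hγ.differentiable (by simp) s).hasDerivAt
    have h1' := hYd.comp_hasDerivAt s ((hasDerivAt_id s).prodMk (hγd.add_const u))
    have h2' := hYd.comp_hasDerivAt u ((hasDerivAt_const u s).prodMk ((hasDerivAt_id u).const_add (γ s)))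
    rw [h1.unique h1', h2.unique h2']
    have : ((1, deriv γ s) : ℝ × ℝ) = (1, 0) + deriv γ s • (0, 1) := by simp
    rw [this, map_add, map_smul, smul_eq_mul]
    ring
  have hI : Integrable fun q : ℝ × ℝ => fderiv ℝ Z q (1, 0) := integrable_fderiv_apply hZ1 hZc _
  have hm : MeasurableSet {q : ℝ × ℝ | q.2 < 0} := measurableSet_lt measurable_snd measurable_const
  rw [setIntegral_subgraph hγc (integrable_fderiv_apply hY hc _)]
  have shift : ∀ s, ∫ t in Iic (γ s), fderiv ℝ Y (s, t) (1, 0)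
      = (∫ u in Iic 0, fderiv ℝ Z (s, u) (1, 0)) - Y (s, γ s) * deriv γ s := by
    intro s
    have e1 : ∫ t in Iic (γ s), fderiv ℝ Y (s, t) (1, 0)
        = ∫ u in Iic 0, fderiv ℝ Y (s, γ s + u) (1, 0) := by
      have := (measurePreserving_add_left volume (γ s)).setIntegral_preimage_emb
        (measurableEmbedding_addLeft (γ s)) (fun t => fderiv ℝ Y (s, t) (1, 0)) (Iic (γ s))
      rw [← this]
      congr 2
      ext u
      simp
    have hs1 : Integrable fun u => fderiv ℝ Z (s, u) (1, 0) := by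
      refine Continuous.integrable_of_hasCompactSupport ?_ ?_
      · exact ((hZ1.continuous_fderiv (by simp)).comp (by fun_prop)).clm_apply continuous_const
      · exact hasCompactSupport_slice_snd (hZc.fderiv_apply (𝕜 := ℝ) (1, 0)) s
    have hs2 : Integrable fun u => fderiv ℝ Z (s, u) (0, 1) := by
      refine Continuous.integrable_of_hasCompactSupport ?_ ?_
      · exact ((hZ1.continuous_fderiv (by simp)).comp (by fun_prop)).clm_apply continuous_const
      · exact hasCompactSupport_slice_snd (hZc.fderiv_apply (𝕜 := ℝ) (0, 1)) s
    rw [e1]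
    simp only [key]
    rw [integral_sub hs1.integrableOn (hs2.const_mul _).integrableOn, integral_const_mul,
      integral_Iic_fderiv_snd hZ1 hZc]
    simp [hZ, mul_comm]
  simp only [shift]
  have hI0 : Integrable (fun q : ℝ × ℝ => fderiv ℝ Z q (1, 0))
      ((volume : Measure ℝ).prod (volume.restrict (Iic 0))) := by
    have := hI.integrableOn (s := univ ×ˢ Iic 0)
    rwa [IntegrableOn, Measure.volume_eq_prod, ← Measure.prod_restrict, Measure.restrict_univ]
      at this
  have hz : ∫ s, ∫ u in Iic 0, fderiv ℝ Z (s, u) (1, 0) = 0 := by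
    rw [integral_integral_swap hI0]
    simp only [integral_fderiv_fst hZ1 hZc, integral_zero]
  rw [integral_sub hI0.integral_prod_left, hz, zero_sub]
  have h0 : HasCompactSupport fun s => Y (s, γ s) := by
    simpa [hZ] using hasCompactSupport_slice_fst hZc 0
  exact (Continuous.integrable_of_hasCompactSupport
    ((hY.continuous.comp (by fun_prop)).mul hγ') h0.mul_right)

theorem setIntegral_upper {f : ℝ × ℝ → ℝ} (hf : Integrable f) :
    ∫ q in {q : ℝ × ℝ | 0 < q.2}, f q
      = (∫ q, f q) - ∫ q in {q : ℝ × ℝ | q.2 < 0}, f q := by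
  have hm : MeasurableSet {q : ℝ × ℝ | 0 < q.2} := measurableSet_lt measurable_const measurable_snd
  have h0 : volume {q : ℝ × ℝ | q.2 = 0} = 0 := by
    have : {q : ℝ × ℝ | q.2 = 0} = univ ×ˢ {0} := by ext; simp
    rw [this, Measure.volume_eq_prod, Measure.prod_prod]
    simp
  have e1 : ∫ q in {q : ℝ × ℝ | q.2 < 0}, f q = ∫ q in {q : ℝ × ℝ | 0 < q.2}ᶜ, f q := by
    refine setIntegral_congr_set ?_
    rw [ae_eq_set]
    constructor
    · refine measure_mono_null (fun q hq => ?_) (measure_empty (μ := volume))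
      exact absurd hq.1 (by simpa using not_lt.1 fun h => hq.2 (by simpa using h.le))
    · refine measure_mono_null (fun q hq => ?_) h0
      have h1 : ¬ 0 < q.2 := hq.1
      have h2 : ¬ q.2 < 0 := hq.2
      exact le_antisymm (not_lt.1 h1) (not_lt.1 h2)
  have e2 := integral_add_compl hm hf
  rw [e1, ← e2, add_sub_cancel_right]

theorem integral_fderiv_fst_prod (hY : ContDiff ℝ 1 Y) (hc : HasCompactSupport Y) :
    ∫ q, fderiv ℝ Y q (1, 0) = 0 := by
  have hI := integrable_fderiv_apply hY hc (1, 0)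
  rw [Measure.volume_eq_prod] at hI ⊢
  rw [integral_prod_symm _ hI]
  simp [integral_fderiv_fst hY hc]

theorem integral_fderiv_snd_prod (hY : ContDiff ℝ 1 Y) (hc : HasCompactSupport Y) :
    ∫ q, fderiv ℝ Y q (0, 1) = 0 := by
  have hI := integrable_fderiv_apply hY hc (0, 1)
  rw [Measure.volume_eq_prod] at hI ⊢
  rw [integral_prod _ hI]
  have : ∀ s, ∫ t, fderiv ℝ Y (s, t) (0, 1) = 0 := fun s => by
    have h1 : ContDiff ℝ 1 fun t => Y (s, t) := by fun_prop
    refine integral_eq_zero_of_hasDerivAt_of_integrable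
      (fun t => hasDerivAt_snd_of_contDiff hY s t) ?_
      (h1.continuous.integrable_of_hasCompactSupport (hasCompactSupport_slice_snd hc s))
    refine Continuous.integrable_of_hasCompactSupport ?_ ?_
    · exact ((hY.continuous_fderiv (by simp)).comp (by fun_prop)).clm_apply continuous_const
    · exact hasCompactSupport_slice_snd (hc.fderiv_apply (𝕜 := ℝ) (0, 1)) s
  simp [this]

theorem setIntegral_upper_fderiv_snd (hY : ContDiff ℝ 1 Y) (hc : HasCompactSupport Y) :
    ∫ q in {q : ℝ × ℝ | 0 < q.2}, fderiv ℝ Y q (0, 1) = -∫ s, Y (s, 0) := by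
  rw [setIntegral_upper (integrable_fderiv_apply hY hc _), integral_fderiv_snd_prod hY hc,
    setIntegral_subgraph_fderiv_snd hY hc (γ := fun _ => 0) continuous_const, zero_sub]

theorem setIntegral_upper_fderiv_fst (hY : ContDiff ℝ 1 Y) (hc : HasCompactSupport Y) :
    ∫ q in {q : ℝ × ℝ | 0 < q.2}, fderiv ℝ Y q (1, 0) = 0 := by
  rw [setIntegral_upper (integrable_fderiv_apply hY hc _), integral_fderiv_fst_prod hY hc,
    setIntegral_subgraph_fderiv_fst hY hc (γ := fun _ => 0) contDiff_const]
  simp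

end

/-! ### Arc length of a graph -/

/-- A measure on the line whose mass on intervals is pinched by the extrema of a continuous
positive function has that function as density. -/
theorem eq_withDensity_of_mass_bounds {m : Measure ℝ} {σ : ℝ → ℝ} (hσ : Continuous σ)
    (hpos : ∀ s, 0 < σ s)
    (lower : ∀ a b k, a ≤ b → 0 < k → (∀ s ∈ Icc a b, k ≤ σ s) →
      ENNReal.ofReal (k * (b - a)) ≤ m (Ioc a b))
    (upper : ∀ a b k, a ≤ b → 0 < k → (∀ s ∈ Icc a b, σ s ≤ k) →
      m (Ioc a b) ≤ ENNReal.ofReal (k * (b - a))) :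
    m = volume.withDensity fun s => ENNReal.ofReal (σ s) := by
  have bound : ∀ a b, a ≤ b → ∃ K, 0 < K ∧ ∀ s ∈ Icc a b, σ s ≤ K := by
    intro a b hab
    obtain ⟨z, hz, hmax⟩ := isCompact_Icc.exists_isMaxOn (nonempty_Icc.2 hab) hσ.continuousOn
    exact ⟨σ z, hpos z, fun s hs => hmax hs⟩
  have fin : ∀ a b, m (Ioc a b) ≠ ⊤ := by
    intro a b
    rcases le_total a b with hab | hab
    · obtain ⟨K, hK, h⟩ := bound a b hab
      exact ((upper a b K hab hK h).trans_lt ENNReal.ofReal_lt_top).ne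
    · simp [Ioc_eq_empty_of_le hab]
  have : IsLocallyFiniteMeasure m := by
    refine ⟨fun x => ⟨Ioc (x - 1) (x + 1), Ioc_mem_nhds (by linarith) (by linarith), ?_⟩⟩
    exact (fin _ _).lt_top
  refine Measure.ext_of_Ioc _ _ fun x y hxy => ?_
  have lowerR : ∀ a b k, a ≤ b → 0 < k → (∀ s ∈ Icc a b, k ≤ σ s) →
      k * (b - a) ≤ m.real (Ioc a b) := fun a b k hab hk h =>
    (ENNReal.ofReal_le_iff_le_toReal (fin a b)).1 (lower a b k hab hk h)
  have upperR : ∀ a b k, a ≤ b → 0 < k → (∀ s ∈ Icc a b, σ s ≤ k) →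
      m.real (Ioc a b) ≤ k * (b - a) := fun a b k hab hk h =>
    ENNReal.toReal_le_of_le_ofReal (mul_nonneg hk.le (sub_nonneg.2 hab)) (upper a b k hab hk h)
  set F : ℝ → ℝ := fun t => m.real (Ioc x t) with hF
  have add : ∀ a b, x ≤ a → a ≤ b → F b = F a + m.real (Ioc a b) := by
    intro a b hxa hab
    simp only [hF]
    rw [← measureReal_union (Ioc_disjoint_Ioc_of_le le_rfl) measurableSet_Ioc (fin _ _) (fin _ _),
      Ioc_union_Ioc_eq_Ioc hxa hab]
  have hcont : ContinuousOn F (Icc x y) := by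
    obtain ⟨K, hK, h⟩ := bound x y hxy.le
    have hlip : LipschitzOnWith ⟨K, hK.le⟩ F (Icc x y) := by
      refine LipschitzOnWith.of_le_add_mul _ fun b hb a ha => ?_
      rw [Real.dist_eq]
      change F b ≤ F a + K * |b - a|
      rcases le_total a b with hab | hab
      · rw [add a b ha.1 hab, abs_of_nonneg (sub_nonneg.2 hab)]
        have := upperR a b K hab hK fun s hs => h s ⟨ha.1.trans hs.1, hs.2.trans hb.2⟩
        linarith
      · have h1 := add b a hb.1 hab
        have h2 : 0 ≤ m.real (Ioc b a) := measureReal_nonneg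
        have h3 : 0 ≤ K * |b - a| := by positivity
        linarith
    exact hlip.continuousOn
  -- The pinching on `[t, b]` makes `σ` the right derivative of the distribution function `F`. The
  -- choice `c' ≤ σ(t)/2` keeps the lower constant `σ(t) - c'` positive.
  have hder : ∀ t ∈ Ioo x y, HasDerivWithinAt F (σ t) (Ioi t) t := by
    intro t ht
    rw [hasDerivWithinAt_iff_isLittleO, Asymptotics.isLittleO_iff]
    intro c hc
    set c' := min c (σ t / 2)
    have hc' : 0 < c' := lt_min hc (half_pos (hpos t))
    obtain ⟨δ, hδ, hclose⟩ := Metric.continuousAt_iff.1 (hσ.continuousAt (x := t)) c' hc'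
    filter_upwards [Ioo_mem_nhdsGT (show t < t + δ by linarith)] with b hb
    have hs : ∀ s ∈ Icc t b, σ t - c' ≤ σ s ∧ σ s ≤ σ t + c' := by
      intro s hs
      have := hclose (x := s) (by
        rw [Real.dist_eq, abs_lt]
        constructor <;> linarith [hs.1, hs.2, hb.2])
      rw [Real.dist_eq, abs_lt] at this
      constructor <;> linarith [this.1, this.2]
    have hle : c' ≤ c := min_le_left _ _
    have hle2 : c' ≤ σ t / 2 := min_le_right _ _
    have l1 := lowerR t b (σ t - c') hb.1.le (by linarith [hpos t]) fun s hs' => (hs s hs').1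
    have l2 := upperR t b (σ t + c') hb.1.le (by linarith [hpos t]) fun s hs' => (hs s hs').2
    have h0 : 0 < b - t := sub_pos.2 hb.1
    rw [add t b ht.1.le hb.1.le, Real.norm_eq_abs, Real.norm_eq_abs, abs_of_pos h0, smul_eq_mul,
      abs_le]
    constructor <;> nlinarith
  have key := intervalIntegral.integral_eq_sub_of_hasDeriv_right_of_le hxy.le hcont hder
    (hσ.intervalIntegrable x y)
  have hFx : F x = 0 := by simp [hF]
  rw [hFx, sub_zero, intervalIntegral.integral_of_le hxy.le] at key
  rw [withDensity_apply _ measurableSet_Ioc,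
    ← ofReal_integral_eq_lintegral_ofReal
      ((hσ.integrableOn_Icc (a := x) (b := y)).mono_set Ioc_subset_Icc_self)
      (Filter.Eventually.of_forall fun s => (hpos s).le), key]
  exact (ENNReal.ofReal_toReal (fin x y)).symm

/-- Arc length on a graph, as a measure on the parameter line. -/
theorem comap_graph_hausdorff {γ : ℝ → ℝ} (hγ : ContDiff ℝ 1 γ) {X : Type*} [MetricSpace X]
    [MeasurableSpace X] [BorelSpace X] {Γ : ℝ → X}
    (hΓ : ∀ s t, dist (Γ s) (Γ t) ^ 2 = (s - t) ^ 2 + (γ s - γ t) ^ 2) :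
    MeasurableEmbedding Γ ∧ (μH[1] : Measure X).comap Γ
      = volume.withDensity fun s => ENNReal.ofReal (√(1 + deriv γ s ^ 2)) := by
  have hγ' : Continuous (deriv γ) := hγ.continuous_deriv (by simp)
  have hdist : ∀ s t, dist (Γ s) (Γ t) = √((s - t) ^ 2 + (γ s - γ t) ^ 2) := fun s t => by
    rw [← hΓ, Real.sqrt_sq dist_nonneg]
  -- By the mean value theorem the ratio of chord to parameter length is a value of `√(1 + γ'²)`. So
  -- `Γ` and its inverse are Lipschitz with constants given by bounds of this function, and
  -- one-dimensional Hausdorff measure on the line is Lebesgue measure.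
  have hmv : ∀ s t, ∃ z ∈ uIcc s t, dist (Γ s) (Γ t) = √(1 + deriv γ z ^ 2) * |s - t| := by
    intro s t
    have : ∃ z ∈ uIcc s t, γ s - γ t = deriv γ z * (s - t) := by
      rcases lt_trichotomy s t with h | h | h
      · obtain ⟨z, hz, e⟩ := exists_deriv_eq_slope γ h hγ.continuous.continuousOn
          (hγ.differentiable (by simp)).differentiableOn
        refine ⟨z, by rw [uIcc_of_le h.le]; exact Ioo_subset_Icc_self hz, ?_⟩
        rw [e]
        have : t - s ≠ 0 := (sub_pos.2 h).ne'
        field_simp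
        ring
      · exact ⟨s, left_mem_uIcc, by simp [h]⟩
      · obtain ⟨z, hz, e⟩ := exists_deriv_eq_slope γ h hγ.continuous.continuousOn
          (hγ.differentiable (by simp)).differentiableOn
        refine ⟨z, by rw [uIcc_of_ge h.le]; exact Ioo_subset_Icc_self hz, ?_⟩
        rw [e]
        have : s - t ≠ 0 := (sub_pos.2 h).ne'
        field_simp
    obtain ⟨z, hz, e⟩ := this
    refine ⟨z, hz, ?_⟩
    rw [hdist, e, ← Real.sqrt_sq_eq_abs, ← Real.sqrt_mul (by positivity)]
    congr 1
    ring
  have hcont : Continuous Γ := by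
    rw [Metric.continuous_iff']
    intro a ε hε
    have : Filter.Tendsto (fun s => √((s - a) ^ 2 + (γ s - γ a) ^ 2)) (nhds a) (nhds 0) := by
      have h : Continuous fun s => √((s - a) ^ 2 + (γ s - γ a) ^ 2) := by
        have := hγ.continuous
        fun_prop
      have := h.tendsto a
      simpa using this
    filter_upwards [this.eventually_lt_const hε] with s hs
    rwa [hdist]
  have hanti : AntilipschitzWith 1 Γ := by
    refine AntilipschitzWith.of_le_mul_dist fun s t => ?_
    rw [hdist, Real.dist_eq, NNReal.coe_one, one_mul]
    exact Real.abs_le_sqrt (by nlinarith [sq_nonneg (γ s - γ t)])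
  have hinj : Function.Injective Γ := hanti.injective
  have hemb : MeasurableEmbedding Γ := hcont.measurableEmbedding hinj
  refine ⟨hemb, eq_withDensity_of_mass_bounds (by fun_prop) (fun s => by positivity) ?_ ?_⟩
  · intro a b k hab hk h
    rw [hemb.comap_apply]
    have hlip : LipschitzOnWith ⟨k⁻¹, (inv_pos.2 hk).le⟩ (Function.invFun Γ) (Γ '' Ioc a b) := by
      refine LipschitzOnWith.of_dist_le_mul ?_
      rintro _ ⟨s, hs, rfl⟩ _ ⟨t, ht, rfl⟩
      rw [Function.leftInverse_invFun hinj, Function.leftInverse_invFun hinj]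
      obtain ⟨z, hz, e⟩ := hmv s t
      have hz' : z ∈ Icc a b :=
        uIcc_subset_Icc ⟨hs.1.le, hs.2⟩ ⟨ht.1.le, ht.2⟩ hz
      change dist s t ≤ k⁻¹ * dist (Γ s) (Γ t)
      rw [le_inv_mul_iff₀ hk, e, Real.dist_eq]
      exact mul_le_mul_of_nonneg_right (h z hz') (abs_nonneg _)
    have := hlip.hausdorffMeasure_image_le (d := 1) zero_le_one
    rw [image_image] at this
    simp only [Function.leftInverse_invFun hinj _, image_id', ENNReal.rpow_one,
      hausdorffMeasure_real, Real.volume_Ioc] at this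
    rw [ENNReal.ofReal_mul hk.le]
    calc ENNReal.ofReal k * ENNReal.ofReal (b - a)
        ≤ ENNReal.ofReal k * (ENNReal.ofReal k⁻¹ * μH[1] (Γ '' Ioc a b)) := by
          gcongr
          rwa [ENNReal.ofReal_eq_coe_nnreal (inv_pos.2 hk).le]
      _ = μH[1] (Γ '' Ioc a b) := by
          rw [← mul_assoc, ← ENNReal.ofReal_mul hk.le, mul_inv_cancel₀ hk.ne']
          simp
  · intro a b k hab hk h
    rw [hemb.comap_apply]
    have hlip : LipschitzOnWith ⟨k, hk.le⟩ Γ (Ioc a b) := by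
      refine LipschitzOnWith.of_dist_le_mul fun s hs t ht => ?_
      obtain ⟨z, hz, e⟩ := hmv s t
      have hz' : z ∈ Icc a b :=
        uIcc_subset_Icc ⟨hs.1.le, hs.2⟩ ⟨ht.1.le, ht.2⟩ hz
      rw [e, Real.dist_eq]
      exact mul_le_mul_of_nonneg_right (h z hz') (abs_nonneg _)
    have := hlip.hausdorffMeasure_image_le (d := 1) zero_le_one
    simp only [ENNReal.rpow_one, hausdorffMeasure_real, Real.volume_Ioc] at this
    rw [ENNReal.ofReal_mul hk.le]
    rwa [ENNReal.ofReal_eq_coe_nnreal hk.le]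

/-- Integration over a graph with respect to arc length. -/
theorem setIntegral_graph_hausdorff {γ : ℝ → ℝ} (hγ : ContDiff ℝ 1 γ) {X : Type*} [MetricSpace X]
    [MeasurableSpace X] [BorelSpace X] {Γ : ℝ → X}
    (hΓ : ∀ s t, dist (Γ s) (Γ t) ^ 2 = (s - t) ^ 2 + (γ s - γ t) ^ 2) (G : X → ℝ) :
    ∫ p in range Γ, G p ∂μH[1] = ∫ s, √(1 + deriv γ s ^ 2) * G (Γ s) := by
  have hγ' : Continuous (deriv γ) := hγ.continuous_deriv (by simp)
  obtain ⟨hemb, hm⟩ := comap_graph_hausdorff hγ hΓ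
  have e1 : (μH[1] : Measure X).restrict (range Γ) = ((μH[1] : Measure X).comap Γ).map Γ :=
    (hemb.map_comap _).symm
  rw [e1, hemb.integral_map, hm, integral_withDensity_eq_integral_toReal_smul (by fun_prop)
    (Filter.Eventually.of_forall fun _ => ENNReal.ofReal_lt_top)]
  congr 1
  funext s
  rw [ENNReal.toReal_ofReal (by positivity), smul_eq_mul]

theorem hausdorffMeasure_graph_lt_top {γ : ℝ → ℝ} (hγ : ContDiff ℝ 1 γ) {X : Type*} [MetricSpace X]
    [MeasurableSpace X] [BorelSpace X] {Γ : ℝ → X}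
    (hΓ : ∀ s t, dist (Γ s) (Γ t) ^ 2 = (s - t) ^ 2 + (γ s - γ t) ^ 2) (a b : ℝ) :
    μH[1] (Γ '' Icc a b) < ⊤ := by
  have hγ' : Continuous (deriv γ) := hγ.continuous_deriv (by simp)
  obtain ⟨hemb, hm⟩ := comap_graph_hausdorff hγ hΓ
  rw [← hemb.comap_apply, hm, withDensity_apply _ measurableSet_Icc]
  have h : Continuous fun s => √(1 + deriv γ s ^ 2) := by fun_prop
  exact (h.integrableOn_Icc (a := a) (b := b)).lintegral_lt_top

/-! ### Level sets as graphs -/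

/-- The implicit function theorem gives only a germ; multiplication by a bump makes it a global `C¹`
function, so that graphs over the whole line can be used. -/
theorem exists_contDiff_eventuallyEq {ψ : ℝ → ℝ} {a : ℝ} (hψ : ContDiffAt ℝ 1 ψ a) :
    ∃ γ : ℝ → ℝ, ContDiff ℝ 1 γ ∧ γ =ᶠ[nhds a] ψ := by
  obtain ⟨r, hr, hball⟩ := Metric.eventually_nhds_iff_ball.1 (hψ.eventually (by simp))
  let b : ContDiffBump a := ⟨r / 4, r / 2, by positivity, by linarith⟩
  refine ⟨fun s => b s * ψ s, contDiff_iff_contDiffAt.2 fun s => ?_, ?_⟩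
  · by_cases hs : s ∈ Metric.ball a r
    · exact b.contDiffAt.mul (hball s hs)
    · have : (fun s => b s * ψ s) =ᶠ[nhds s] fun _ => 0 := by
        have hnot : s ∉ tsupport b := by
          rw [b.tsupport_eq]
          intro h
          exact hs (Metric.closedBall_subset_ball (by change r / 2 < r; linarith) h)
        filter_upwards [(isClosed_tsupport _).isOpen_compl.mem_nhds hnot] with t ht
        rw [image_eq_zero_of_notMem_tsupport ht, zero_mul]
      exact contDiffAt_const.congr_of_eventuallyEq this
  · filter_upwards [b.eventuallyEq_one] with s hs
    rw [hs, Pi.one_apply, one_mul]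

/-- The graph comes from the implicit function theorem. The sign of `f` on either side of it follows
from strict monotonicity in the second variable, and the tangency relation from differentiating
`f(s, γ(s)) = 0`. -/
theorem exists_graph_chart {f : ℝ × ℝ → ℝ} (hf : ContDiff ℝ 1 f) (h0 : f 0 = 0)
    (hd : 0 < fderiv ℝ f 0 (0, 1)) :
    ∃ γ : ℝ → ℝ, ContDiff ℝ 1 γ ∧ ∀ᶠ v in nhds (0 : ℝ × ℝ), 0 < fderiv ℝ f v (0, 1) ∧
      (f v < 0 ↔ v.2 < γ v.1) ∧ (f v = 0 ↔ v.2 = γ v.1) ∧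
      (v.2 = γ v.1 → fderiv ℝ f v (1, 0) + deriv γ v.1 * fderiv ℝ f v (0, 1) = 0) := by
  have if₂ : (fderiv ℝ f 0 ∘L .inr ℝ ℝ ℝ).IsInvertible := by
    refine ⟨ContinuousLinearEquiv.unitsEquivAut ℝ (Units.mk0 _ hd.ne'), ?_⟩
    ext
    simp
  have cdf : ContDiffAt ℝ 1 f 0 := hf.contDiffAt
  obtain ⟨γ, hγ, hγψ⟩ := exists_contDiff_eventuallyEq
    (cdf.contDiffAt_implicitFunction one_ne_zero if₂)
  have hγ0 : γ 0 = 0 := by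
    have := cdf.implicitFunction_apply_self one_ne_zero if₂
    exact hγψ.self_of_nhds.trans this
  have hzero : ∀ᶠ s in nhds (0 : ℝ), f (s, γ s) = 0 := by
    have := cdf.eventually_apply_implicitFunction one_ne_zero if₂
    filter_upwards [this, hγψ] with s h1 h2
    rw [h2, h1, h0]
  have hpos : ∀ᶠ v in nhds (0 : ℝ × ℝ), 0 < fderiv ℝ f v (0, 1) :=
    (((hf.continuous_fderiv (by simp)).clm_apply continuous_const).tendsto 0).eventually_const_lt hd
  obtain ⟨r, hr, hball⟩ := Metric.eventually_nhds_iff_ball.1 hpos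
  have hmem : ∀ s t : ℝ, |s| < r → |t| < r → (s, t) ∈ Metric.ball (0 : ℝ × ℝ) r := by
    intro s t hs ht
    rw [mem_ball_zero_iff, Prod.norm_mk, max_lt_iff]
    exact ⟨hs, ht⟩
  have hmono : ∀ s, |s| < r → StrictMonoOn (fun t => f (s, t)) (Ioo (-r) r) := by
    intro s hs
    refine strictMonoOn_of_deriv_pos (convex_Ioo _ _) (by have := hf.continuous; fun_prop) ?_
    intro t ht
    rw [interior_Ioo] at ht
    rw [(hasDerivAt_snd_of_contDiff hf s t).deriv]
    exact hball _ (hmem s t hs (abs_lt.2 ht))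
  have hfst : Filter.Tendsto (Prod.fst : ℝ × ℝ → ℝ) (nhds 0) (nhds 0) := continuous_fst.tendsto 0
  have hγr : ∀ᶠ s in nhds (0 : ℝ), |γ s| < r := by
    have : Filter.Tendsto (fun s => |γ s|) (nhds 0) (nhds 0) := by
      have := hγ.continuous.abs.tendsto 0
      simpa [hγ0] using this
    exact this.eventually_lt_const hr
  refine ⟨γ, hγ, ?_⟩
  filter_upwards [hpos, hfst.eventually hγr, hfst.eventually hzero.eventually_nhds,
    Metric.ball_mem_nhds (0 : ℝ × ℝ) hr] with v h1 h2 h3 h4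
  obtain ⟨s, t⟩ := v
  rw [mem_ball_zero_iff, Prod.norm_mk, max_lt_iff, Real.norm_eq_abs, Real.norm_eq_abs] at h4
  have hz := h3.self_of_nhds
  have hm := hmono s h4.1
  have ht := abs_lt.1 h4.2
  have hg := abs_lt.1 h2
  refine ⟨h1, ?_, ?_, ?_⟩
  · rw [← hm.lt_iff_lt ht hg]
    simp only
    rw [hz]
  · rw [← hm.injOn.eq_iff ht hg]
    simp only
    rw [hz]
  · rintro e
    have e' : t = γ s := e
    subst e'
    have hγd := (hγ.differentiable (by simp) s).hasDerivAt
    have hd1 := (hf.differentiable (by simp) (s, γ s)).hasFDerivAt.comp_hasDerivAt s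
      ((hasDerivAt_id s).prodMk hγd)
    have hd2 : HasDerivAt (fun s => f (s, γ s)) 0 s :=
      (hasDerivAt_const s (0 : ℝ)).congr_of_eventuallyEq h3
    have := hd1.unique hd2
    have e1 : ((1, deriv γ s) : ℝ × ℝ) = (1, 0) + deriv γ s • (0, 1) := by simp
    rw [e1, map_add, map_smul, smul_eq_mul] at this
    exact this

/-! ### Orthonormal frames of the plane -/

/-- Cartesian coordinates with origin `p` along the orthonormal basis `b`. -/
noncomputable def frame (p : Plane) (b : OrthonormalBasis (Fin 2) ℝ Plane) : ℝ × ℝ ≃ₜ Plane :=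
  (((ContinuousLinearEquiv.finTwoArrow ℝ ℝ).symm.trans
    (EuclideanSpace.equiv (Fin 2) ℝ).symm).toHomeomorph.trans b.repr.symm.toHomeomorph).trans
    (Homeomorph.addLeft p)

variable {p : Plane} {b : OrthonormalBasis (Fin 2) ℝ Plane}

theorem frame_apply (q : ℝ × ℝ) : frame p b q = p + (q.1 • b 0 + q.2 • b 1) := by
  have : frame p b q = p + b.repr.symm (WithLp.toLp 2 ![q.1, q.2]) := rfl
  rw [this, ← b.sum_repr (b.repr.symm _)]
  simp

theorem measurePreserving_frame : MeasurePreserving (frame p b) := by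
  have h1 : MeasurePreserving (MeasurableEquiv.finTwoArrow (α := ℝ)).symm :=
    (volume_preserving_finTwoArrow ℝ).symm
  have h2 := PiLp.volume_preserving_toLp (Fin 2)
  have h3 := b.measurePreserving_repr_symm
  have h4 : MeasurePreserving (fun x : Plane => p + x) := measurePreserving_add_left volume p
  exact h4.comp (h3.comp (h2.comp h1))

theorem hasFDerivAt_frame (q : ℝ × ℝ) :
    HasFDerivAt (frame p b) ((ContinuousLinearMap.fst ℝ ℝ ℝ).smulRight (b 0)
      + (ContinuousLinearMap.snd ℝ ℝ ℝ).smulRight (b 1)) q := by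
  have : (frame p b : ℝ × ℝ → Plane) = fun q => p + (q.1 • b 0 + q.2 • b 1) :=
    funext frame_apply
  rw [this]
  exact ((((ContinuousLinearMap.fst ℝ ℝ ℝ).smulRight (b 0)
    + (ContinuousLinearMap.snd ℝ ℝ ℝ).smulRight (b 1)).hasFDerivAt).const_add p)

theorem contDiff_frame {n : WithTop ℕ∞} : ContDiff ℝ n (frame p b) := by
  have : (frame p b : ℝ × ℝ → Plane) = fun q => p + (q.1 • b 0 + q.2 • b 1) :=
    funext frame_apply
  rw [this]
  fun_prop

theorem fderiv_comp_frame {F : Type*} [NormedAddCommGroup F] [NormedSpace ℝ F] {w : Plane → F}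
    {q : ℝ × ℝ} (hw : DifferentiableAt ℝ w (frame p b q)) (v : ℝ × ℝ) :
    fderiv ℝ (fun q => w (frame p b q)) q v = fderiv ℝ w (frame p b q) (v.1 • b 0 + v.2 • b 1) := by
  have := hw.hasFDerivAt.comp q (hasFDerivAt_frame (p := p) (b := b) q)
  have e : (fun q => w (frame p b q)) = w ∘ frame p b := rfl
  rw [e, this.fderiv]
  simp

theorem dist_frame_sq (q q' : ℝ × ℝ) :
    dist (frame p b q) (frame p b q') ^ 2 = (q.1 - q'.1) ^ 2 + (q.2 - q'.2) ^ 2 := by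
  have h : frame p b q - frame p b q' = (q.1 - q'.1) • b 0 + (q.2 - q'.2) • b 1 := by
    rw [frame_apply, frame_apply]
    module
  rw [dist_eq_norm, h, ← b.repr.norm_map, EuclideanSpace.norm_sq_eq]
  simp [Fin.sum_univ_two, b.repr_self]

/-- The divergence of a plane vector field. -/
noncomputable def divergence (X : Plane → Plane) (x : Plane) : ℝ :=
  LinearMap.trace ℝ Plane (fderiv ℝ X x : Plane →ₗ[ℝ] Plane)

/-- The divergence is a trace, hence the same in every orthonormal frame. This lets each boundary
piece be treated in its own rotated coordinates. -/
theorem divergence_frame {X : Plane → Plane} (hX : ContDiff ℝ 1 X) (q : ℝ × ℝ) :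
    divergence X (frame p b q) = fderiv ℝ (fun q => ⟪b 0, X (frame p b q)⟫_ℝ) q (1, 0)
      + fderiv ℝ (fun q => ⟪b 1, X (frame p b q)⟫_ℝ) q (0, 1) := by
  have hd : DifferentiableAt ℝ X (frame p b q) := hX.differentiable (by simp) _
  have key : ∀ (w : Plane) (v : ℝ × ℝ), fderiv ℝ (fun q => ⟪w, X (frame p b q)⟫_ℝ) q v
      = ⟪w, fderiv ℝ X (frame p b q) (v.1 • b 0 + v.2 • b 1)⟫_ℝ := by
    intro w v
    have h1 := ((innerSL ℝ w).hasFDerivAt.comp _ hd.hasFDerivAt)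
    have h2 := fderiv_comp_frame (p := p) (b := b) (q := q) h1.differentiableAt v
    rw [h1.fderiv] at h2
    exact h2
  rw [key, key, divergence, LinearMap.trace_eq_sum_inner _ b, Fin.sum_univ_two]
  simp

theorem measurableEmbedding_frame : MeasurableEmbedding (frame p b) :=
  (frame p b).measurableEmbedding

theorem setIntegral_frame (f : Plane → ℝ) (s : Set Plane) :
    ∫ x in s, f x = ∫ q in frame p b ⁻¹' s, f (frame p b q) :=
  (measurePreserving_frame.setIntegral_preimage_emb measurableEmbedding_frame f s).symm

theorem contDiff_inner_frame {X : Plane → Plane} (hX : ContDiff ℝ 1 X) (w : Plane) :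
    ContDiff ℝ 1 fun q => ⟪w, X (frame p b q)⟫_ℝ :=
  contDiff_const.inner ℝ (hX.comp contDiff_frame)

theorem hasCompactSupport_inner_frame {X : Plane → Plane} (hc : HasCompactSupport X) (w : Plane) :
    HasCompactSupport fun q => ⟪w, X (frame p b q)⟫_ℝ :=
  (hc.comp_homeomorph (frame p b)).comp_left (g := fun x => ⟪w, x⟫_ℝ) (inner_zero_right _)

theorem integral_divergence_eq_zero {X : Plane → Plane} (hX : ContDiff ℝ 1 X)
    (hc : HasCompactSupport X) : ∫ x, divergence X x = 0 := by
  let b := EuclideanSpace.basisFun (Fin 2) ℝ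
  rw [← setIntegral_univ, setIntegral_frame (p := 0) (b := b), preimage_univ, setIntegral_univ]
  simp only [divergence_frame hX]
  have h0 := contDiff_inner_frame (p := 0) (b := b) hX (b 0)
  have h1 := contDiff_inner_frame (p := 0) (b := b) hX (b 1)
  have c0 := hasCompactSupport_inner_frame (p := 0) (b := b) hc (b 0)
  have c1 := hasCompactSupport_inner_frame (p := 0) (b := b) hc (b 1)
  have i0 := integrable_fderiv_apply h0 c0 (1, 0)
  have i1 := integrable_fderiv_apply h1 c1 (0, 1)
  rw [integral_add i0 i1, integral_fderiv_fst_prod h0 c0, integral_fderiv_snd_prod h1 c1, add_zero]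

/-! ### The divergence theorem in a body -/

variable {B : Set Plane}

theorem IsDefiningAt.eq_zero {p : Plane} {ρ : Plane → ℝ} (h : IsDefiningAt B p ρ)
    (hB : IsOpen B) (hp : p ∈ frontier B) : ρ p = 0 := by
  obtain ⟨hρ, -, hev⟩ := h
  rcases lt_trichotomy (ρ p) 0 with h | h | h
  · have : p ∈ B := hev.self_of_nhds.2 h
    rw [hB.frontier_eq] at hp
    exact absurd this hp.2
  · exact h
  · have h1 : ∀ᶠ x in nhds p, x ∉ B := by
      filter_upwards [hev, hρ.continuous.continuousAt.eventually_const_lt h] with x hx1 hx2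
      rw [hx1]
      exact hx2.le.not_gt
    have : p ∉ closure B := by
      rw [mem_closure_iff_frequently]
      exact fun h => h h1
    exact absurd (frontier_subset_closure hp) this

/-- Near a boundary point, in a suitable frame, a body is the region under a graph. -/
theorem exists_boundary_chart (hB : IsOpen B) {p : Plane} (hp : p ∈ frontier B) {ρ : Plane → ℝ}
    (hρ : IsDefiningAt B p ρ) :
    ∃ (b : OrthonormalBasis (Fin 2) ℝ Plane) (γ : ℝ → ℝ) (U : Set Plane), ContDiff ℝ 1 γ ∧
      IsOpen U ∧ p ∈ U ∧ ∀ q : ℝ × ℝ, frame p b q ∈ U → |q.1| < 1 ∧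
        (frame p b q ∈ B ↔ q.2 < γ q.1) ∧ (frame p b q ∈ frontier B ↔ q.2 = γ q.1) ∧
        (q.2 = γ q.1 → IsWaterNormal B (frame p b q)
          ((√(1 + deriv γ q.1 ^ 2))⁻¹ • (deriv γ q.1 • b 0 - b 1))) := by
  have hρs : ContDiff ℝ 1 ρ := hρ.1.of_le (by simp)
  have hdiff : Differentiable ℝ ρ := hρs.differentiable (by simp)
  set g := gradient ρ p with hg
  have hg0 : g ≠ 0 := hρ.2.1
  -- The second axis is taken along `∇ρ(p)`, so that `ρ` increases along it and the body lies below
  -- the graph.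
  obtain ⟨b, hb⟩ : ∃ b : OrthonormalBasis (Fin 2) ℝ Plane, b 1 = ‖g‖⁻¹ • g := by
    have hcard : Module.finrank ℝ Plane = Fintype.card (Fin 2) := by simp
    have hon : Orthonormal ℝ (({1} : Set (Fin 2)).domRestrict fun _ => ‖g‖⁻¹ • g) := by
      constructor
      · rintro ⟨i, hi⟩
        change ‖‖g‖⁻¹ • g‖ = 1
        rw [norm_smul, norm_inv, norm_norm, inv_mul_cancel₀ (norm_ne_zero_iff.2 hg0)]
      · rintro ⟨i, hi⟩ ⟨j, hj⟩ hij
        exact absurd (Subtype.ext (hi.trans hj.symm)) hij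
    obtain ⟨b, hb⟩ := hon.exists_orthonormalBasis_extension_of_card_eq hcard
    exact ⟨b, hb 1 rfl⟩
  set f : ℝ × ℝ → ℝ := fun q => ρ (frame p b q) with hf
  have hf1 : ContDiff ℝ 1 f := hρs.comp contDiff_frame
  have hp0 : frame p b 0 = p := by rw [frame_apply]; simp
  have hf0 : f 0 = 0 := by simp only [hf, hp0]; exact hρ.eq_zero hB hp
  have hfd : ∀ q v, fderiv ℝ f q v = ⟪gradient ρ (frame p b q), v.1 • b 0 + v.2 • b 1⟫_ℝ := by
    intro q v
    rw [hf, fderiv_comp_frame (hdiff _), gradient, InnerProductSpace.toDual_symm_apply]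
  have hfd0 : 0 < fderiv ℝ f 0 (0, 1) := by
    rw [hfd, hp0, ← hg, hb]
    simp only [zero_smul, one_smul, zero_add, inner_smul_right, real_inner_self_eq_norm_sq]
    have := norm_pos_iff.2 hg0
    positivity
  obtain ⟨γ, hγ, hev⟩ := exists_graph_chart hf1 hf0 hfd0
  have hdef : ∀ᶠ v in nhds (0 : ℝ × ℝ), ∀ᶠ x in nhds (frame p b v), (x ∈ B ↔ ρ x < 0) := by
    have := (frame p b).continuous.tendsto 0
    rw [hp0] at this
    exact this.eventually hρ.2.2.eventually_nhds
  have hsmall : ∀ᶠ v in nhds (0 : ℝ × ℝ), |v.1| < 1 := by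
    have : Filter.Tendsto (fun v : ℝ × ℝ => |v.1|) (nhds 0) (nhds |0|) :=
      (continuous_abs.comp continuous_fst).tendsto 0
    rw [abs_zero] at this
    exact this.eventually_lt_const one_pos
  obtain ⟨V, hV, hVo, h0V⟩ := eventually_nhds_iff.1 (hev.and (hdef.and hsmall))
  refine ⟨b, γ, frame p b '' V, hγ, (frame p b).isOpenMap _ hVo, ⟨0, h0V, hp0⟩, ?_⟩
  rintro q ⟨q', hq', e⟩
  obtain rfl := (frame p b).injective e
  obtain ⟨⟨hpos, hlt, heq, htan⟩, hdefq, hq1⟩ := hV q' hq'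
  have hgne : gradient ρ (frame p b q') ≠ 0 := by
    intro h0
    rw [hfd, h0, inner_zero_left] at hpos
    exact lt_irrefl _ hpos
  have hdq : IsDefiningAt B (frame p b q') ρ := ⟨hρ.1, hgne, hdefq⟩
  refine ⟨hq1, hdefq.self_of_nhds.trans hlt, ?_, fun hq => ⟨ρ, hdq, ?_⟩⟩
  · rw [← heq]
    refine ⟨fun h => hdq.eq_zero hB h, fun h => ?_⟩
    rw [hB.frontier_eq]
    refine ⟨?_, fun h' => ?_⟩
    -- A point of the graph is a limit of points directly below it, which belong to the body.
    · have hc : Filter.Tendsto (fun ε : ℝ => (q'.1, q'.2 - ε)) (nhdsWithin 0 (Ioi 0)) (nhds q') := by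
        have : Continuous fun ε : ℝ => (q'.1, q'.2 - ε) := by fun_prop
        have := this.tendsto 0
        simp only [sub_zero, Prod.mk.eta] at this
        exact this.mono_left nhdsWithin_le_nhds
      have hc' := ((frame p b).continuous.tendsto q').comp hc
      refine mem_closure_of_tendsto hc' ?_
      have hVq : ∀ᶠ ε in nhdsWithin (0 : ℝ) (Ioi 0), (q'.1, q'.2 - ε) ∈ V :=
        hc.eventually (hVo.mem_nhds hq')
      filter_upwards [hVq, self_mem_nhdsWithin] with ε h1 h2
      obtain ⟨⟨-, hlt', -, -⟩, hd', -⟩ := hV _ h1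
      have h2' : (0 : ℝ) < ε := h2
      refine hd'.self_of_nhds.2 (hlt'.2 ?_)
      have := heq.1 h
      simp only
      linarith
    · have h1 : f q' < 0 := hdefq.self_of_nhds.1 h'
      rw [h] at h1
      exact lt_irrefl _ h1
  · set c := fderiv ℝ f q' (0, 1) with hc
    set d := deriv γ q'.1
    have ht := htan hq
    have e0 : ⟪b 0, gradient ρ (frame p b q')⟫_ℝ = -(d * c) := by
      have := hfd q' (1, 0)
      simp only [one_smul, zero_smul, add_zero] at this
      rw [real_inner_comm, ← this]
      linarith
    have e1 : ⟪b 1, gradient ρ (frame p b q')⟫_ℝ = c := by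
      have := hfd q' (0, 1)
      simp only [one_smul, zero_smul, zero_add] at this
      rw [real_inner_comm, ← this]
    have hgrad : gradient ρ (frame p b q') = -(c • (d • b 0 - b 1)) := by
      rw [← b.sum_repr' (gradient ρ (frame p b q')), Fin.sum_univ_two, e0, e1]
      module
    have hn : ‖d • b 0 - b 1‖ = √(1 + d ^ 2) := by
      have : ‖d • b 0 - b 1‖ ^ 2 = 1 + d ^ 2 := by
        rw [← b.repr.norm_map, EuclideanSpace.norm_sq_eq]
        simp [Fin.sum_univ_two, b.repr_self]
        ring
      rw [← this, Real.sqrt_sq (norm_nonneg _)]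
    rw [hgrad, norm_neg, norm_smul, hn, Real.norm_of_nonneg hpos.le, mul_inv, smul_neg, neg_neg,
      smul_smul]
    congr 1
    field_simp

variable {B : Set Plane}

theorem fderiv_inner_frame_eq_zero {p : Plane} {b : OrthonormalBasis (Fin 2) ℝ Plane}
    {X : Plane → Plane} (w : Plane) {q : ℝ × ℝ} (hq : frame p b q ∉ tsupport X) :
    fderiv ℝ (fun q => ⟪w, X (frame p b q)⟫_ℝ) q = 0 := by
  have : (fun q => ⟪w, X (frame p b q)⟫_ℝ) =ᶠ[nhds q] fun _ => 0 := by
    filter_upwards [(frame p b).continuous.continuousAt.preimage_mem_nhds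
      ((isClosed_tsupport X).isOpen_compl.mem_nhds hq)] with q' hq'
    rw [image_eq_zero_of_notMem_tsupport hq', inner_zero_right]
  rw [this.fderiv_eq]
  simp

/-- Integration by parts under the graph leaves `X₁ - γ'X₀` on it, which is `-√(1 + γ'²)⟪X, n⟫`; the
root is the density of arc length. As the normal is given as a relation, its flux is represented by
a function `G` on the boundary. -/
theorem exists_local_divergence_theorem (hB : IsOpen B) {p : Plane} (hp : p ∈ frontier B)
    {ρ : Plane → ℝ} (hρ : IsDefiningAt B p ρ) :
    ∃ U : Set Plane, IsOpen U ∧ p ∈ U ∧ μH[1] (frontier B ∩ U) < ⊤ ∧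
      ∀ (X : Plane → Plane) (G : Plane → ℝ), ContDiff ℝ 1 X → HasCompactSupport X →
        tsupport X ⊆ U → (∀ q ∈ frontier B, ∀ n, IsWaterNormal B q n → ⟪X q, n⟫_ℝ = G q) →
        (∀ q ∈ frontier B, q ∉ U → G q = 0) →
        ∫ x in B, divergence X x = -∫ x in frontier B, G x ∂μH[1] := by
  obtain ⟨b, γ, U, hγ, hU, hpU, hchart⟩ := exists_boundary_chart hB hp hρ
  have hγc := hγ.continuous
  have hγ' : Continuous (deriv γ) := hγ.continuous_deriv (by simp)
  set Γ : ℝ → Plane := fun s => frame p b (s, γ s) with hΓdef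
  have hΓ : ∀ s t, dist (Γ s) (Γ t) ^ 2 = (s - t) ^ 2 + (γ s - γ t) ^ 2 := fun s t =>
    dist_frame_sq _ _
  have hfr : ∀ x ∈ U, x ∈ frontier B ↔ x ∈ range Γ := by
    intro x hx
    obtain ⟨q, rfl⟩ := (frame p b).surjective x
    rw [(hchart q hx).2.2.1]
    constructor
    · intro h
      exact ⟨q.1, by rw [hΓdef]; simp only; rw [← h]⟩
    · rintro ⟨s, hs⟩
      have := (frame p b).injective hs
      rw [← this]
  refine ⟨U, hU, hpU, ?_, ?_⟩
  · refine (measure_mono ?_).trans_lt (hausdorffMeasure_graph_lt_top hγ hΓ (-1) 1)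
    rintro x ⟨hx, hxU⟩
    obtain ⟨s, rfl⟩ := (hfr x hxU).1 hx
    exact ⟨s, abs_le.1 (hchart _ hxU).1.le, rfl⟩
  intro X G hX hc hsupp hG hG0
  have hY0 := contDiff_inner_frame (p := p) (b := b) hX (b 0)
  have hY1 := contDiff_inner_frame (p := p) (b := b) hX (b 1)
  have hc0 := hasCompactSupport_inner_frame (p := p) (b := b) hc (b 0)
  have hc1 := hasCompactSupport_inner_frame (p := p) (b := b) hc (b 1)
  have hi0 := integrable_fderiv_apply hY0 hc0 (1, 0)
  have hi1 := integrable_fderiv_apply hY1 hc1 (0, 1)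
  have hleft : ∫ x in B, divergence X x
      = (-∫ s, ⟪b 0, X (Γ s)⟫_ℝ * deriv γ s) + ∫ s, ⟪b 1, X (Γ s)⟫_ℝ := by
    rw [setIntegral_frame (p := p) (b := b)]
    simp only [divergence_frame hX]
    have hm1 : MeasurableSet (frame p b ⁻¹' B) := (hB.preimage (frame p b).continuous).measurableSet
    have hm2 : MeasurableSet {q : ℝ × ℝ | q.2 < γ q.1} :=
      measurableSet_lt measurable_snd (hγc.measurable.comp measurable_fst)
    rw [← setIntegral_subgraph_fderiv_fst hY0 hc0 hγ, ← setIntegral_subgraph_fderiv_snd hY1 hc1 hγc,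
      ← integral_add hi0.integrableOn hi1.integrableOn, ← integral_indicator hm1,
      ← integral_indicator hm2]
    congr 1
    funext q
    by_cases hq : frame p b q ∈ U
    · have h1 : q ∈ frame p b ⁻¹' B ↔ q ∈ {q : ℝ × ℝ | q.2 < γ q.1} := (hchart q hq).2.1
      by_cases h2 : q ∈ {q : ℝ × ℝ | q.2 < γ q.1}
      · rw [indicator_of_mem h2, indicator_of_mem (h1.2 h2)]
      · rw [indicator_of_notMem h2, indicator_of_notMem (mt h1.1 h2)]
    · have hq' : frame p b q ∉ tsupport X := fun h => hq (hsupp h)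
      have e : fderiv ℝ (fun q => ⟪b 0, X (frame p b q)⟫_ℝ) q (1, 0)
          + fderiv ℝ (fun q => ⟪b 1, X (frame p b q)⟫_ℝ) q (0, 1) = 0 := by
        rw [fderiv_inner_frame_eq_zero _ hq', fderiv_inner_frame_eq_zero _ hq']
        simp
      simp only [indicator, e, ite_self]
  have hright : ∫ x in frontier B, G x ∂μH[1]
      = ∫ s, √(1 + deriv γ s ^ 2) * U.indicator G (Γ s) := by
    rw [← setIntegral_graph_hausdorff hγ hΓ]
    have hmr : MeasurableSet (range Γ) := (comap_graph_hausdorff hγ hΓ).1.measurableSet_range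
    rw [← integral_indicator isClosed_frontier.measurableSet, ← integral_indicator hmr]
    congr 1
    funext x
    by_cases hx : x ∈ U
    · by_cases h : x ∈ frontier B
      · rw [indicator_of_mem h, indicator_of_mem ((hfr x hx).1 h), indicator_of_mem hx]
      · rw [indicator_of_notMem h, indicator_of_notMem (mt (hfr x hx).2 h)]
    · have : (range Γ).indicator (U.indicator G) x = 0 := by
        simp only [indicator, hx, if_false, ite_self]
      rw [this]
      by_cases h : x ∈ frontier B
      · rw [indicator_of_mem h, hG0 x h hx]
      · rw [indicator_of_notMem h]
  have hg0 : Integrable fun s => ⟪b 0, X (Γ s)⟫_ℝ * deriv γ s := by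
    refine Continuous.integrable_of_hasCompactSupport ?_ ?_
    · exact (hY0.continuous.comp (by fun_prop : Continuous fun s => (s, γ s))).mul hγ'
    · refine HasCompactSupport.mul_right (f := fun s => ⟪b 0, X (Γ s)⟫_ℝ) ?_
      refine HasCompactSupport.of_support_subset_isCompact (hc0.isCompact.image continuous_fst)
        fun s hs => ⟨(s, γ s), subset_tsupport _ hs, rfl⟩
  have hg1 : Integrable fun s => ⟪b 1, X (Γ s)⟫_ℝ := by
    refine Continuous.integrable_of_hasCompactSupport
      (hY1.continuous.comp (by fun_prop : Continuous fun s => (s, γ s))) ?_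
    refine HasCompactSupport.of_support_subset_isCompact (hc1.isCompact.image continuous_fst)
      fun s hs => ⟨(s, γ s), subset_tsupport _ hs, rfl⟩
  rw [hleft, hright, neg_add_eq_sub, ← integral_sub hg1 hg0, ← integral_neg]
  congr 1
  funext s
  by_cases hs : Γ s ∈ U
  · rw [indicator_of_mem hs]
    obtain ⟨-, -, hf, hn⟩ := hchart (s, γ s) hs
    rw [← hG (Γ s) (hf.2 rfl) _ (hn rfl)]
    have h0 : 0 < √(1 + deriv γ s ^ 2) := by positivity
    rw [inner_smul_right, inner_sub_right, inner_smul_right, ← mul_assoc, mul_inv_cancel₀ h0.ne',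
      real_inner_comm (b 0), real_inner_comm (b 1)]
    ring
  · have : X (Γ s) = 0 := image_eq_zero_of_notMem_tsupport fun h => hs (hsupp h)
    simp [this, hs]

theorem hausdorffMeasure_frontier_lt_top (hB : IsSubmergedBody B) :
    μH[1] (frontier B) < ⊤ := by
  have hK : IsCompact (frontier B) := Metric.isCompact_of_isClosed_isBounded isClosed_frontier
    (hB.isBounded.closure.subset frontier_subset_closure)
  refine hK.measure_lt_top_of_nhdsWithin fun p hp => ?_
  obtain ⟨ρ, hρ⟩ := hB.smooth_boundary p hp
  obtain ⟨U, hU, hpU, hfin, -⟩ := exists_local_divergence_theorem hB.isOpen hp hρ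
  exact ⟨frontier B ∩ U, Filter.inter_mem self_mem_nhdsWithin
    (mem_nhdsWithin_of_mem_nhds (hU.mem_nhds hpU)), hfin⟩

theorem integrableOn_frontier (hB : IsSubmergedBody B) {E : Type*} [NormedAddCommGroup E]
    [SecondCountableTopology E] {g : Plane → E} (hg : Continuous g) :
    IntegrableOn g (frontier B) μH[1] := by
  have hF : IsCompact (frontier B) := Metric.isCompact_of_isClosed_isBounded isClosed_frontier
    (hB.isBounded.closure.subset frontier_subset_closure)
  obtain ⟨C, hC⟩ := hF.exists_bound_of_continuousOn hg.continuousOn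
  exact Measure.integrableOn_of_bounded (hausdorffMeasure_frontier_lt_top hB).ne
    hg.aestronglyMeasurable ((ae_restrict_iff' isClosed_frontier.measurableSet).2
      (Filter.Eventually.of_forall hC))

/-- Finite one-dimensional Hausdorff measure forces the two-dimensional one to vanish, and the
latter is a Haar measure on the plane. -/
theorem volume_frontier (hB : IsSubmergedBody B) : volume (frontier B) = 0 := by
  have h2 : (μH[2] : Measure Plane) (frontier B) = 0 := by
    rcases Measure.hausdorffMeasure_zero_or_top (X := Plane) (d₁ := 1) (d₂ := 2) (by norm_num)
      (frontier B) with h | h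
    · exact h
    · exact absurd h (hausdorffMeasure_frontier_lt_top hB).ne
  have : (μH[2] : Measure Plane).IsAddHaarMeasure := by
    have := isAddHaarMeasure_hausdorffMeasure (E := Plane)
    simpa using this
  exact Measure.absolutelyContinuous_isAddHaarMeasure volume (μH[2] : Measure Plane) h2

theorem divergence_add {X Y : Plane → Plane} (hX : ContDiff ℝ 1 X) (hY : ContDiff ℝ 1 Y)
    (x : Plane) : divergence (X + Y) x = divergence X x + divergence Y x := by
  rw [divergence, fderiv_add (hX.differentiable (by simp) x) (hY.differentiable (by simp) x)]
  exact map_add _ _ _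

theorem integrable_divergence {X : Plane → Plane} (hX : ContDiff ℝ 1 X) (hc : HasCompactSupport X) :
    Integrable (divergence X) := by
  let b := EuclideanSpace.basisFun (Fin 2) ℝ
  have e : divergence X = fun x => ⟪b 0, fderiv ℝ X x (b 0)⟫_ℝ + ⟪b 1, fderiv ℝ X x (b 1)⟫_ℝ := by
    funext x
    rw [divergence, LinearMap.trace_eq_sum_inner _ b, Fin.sum_univ_two]
    rfl
  have hf := hX.continuous_fderiv (by simp)
  rw [e]
  refine Continuous.integrable_of_hasCompactSupport ?_ ?_
  · exact (continuous_const.inner (hf.clm_apply continuous_const)).add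
      (continuous_const.inner (hf.clm_apply continuous_const))
  · exact ((hc.fderiv (𝕜 := ℝ)).comp_left (g := fun A : Plane →L[ℝ] Plane =>
      ⟪b 0, A (b 0)⟫_ℝ + ⟪b 1, A (b 1)⟫_ℝ) (by simp))

theorem divergence_eq_zero_of_eventuallyEq {X : Plane → Plane} {x : Plane}
    (h : X =ᶠ[nhds x] 0) : divergence X x = 0 := by
  rw [divergence, h.fderiv_eq]
  simp

theorem exists_isWaterNormal (hB : IsSubmergedBody B) {p : Plane} (hp : p ∈ frontier B) :
    ∃ n, IsWaterNormal B p n := by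
  obtain ⟨ρ, hρ⟩ := hB.smooth_boundary p hp
  exact ⟨_, ρ, hρ, rfl⟩

/-- For `p` in `B` the cutoff is supported in `B` and both sides vanish. For `p` on the boundary it
is supported in a graph chart. -/
theorem exists_localized_divergence_theorem (hB : IsSubmergedBody B) {p : Plane}
    (hp : p ∈ closure B) :
    ∃ c : Plane → ℝ, ContDiff ℝ 1 c ∧ (∀ᶠ x in nhds p, c x = 1) ∧
      ∀ (X : Plane → Plane) (G : Plane → ℝ), ContDiff ℝ 1 X → HasCompactSupport X →
        (∀ q ∈ frontier B, ∀ n, IsWaterNormal B q n → ⟪X q, n⟫_ℝ = G q) →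
        ∫ x in B, divergence (fun y => c y • X y) x
          = -∫ x in frontier B, c x * G x ∂μH[1] := by
  have bump : ∀ U : Set Plane, IsOpen U → p ∈ U → ∃ c : ContDiffBump p, tsupport c ⊆ U := by
    intro U hU hpU
    obtain ⟨r, hr, hball⟩ := Metric.isOpen_iff.1 hU p hpU
    refine ⟨⟨r / 4, r / 2, by positivity, by linarith⟩, ?_⟩
    rw [ContDiffBump.tsupport_eq]
    exact (Metric.closedBall_subset_ball (by simp only; linarith)).trans hball
  have hsm : ∀ (c : ContDiffBump p) (X : Plane → Plane), ContDiff ℝ 1 X →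
      ContDiff ℝ 1 fun y => c y • X y := fun c X hX => c.contDiff.smul hX
  have hcs : ∀ (c : ContDiffBump p) (X : Plane → Plane), HasCompactSupport fun y => c y • X y :=
    fun c X => c.hasCompactSupport.smul_right
  have hts : ∀ (c : ContDiffBump p) (X : Plane → Plane),
      tsupport (fun y => c y • X y) ⊆ tsupport c := fun c X => tsupport_smul_subset_left _ _
  by_cases hpB : p ∈ B
  · obtain ⟨c, hc⟩ := bump B hB.isOpen hpB
    refine ⟨c, c.contDiff, c.eventuallyEq_one, fun X G hX hXc hG => ?_⟩
    have hz : ∀ q ∈ frontier B, c q = 0 := by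
      intro q hq
      refine image_eq_zero_of_notMem_tsupport fun h => ?_
      rw [hB.isOpen.frontier_eq] at hq
      exact hq.2 (hc h)
    have h1 : ∫ x in frontier B, c x * G x ∂μH[1] = 0 := by
      rw [setIntegral_congr_fun isClosed_frontier.measurableSet
        (g := fun _ => (0 : ℝ)) fun x hx => by simp only [hz x hx, zero_mul]]
      simp
    rw [h1, neg_zero, setIntegral_eq_integral_of_forall_compl_eq_zero,
      integral_divergence_eq_zero (hsm c X hX) (hcs c X)]
    intro x hx
    have hx' : x ∉ tsupport fun y => c y • X y := fun h => hx (hc (hts c X h))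
    exact divergence_eq_zero_of_eventuallyEq (notMem_tsupport_iff_eventuallyEq.1 hx')
  · have hpf : p ∈ frontier B := by
      rw [hB.isOpen.frontier_eq]
      exact ⟨hp, hpB⟩
    obtain ⟨ρ, hρ⟩ := hB.smooth_boundary p hpf
    obtain ⟨U, hU, hpU, -, hloc⟩ := exists_local_divergence_theorem hB.isOpen hpf hρ
    obtain ⟨c, hc⟩ := bump U hU hpU
    refine ⟨c, c.contDiff, c.eventuallyEq_one, fun X G hX hXc hG => ?_⟩
    refine hloc _ _ (hsm c X hX) (hcs c X) ((hts c X).trans hc) ?_ ?_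
    · intro q hq n hn
      rw [real_inner_smul_left, hG q hq n hn]
    · intro q hq hqU
      rw [image_eq_zero_of_notMem_tsupport fun h => hqU (hc h), zero_mul]

/-- The divergence theorem in a submerged body; the boundary normal points into the body. -/
theorem integral_divergence_body (hB : IsSubmergedBody B) {X : Plane → Plane} {G : Plane → ℝ}
    (hX : ContDiff ℝ 1 X) (hc : HasCompactSupport X) (hGc : Continuous G)
    (hG : ∀ q ∈ frontier B, ∀ n, IsWaterNormal B q n → ⟪X q, n⟫_ℝ = G q) :
    ∫ x in B, divergence X x = -∫ x in frontier B, G x ∂μH[1] := by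
  have hK : IsCompact (closure B) :=
    Metric.isCompact_of_isClosed_isBounded isClosed_closure hB.isBounded.closure
  have hint : ∀ g : Plane → ℝ, Continuous g → IntegrableOn g (frontier B) μH[1] :=
    fun g hg => integrableOn_frontier hB hg
  choose! c hc1 hcone hcloc using fun p (hp : p ∈ closure B) =>
    exists_localized_divergence_theorem hB hp
  obtain ⟨t, htK, ht⟩ := hK.elim_nhds_subcover (fun p => {x | c p x = 1}) hcone
  -- Induction over the finite cover, in place of a partition of unity: split `X = c_p X + (1 -
  -- c_p)X`. The second part vanishes where `c_p = 1`, so `p` can be dropped from the cover; when no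
  -- set is left, `X` vanishes on the closure of `B`.
  have step : ∀ t : Finset Plane, (∀ p ∈ t, p ∈ closure B) → ∀ (X : Plane → Plane)
      (G : Plane → ℝ), ContDiff ℝ 1 X → HasCompactSupport X → Continuous G →
      (∀ q ∈ frontier B, ∀ n, IsWaterNormal B q n → ⟪X q, n⟫_ℝ = G q) →
      (∀ x ∈ closure B, x ∉ ⋃ p ∈ t, {x | c p x = 1} → X x = 0) →
      ∫ x in B, divergence X x = -∫ x in frontier B, G x ∂μH[1] := by
    intro t
    induction t using Finset.induction_on with
    | empty =>
      intro _ X G hX hc hGc hG h0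
      have h0' : ∀ x ∈ closure B, X x = 0 := fun x hx => h0 x hx (by simp)
      rw [setIntegral_congr_fun (g := fun _ => (0 : ℝ)) hB.isOpen.measurableSet,
        setIntegral_congr_fun (g := fun _ => (0 : ℝ)) isClosed_frontier.measurableSet]
      · simp
      · intro q hq
        obtain ⟨n, hn⟩ := exists_isWaterNormal hB hq
        simp only
        rw [← hG q hq n hn, h0' q (frontier_subset_closure hq), inner_zero_left]
      · intro x hx
        refine divergence_eq_zero_of_eventuallyEq ?_
        filter_upwards [hB.isOpen.mem_nhds hx] with y hy
        exact h0' y (subset_closure hy)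
    | insert p t hp ih =>
      intro hsub X G hX hc hGc hG h0
      have hpK := hsub p (Finset.mem_insert_self p t)
      have hcp : ContDiff ℝ 1 (c p) := hc1 p hpK
      have hX1 : ContDiff ℝ 1 fun y => c p y • X y := hcp.smul hX
      have hX2 : ContDiff ℝ 1 fun y => (1 - c p y) • X y := (contDiff_const.sub hcp).smul hX
      have e1 := hcloc p hpK X G hX hc hG
      have hcs1 : HasCompactSupport fun y => c p y • X y := hc.smul_left (f := c p)
      have hcs2 : HasCompactSupport fun y => (1 - c p y) • X y :=
        hc.smul_left (f := fun y => 1 - c p y)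
      have g2 : ∀ q ∈ frontier B, ∀ n, IsWaterNormal B q n →
          ⟪(1 - c p q) • X q, n⟫_ℝ = (1 - c p q) * G q := fun q hq n hn => by
        rw [real_inner_smul_left, hG q hq n hn]
      have z2 : ∀ x ∈ closure B, x ∉ ⋃ q ∈ t, {x | c q x = 1} → (1 - c p x) • X x = 0 := by
        intro x hx hxt
        by_cases h : c p x = 1
        · rw [h, sub_self, zero_smul]
        · rw [h0 x hx, smul_zero]
          simp only [Finset.mem_insert, mem_iUnion, mem_ofPred_eq, exists_prop] at hxt ⊢
          rintro ⟨q, rfl | hq, hq'⟩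
          · exact h hq'
          · exact hxt ⟨q, hq, hq'⟩
      have e2 := ih (fun q hq => hsub q (Finset.mem_insert_of_mem hq)) (fun y => (1 - c p y) • X y)
        (fun y => (1 - c p y) * G y) hX2 hcs2
        ((continuous_const.sub hcp.continuous).mul hGc) g2 z2
      have eX : divergence X = fun x => divergence (fun y => c p y • X y) x
          + divergence (fun y => (1 - c p y) • X y) x := by
        funext x
        rw [← divergence_add hX1 hX2]
        congr 1
        funext y
        simp only [Pi.add_apply]
        module
      have eG : ∫ x in frontier B, G x ∂μH[1] = (∫ x in frontier B, c p x * G x ∂μH[1])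
          + ∫ x in frontier B, (1 - c p x) * G x ∂μH[1] := by
        rw [← integral_add (hint (fun x => c p x * G x) (hcp.continuous.mul hGc))
          (hint (fun x => (1 - c p x) * G x) ((continuous_const.sub hcp.continuous).mul hGc))]
        congr 1
        funext x
        ring
      rw [eX, eG, integral_add (integrable_divergence hX1 hcs1).integrableOn
        (integrable_divergence hX2 hcs2).integrableOn, e1, e2, neg_add]
  exact step t htK X G hX hc hGc hG fun x hx hxt => absurd (ht hx) hxt

/-! ### The estimate for real solutions -/

/-- The standard coordinates of the plane. -/
noncomputable def stdFrame : ℝ × ℝ ≃ₜ Plane := frame 0 (EuclideanSpace.basisFun (Fin 2) ℝ)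

theorem stdFrame_apply (q : ℝ × ℝ) :
    stdFrame q = q.1 • EuclideanSpace.single 0 1 + q.2 • EuclideanSpace.single 1 1 := by
  rw [stdFrame, frame_apply]
  simp

@[simp] theorem stdFrame_zero (q : ℝ × ℝ) : stdFrame q 0 = q.1 := by
  rw [stdFrame_apply]; simp

@[simp] theorem stdFrame_one (q : ℝ × ℝ) : stdFrame q 1 = q.2 := by
  rw [stdFrame_apply]; simp

theorem norm_sq_stdFrame (q : ℝ × ℝ) : ‖stdFrame q‖ ^ 2 = q.1 ^ 2 + q.2 ^ 2 := by
  rw [EuclideanSpace.norm_sq_eq]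
  simp [Fin.sum_univ_two]

theorem stdFrame_surf (t : ℝ) : stdFrame (t, 0) = surf t := by
  ext i
  fin_cases i <;> simp [surf]

theorem contDiff_stdFrame {n : WithTop ℕ∞} : ContDiff ℝ n stdFrame := contDiff_frame

theorem dX_comp_stdFrame {w : Plane → ℝ} (hw : Differentiable ℝ w) (q : ℝ × ℝ) :
    dX (fun q => w (stdFrame q)) q = fderiv ℝ w (stdFrame q) (EuclideanSpace.single 0 1) := by
  rw [dX]
  refine (fderiv_comp_frame (hw _) _).trans ?_
  simp [stdFrame]

theorem dY_comp_stdFrame {w : Plane → ℝ} (hw : Differentiable ℝ w) (q : ℝ × ℝ) :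
    dY (fun q => w (stdFrame q)) q = fderiv ℝ w (stdFrame q) (EuclideanSpace.single 1 1) := by
  rw [dY]
  refine (fderiv_comp_frame (hw _) _).trans ?_
  simp [stdFrame]

theorem contDiff_fderiv_apply_const {F : Type*} [NormedAddCommGroup F] [NormedSpace ℝ F]
    {w : Plane → F} (hw : ContDiff ℝ ∞ w) (e : Plane) :
    ContDiff ℝ ∞ fun x => fderiv ℝ w x e :=
  (hw.fderiv_right (m := ∞) (by simp)).clm_apply contDiff_const

theorem laplacian_eq_fderiv_fderiv {F : Type*} [NormedAddCommGroup F] [NormedSpace ℝ F]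
    {w : Plane → F} (hw : ContDiff ℝ ∞ w) (x : Plane) :
    (Δ w) x = fderiv ℝ (fun x => fderiv ℝ w x (EuclideanSpace.single 0 1)) x
        (EuclideanSpace.single 0 1)
      + fderiv ℝ (fun x => fderiv ℝ w x (EuclideanSpace.single 1 1)) x
        (EuclideanSpace.single 1 1) := by
  have hd : DifferentiableAt ℝ (fderiv ℝ w) x :=
    (hw.fderiv_right (m := ∞) (by simp)).differentiable (by simp) x
  rw [InnerProductSpace.laplacian_eq_iteratedFDeriv_orthonormalBasis w
    (EuclideanSpace.basisFun (Fin 2) ℝ)]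
  simp only [Fin.sum_univ_two, iteratedFDeriv_two_apply, EuclideanSpace.basisFun_apply,
    Matrix.cons_val_zero, Matrix.cons_val_one]
  rw [fderiv_clm_apply hd (differentiableAt_const _), fderiv_clm_apply hd (differentiableAt_const _)]
  simp

theorem laplacian_stdFrame {w : Plane → ℝ} (hw : ContDiff ℝ ∞ w) (q : ℝ × ℝ) :
    dX (dX fun q => w (stdFrame q)) q + dY (dY fun q => w (stdFrame q)) q
      = (Δ w) (stdFrame q) := by
  have hd : Differentiable ℝ w := hw.differentiable (by simp)
  have h0 : Differentiable ℝ fun x => fderiv ℝ w x (EuclideanSpace.single 0 1) :=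
    (contDiff_fderiv_apply_const hw _).differentiable (by simp)
  have h1 : Differentiable ℝ fun x => fderiv ℝ w x (EuclideanSpace.single 1 1) :=
    (contDiff_fderiv_apply_const hw _).differentiable (by simp)
  have e0 : (dX fun q => w (stdFrame q)) = fun q => fderiv ℝ w (stdFrame q)
    (EuclideanSpace.single 0 1) := funext (dX_comp_stdFrame hd)
  have e1 : (dY fun q => w (stdFrame q)) = fun q => fderiv ℝ w (stdFrame q)
    (EuclideanSpace.single 1 1) := funext (dY_comp_stdFrame hd)
  rw [e0, e1, dX_comp_stdFrame h0, dY_comp_stdFrame h1, laplacian_eq_fderiv_fderiv hw]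

theorem setIntegral_stdFrame (f : Plane → ℝ) (s : Set Plane) :
    ∫ x in s, f x = ∫ q in stdFrame ⁻¹' s, f (stdFrame q) := setIntegral_frame f s

theorem integrableOn_stdFrame {f : Plane → ℝ} {s : Set Plane} :
    IntegrableOn (fun q => f (stdFrame q)) (stdFrame ⁻¹' s) ↔ IntegrableOn f s :=
  measurePreserving_frame.integrableOn_comp_preimage measurableEmbedding_frame

section

variable {B : Set Plane} {ν L h H : ℝ}

theorem closure_body_subset (hBL : B ⊆ {x | |x 0| < L ∧ h < x 1}) (hBH : B ⊆ {x | x 1 < H}) :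
    closure B ⊆ {x | |x 0| ≤ L ∧ h ≤ x 1 ∧ x 1 ≤ H} := by
  refine closure_minimal (fun x hx => ⟨(hBL hx).1.le, (hBL hx).2.le, le_of_lt (hBH hx)⟩) ?_
  have h0 : Continuous fun x : Plane => x 0 := by fun_prop
  have h1 : Continuous fun x : Plane => x 1 := by fun_prop
  exact (isClosed_le h0.abs continuous_const).inter
    ((isClosed_le continuous_const h1).inter (isClosed_le h1 continuous_const))

theorem measurableSet_water : MeasurableSet (water B) := by
  have h1 : Continuous fun x : Plane => x 1 := by fun_prop
  exact (isOpen_lt continuous_const h1).measurableSet.diff isClosed_closure.measurableSet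

/-- The divergence theorem in the water domain. -/
theorem integral_divergence_water (hB : IsSubmergedBody B) {X : Plane → Plane} {G : Plane → ℝ}
    (hX : ContDiff ℝ 1 X) (hc : HasCompactSupport X) (hGc : Continuous G)
    (hG : ∀ q ∈ frontier B, ∀ n, IsWaterNormal B q n → ⟪X q, n⟫_ℝ = G q) :
    ∫ x in water B, divergence X x = -(∫ t, X (surf t) 1) + ∫ x in frontier B, G x ∂μH[1] := by
  have hi := integrable_divergence hX hc
  have hupper : ∫ x in {x : Plane | 0 < x 1}, divergence X x = -∫ t, X (surf t) 1 := by
    let b := EuclideanSpace.basisFun (Fin 2) ℝ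
    have hpre : stdFrame ⁻¹' {x : Plane | 0 < x 1} = {q : ℝ × ℝ | 0 < q.2} := by
      ext q; simp
    have h0 := contDiff_inner_frame (p := 0) (b := b) hX (b 0)
    have h1 := contDiff_inner_frame (p := 0) (b := b) hX (b 1)
    have c0 := hasCompactSupport_inner_frame (p := 0) (b := b) hc (b 0)
    have c1 := hasCompactSupport_inner_frame (p := 0) (b := b) hc (b 1)
    have i0 := integrable_fderiv_apply h0 c0 (1, 0)
    have i1 := integrable_fderiv_apply h1 c1 (0, 1)
    rw [setIntegral_stdFrame, hpre]
    simp only [stdFrame, divergence_frame hX]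
    rw [integral_add i0.integrableOn i1.integrableOn, setIntegral_upper_fderiv_fst h0 c0,
      setIntegral_upper_fderiv_snd h1 c1, zero_add]
    congr 2
    funext t
    have : frame 0 b (t, 0) = surf t := stdFrame_surf t
    rw [this]
    simp [b, EuclideanSpace.inner_single_left]
  have hcl : ∫ x in closure B, divergence X x = ∫ x in B, divergence X x := by
    rw [closure_eq_self_union_frontier]
    refine setIntegral_congr_set ?_
    exact union_ae_eq_left_of_ae_eq_empty (ae_eq_empty.2 (volume_frontier hB))
  rw [water, setIntegral_sdiff isClosed_closure.measurableSet hi.integrableOn hB.closure_subset,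
    hupper, hcl, integral_divergence_body hB hX hc hGc hG]
  ring

end

section

variable {B : Set Plane} {ν L h H : ℝ}

theorem energyField_of_real (hL : 0 < L) (hh : 0 < h) (hH : 0 < H)
    (hBL : B ⊆ {x | |x 0| < L ∧ h < x 1}) (hBH : B ⊆ {x | x 1 < H})
    {w : Plane → ℝ} (hw : ContDiff ℝ ∞ w)
    (grad : ∀ i, IntegrableOn (fun x => fderiv ℝ w x (EuclideanSpace.single i 1) ^ 2) (water B))
    (trace : Integrable fun t => w (surf t) ^ 2)
    (laplacian : IntegrableOn (fun x => ‖x‖ ^ 2 * (Δ w) x ^ 2) (water B))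
    (surface : Integrable fun t => (t * (-fderiv ℝ w (surf t) (EuclideanSpace.single 1 1)
      - ν * w (surf t))) ^ 2) :
    EnergyField ν L h H (stdFrame ⁻¹' water B) fun q => w (stdFrame q) := by
  have hd : Differentiable ℝ w := hw.differentiable (by simp)
  have hcl := closure_body_subset hBL hBH
  refine ⟨hL, hh, hH, stdFrame.continuous.measurable measurableSet_water, ?_, ?_, ?_, ?_,
    hw.comp contDiff_stdFrame, ?_, ?_, ?_, ?_, ?_⟩
  · intro q hq
    simpa using hq.1
  · intro x y hy hx
    refine ⟨by simpa using hy, fun hc => ?_⟩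
    have := (hcl hc).1
    simp only [stdFrame_zero] at this
    exact this.not_gt hx
  · intro x y hy hx
    refine ⟨by simpa using hy, fun hc => ?_⟩
    have := (hcl hc).2.1
    simp only [stdFrame_one] at this
    exact this.not_gt hx
  · intro x y hx
    refine ⟨by simpa using hH.trans hx, fun hc => ?_⟩
    have := (hcl hc).2.2
    simp only [stdFrame_one] at this
    exact this.not_gt hx
  · simp only [dX_comp_stdFrame hd]
    exact integrableOn_stdFrame.2 (grad 0)
  · simp only [dY_comp_stdFrame hd]
    exact integrableOn_stdFrame.2 (grad 1)
  · simpa only [stdFrame_surf] using trace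
  · simp only [laplacian_stdFrame hw, ← norm_sq_stdFrame]
    exact integrableOn_stdFrame.2 laplacian
  · simp only [dY_comp_stdFrame hd, stdFrame_surf]
    refine surface.congr (Filter.Eventually.of_forall fun t => ?_)
    simp only
    ring

theorem contDiff_gradient {w : Plane → ℝ} (hw : ContDiff ℝ ∞ w) : ContDiff ℝ ∞ (gradient w) :=
  (InnerProductSpace.toDual ℝ Plane).symm.contDiff.comp (hw.fderiv_right (m := ∞) (by simp))

theorem inner_gradient (w : Plane → ℝ) (x e : Plane) : ⟪gradient w x, e⟫_ℝ = fderiv ℝ w x e := by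
  rw [gradient, InnerProductSpace.toDual_symm_apply]

theorem gradient_apply (w : Plane → ℝ) (x : Plane) (i : Fin 2) :
    gradient w x i = fderiv ℝ w x (EuclideanSpace.single i 1) := by
  rw [← inner_gradient, EuclideanSpace.inner_single_right]
  simp

/-- The integrand of Green's first identity in the coordinates of the half-plane estimates. -/
theorem divergence_smul_gradient {w : Plane → ℝ} (hw : ContDiff ℝ ∞ w) {ψ : Plane → ℝ}
    (hψ : ContDiff ℝ ∞ ψ) (q : ℝ × ℝ) :
    divergence (fun x => ψ x • gradient w x) (stdFrame q)
      = dX (fun q => w (stdFrame q)) q * dX (fun q => ψ (stdFrame q)) q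
        + dY (fun q => w (stdFrame q)) q * dY (fun q => ψ (stdFrame q)) q
        + (dX (dX fun q => w (stdFrame q)) q + dY (dY fun q => w (stdFrame q)) q)
          * ψ (stdFrame q) := by
  have hd : Differentiable ℝ w := hw.differentiable (by simp)
  have hw' : ContDiff ℝ ∞ fun q => w (stdFrame q) := hw.comp contDiff_stdFrame
  have hψ' : ContDiff ℝ ∞ fun q => ψ (stdFrame q) := hψ.comp contDiff_stdFrame
  have e := divergence_frame (p := 0) (b := EuclideanSpace.basisFun (Fin 2) ℝ)
    ((hψ.smul (contDiff_gradient hw)).of_le (by simp) : ContDiff ℝ 1 fun x => ψ x • gradient w x) q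
  have e0 : ∀ q, ⟪EuclideanSpace.basisFun (Fin 2) ℝ 0, ψ (stdFrame q) • gradient w (stdFrame q)⟫_ℝ
      = ψ (stdFrame q) * dX (fun q => w (stdFrame q)) q := fun q => by
    rw [dX_comp_stdFrame hd, EuclideanSpace.basisFun_apply, inner_smul_right, real_inner_comm,
      inner_gradient]
  have e1 : ∀ q, ⟪EuclideanSpace.basisFun (Fin 2) ℝ 1, ψ (stdFrame q) • gradient w (stdFrame q)⟫_ℝ
      = ψ (stdFrame q) * dY (fun q => w (stdFrame q)) q := fun q => by
    rw [dY_comp_stdFrame hd, EuclideanSpace.basisFun_apply, inner_smul_right, real_inner_comm,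
      inner_gradient]
  refine e.trans ?_
  change fderiv ℝ (fun q => ⟪EuclideanSpace.basisFun (Fin 2) ℝ 0,
      ψ (stdFrame q) • gradient w (stdFrame q)⟫_ℝ) q (1, 0)
    + fderiv ℝ (fun q => ⟪EuclideanSpace.basisFun (Fin 2) ℝ 1,
      ψ (stdFrame q) • gradient w (stdFrame q)⟫_ℝ) q (0, 1) = _
  simp only [e0, e1]
  rw [fderiv_fun_mul (hψ'.differentiable (by simp) q)
      ((contDiff_dX hw').differentiable (by simp) q),
    fderiv_fun_mul (hψ'.differentiable (by simp) q)
      ((contDiff_dY hw').differentiable (by simp) q)]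
  simp only [add_apply, smul_apply, smul_eq_mul]
  change _ * dX (dX fun q => w (stdFrame q)) q + _ * dX (fun q => ψ (stdFrame q)) q
    + (_ * dY (dY fun q => w (stdFrame q)) q + _ * dY (fun q => ψ (stdFrame q)) q) = _
  ring

/-- The estimate of `EnergyField.gradient_estimate` with its Green formula supplied by the
divergence theorem for `ψ∇w`. The terms `-Δw` and `-w_y - νw` take the place of `f₁` and `g₂`. -/
theorem gradient_estimate_real (hν : 0 < ν) (hL : 0 < L) (hh : 0 < h) (hH : 0 < H)
    (hB : IsSubmergedBody B)
    (hBL : B ⊆ {x | |x 0| < L ∧ h < x 1}) (hBH : B ⊆ {x | x 1 < H})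
    {w g : Plane → ℝ} (hw : ContDiff ℝ ∞ w) (hg : Continuous g)
    (body : ∀ p ∈ frontier B, ∀ n, IsWaterNormal B p n → fderiv ℝ w p n = g p)
    (grad : ∀ i, IntegrableOn (fun x => fderiv ℝ w x (EuclideanSpace.single i 1) ^ 2) (water B))
    (trace : Integrable fun t => w (surf t) ^ 2)
    (laplacian : IntegrableOn (fun x => ‖x‖ ^ 2 * (Δ w) x ^ 2) (water B))
    (surface : Integrable fun t => (t * (-fderiv ℝ w (surf t) (EuclideanSpace.single 1 1)
      - ν * w (surf t))) ^ 2)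
    (surface_mul : Integrable fun t => (-fderiv ℝ w (surf t) (EuclideanSpace.single 1 1)
      - ν * w (surf t)) * w (surf t)) :
    IntegrableOn (fun x => -(Δ w) x * w x) (water B) ∧
    (∫ x in water B, fderiv ℝ w x (EuclideanSpace.single 0 1) ^ 2)
        + (∫ x in water B, fderiv ℝ w x (EuclideanSpace.single 1 1) ^ 2) ≤
      4 * ((∫ x in water B, -(Δ w) x * w x) + (∫ x in frontier B, g x * w x ∂μH[1])
        + ∫ t, (-fderiv ℝ w (surf t) (EuclideanSpace.single 1 1) - ν * w (surf t)) * w (surf t))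
      + 18 * ((∫ x in water B, ‖x‖ ^ 2 * (Δ w) x ^ 2)
        + ν * ∫ t, (t * (-fderiv ℝ w (surf t) (EuclideanSpace.single 1 1) - ν * w (surf t))) ^ 2)
      + (72 * (ν * L ^ 2 / h) * (1 + ν * h) ^ 3 - 3)
        * ∫ x in water B, fderiv ℝ w x (EuclideanSpace.single 0 1) ^ 2 := by
  have hd : Differentiable ℝ w := hw.differentiable (by simp)
  have hE := energyField_of_real hL hh hH hBL hBH hw grad trace laplacian surface
  have hI := hE.integrableOn_laplacian_mul
  simp only [laplacian_stdFrame hw] at hI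
  have hI' := (integrableOn_stdFrame (f := fun x => (Δ w) x * w x)).1 hI
  refine ⟨by
    refine IntegrableOn.congr_fun hI'.neg (fun x _ => ?_) measurableSet_water
    simp, ?_⟩
  have key := hE.gradient_estimate hν (S := ∫ x in frontier B, g x * w x ∂μH[1]) ?_ ?_
  · simp only [laplacian_stdFrame hw, dX_comp_stdFrame hd, dY_comp_stdFrame hd, stdFrame_surf,
      ← norm_sq_stdFrame] at key
    simpa only [setIntegral_stdFrame _ (water B)] using key
  · simp only [dY_comp_stdFrame hd, stdFrame_surf]
    refine surface_mul.neg.congr (Filter.Eventually.of_forall fun t => ?_)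
    simp only [Pi.neg_apply]
    ring
  · intro φ hφ hφc hφF
    set ψ : Plane → ℝ := fun x => φ (stdFrame.symm x) with hψdef
    have hsymm : ContDiff ℝ ∞ (stdFrame.symm : Plane → ℝ × ℝ) := by
      have : (stdFrame.symm : Plane → ℝ × ℝ) = fun x => (x 0, x 1) := by
        funext x
        obtain ⟨q, rfl⟩ := stdFrame.surjective x
        simp
      rw [this]
      fun_prop
    have hψ : ContDiff ℝ ∞ ψ := hφ.comp hsymm
    have hψc : HasCompactSupport ψ := hφc.comp_homeomorph stdFrame.symm
    have hφψ : ∀ q, φ q = ψ (stdFrame q) := fun q => by simp [hψdef]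
    have hgauss := integral_divergence_water hB (X := fun x => ψ x • gradient w x)
      (G := fun x => g x * ψ x) ((hψ.smul (contDiff_gradient hw)).of_le (by simp))
      hψc.smul_right (hg.mul hψ.continuous) (fun q hq n hn => by
        rw [real_inner_smul_left, inner_gradient, body q hq n hn, mul_comm])
    rw [setIntegral_stdFrame] at hgauss
    simp only [divergence_smul_gradient hw hψ, ← hφψ] at hgauss
    rw [hgauss]
    congr 1
    · congr 2
      funext t
      rw [dY_comp_stdFrame hd, stdFrame_surf, hφψ, stdFrame_surf, ← gradient_apply]
      simp [mul_comm]
    -- The boundary of the body lies in the box, where the test function coincides with `w`.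
    · refine setIntegral_congr_fun isClosed_frontier.measurableSet fun x hx => ?_
      obtain ⟨⟨s, t⟩, rfl⟩ := stdFrame.surjective x
      have hb := closure_body_subset hBL hBH (frontier_subset_closure hx)
      simp only [mem_ofPred_eq, stdFrame_zero, stdFrame_one] at hb
      change _ * ψ _ = _
      rw [← hφψ, hφF]
      · exact hb.1.trans ((le_max_left _ _).trans (by unfold boxRadius; linarith))
      · rw [abs_of_nonneg (hh.le.trans hb.2.1)]
        exact hb.2.2.trans ((le_max_right L _).trans (by unfold boxRadius; linarith))

end

/-! ### The right-hand side generated by the surface waves -/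

theorem hasFDerivAt_coord (i : Fin 2) (x : Plane) :
    HasFDerivAt (fun y : Plane => y i) (EuclideanSpace.proj i : Plane →L[ℝ] ℝ) x :=
  (EuclideanSpace.proj i : Plane →L[ℝ] ℝ).hasFDerivAt

theorem laplacian_mul_separated {a e : ℝ → ℂ} (ha : ContDiff ℝ ∞ a) (he : ContDiff ℝ ∞ e)
    (x : Plane) : (Δ fun y : Plane => a (y 0) * e (y 1)) x
      = deriv (deriv a) (x 0) * e (x 1) + a (x 0) * deriv (deriv e) (x 1) := by
  have h0 : ∀ {a e : ℝ → ℂ}, ContDiff ℝ ∞ a → ContDiff ℝ ∞ e → ∀ x : Plane,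
      fderiv ℝ (fun y : Plane => a (y 0) * e (y 1)) x (EuclideanSpace.single 0 1)
        = deriv a (x 0) * e (x 1) := by
    intro a e ha he x
    have h1 := ((ha.differentiable (by simp) (x 0)).hasFDerivAt).comp x (hasFDerivAt_coord 0 x)
    have h2 := ((he.differentiable (by simp) (x 1)).hasFDerivAt).comp x (hasFDerivAt_coord 1 x)
    have h3 := h1.mul h2
    have : (fun y : Plane => a (y 0) * e (y 1))
      = (a ∘ fun y : Plane => y 0) * (e ∘ fun y : Plane => y 1) := rfl
    rw [this, h3.fderiv]
    simp [mul_comm]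
  have h1 : ∀ {a e : ℝ → ℂ}, ContDiff ℝ ∞ a → ContDiff ℝ ∞ e → ∀ x : Plane,
      fderiv ℝ (fun y : Plane => a (y 0) * e (y 1)) x (EuclideanSpace.single 1 1)
        = a (x 0) * deriv e (x 1) := by
    intro a e ha he x
    have h1 := ((ha.differentiable (by simp) (x 0)).hasFDerivAt).comp x (hasFDerivAt_coord 0 x)
    have h2 := ((he.differentiable (by simp) (x 1)).hasFDerivAt).comp x (hasFDerivAt_coord 1 x)
    have h3 := h1.mul h2
    have : (fun y : Plane => a (y 0) * e (y 1))
      = (a ∘ fun y : Plane => y 0) * (e ∘ fun y : Plane => y 1) := rfl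
    rw [this, h3.fderiv]
    simp [mul_comm]
  have ha' := (contDiff_infty_iff_deriv.1 ha).2
  have he' := (contDiff_infty_iff_deriv.1 he).2
  have hs : ContDiff ℝ ∞ fun y : Plane => a (y 0) * e (y 1) :=
    (ha.comp (by fun_prop)).mul (he.comp (by fun_prop))
  rw [laplacian_eq_fderiv_fderiv hs]
  simp only [h0 ha he, h1 ha he]
  rw [h0 ha' he, h1 ha he']

section

variable {χ : ℝ → ℝ} {ν L H : ℝ}

/-- The horizontal profile of `d⁺U⁺ + d⁻U⁻`. -/
noncomputable def waveProfile (χ : ℝ → ℝ) (ν c : ℝ) (dp dm : ℂ) (s : ℝ) : ℂ :=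
  dp * ((χ (s * c) : ℂ) * Complex.exp (-Complex.I * ν * s))
    + dm * ((χ (-s * c) : ℂ) * Complex.exp (Complex.I * ν * s))

theorem contDiff_waveProfile (hχ : IsCutoff χ) (c : ℝ) (dp dm : ℂ) :
    ContDiff ℝ ∞ (waveProfile χ ν c dp dm) := by
  have h := hχ.1
  have hof : ContDiff ℝ ∞ (fun t : ℝ => (t : ℂ)) := Complex.ofRealCLM.contDiff
  have h1 : ContDiff ℝ ∞ fun s : ℝ => (χ (s * c) : ℂ) := hof.comp (h.comp (by fun_prop))
  have h2 : ContDiff ℝ ∞ fun s : ℝ => (χ (-s * c) : ℂ) := hof.comp (h.comp (by fun_prop))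
  have h3 : ContDiff ℝ ∞ fun s : ℝ => Complex.exp (-Complex.I * ν * s) :=
    (contDiff_const.mul hof).cexp
  have h4 : ContDiff ℝ ∞ fun s : ℝ => Complex.exp (Complex.I * ν * s) :=
    (contDiff_const.mul hof).cexp
  exact (contDiff_const.mul (h1.mul h3)).add (contDiff_const.mul (h2.mul h4))

theorem deriv_deriv_exp (z w : ℂ) (s : ℝ) :
    deriv (deriv fun s : ℝ => w * Complex.exp (z * s)) s = z ^ 2 * (w * Complex.exp (z * s)) := by
  have h : ∀ (w : ℂ) (s : ℝ), HasDerivAt (fun s : ℝ => w * Complex.exp (z * s))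
      ((z * w) * Complex.exp (z * s)) s := by
    intro w s
    have := ((hasDerivAt_id (s : ℂ)).const_mul z).cexp.comp_ofReal.const_mul w
    refine this.congr_deriv ?_
    simp
    ring
  have e : (deriv fun s : ℝ => w * Complex.exp (z * s))
      = fun s : ℝ => (z * w) * Complex.exp (z * s) := funext fun s => (h w s).deriv
  rw [e, (h _ s).deriv]
  ring

/-- Beyond `3/c` one cutoff is 1 and the other 0, so the profile is a pure exponential `e^{∓iνs}`.
-/
theorem waveProfile_residual_eq_zero (hχ : IsCutoff χ) {c : ℝ} (hc : 0 < c) (dp dm : ℂ) {s : ℝ}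
    (hs : 3 / c < |s|) :
    deriv (deriv (waveProfile χ ν c dp dm)) s + ν ^ 2 * waveProfile χ ν c dp dm s = 0 := by
  rcases lt_or_ge 0 s with h | h
  · rw [abs_of_pos h] at hs
    have e : waveProfile χ ν c dp dm =ᶠ[nhds s]
        fun s : ℝ => dp * Complex.exp (-Complex.I * ν * s) := by
      filter_upwards [Ioi_mem_nhds hs] with t ht
      have ht' : 3 < t * c := (div_lt_iff₀ hc).1 ht
      rw [waveProfile, hχ.2.2 _ ht', hχ.2.1 (-t * c) (by linarith)]
      simp
    rw [e.deriv.deriv_eq, deriv_deriv_exp, e.self_of_nhds]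
    have : (-Complex.I * ν) ^ 2 = -(ν : ℂ) ^ 2 := by
      rw [mul_pow, neg_sq, Complex.I_sq]; ring
    rw [this]
    ring
  · rw [abs_of_nonpos h] at hs
    have e : waveProfile χ ν c dp dm =ᶠ[nhds s]
        fun s : ℝ => dm * Complex.exp (Complex.I * ν * s) := by
      filter_upwards [Iio_mem_nhds (show s < -(3 / c) by linarith)] with t ht
      have ht' : 3 < -t * c := (div_lt_iff₀ hc).1 (by linarith [mem_Iio.1 ht])
      rw [waveProfile, hχ.2.2 _ ht', hχ.2.1 (t * c) (by linarith)]
      simp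
    rw [e.deriv.deriv_eq, deriv_deriv_exp, e.self_of_nhds]
    have : (Complex.I * ν) ^ 2 = -(ν : ℂ) ^ 2 := by
      rw [mul_pow, Complex.I_sq]; ring
    rw [this]
    ring

/-- Both waves share the vertical factor `e^{-νx₂}`, so the Laplacian acts on the profile `a` as
`a'' + ν²a`, which has compact support. -/
theorem exists_laplacian_waves (hν : 0 < ν) (hL : 0 < L) (hH : 0 < H) (hχ : IsCutoff χ)
    (dp dm : ℂ) : ∃ k : ℝ → ℂ, Continuous k ∧ HasCompactSupport k ∧ ∀ x : Plane,
      (Δ fun y : Plane => dp * Uplus χ ν L H y + dm * Uminus χ ν L H y) x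
        = k (x 0) * Complex.exp (-ν * x 1) := by
  set c := gammaOneSq ν L H with hc
  have hc0 : 0 < c := by rw [hc, gammaOneSq]; positivity
  have ha := contDiff_waveProfile (ν := ν) hχ c dp dm
  have hof : ContDiff ℝ ∞ (fun t : ℝ => (t : ℂ)) := Complex.ofRealCLM.contDiff
  have he : ContDiff ℝ ∞ fun t : ℝ => 1 * Complex.exp (-ν * t) :=
    contDiff_const.mul (contDiff_const.mul hof).cexp
  refine ⟨fun s => deriv (deriv (waveProfile χ ν c dp dm)) s + ν ^ 2 * waveProfile χ ν c dp dm s,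
    ?_, ?_, fun x => ?_⟩
  · have := (contDiff_infty_iff_deriv.1 (contDiff_infty_iff_deriv.1 ha).2).2.continuous
    have := ha.continuous
    fun_prop
  · refine HasCompactSupport.intro (isCompact_Icc (a := -(3 / c)) (b := 3 / c)) fun s hs => ?_
    refine waveProfile_residual_eq_zero hχ hc0 dp dm ?_
    by_contra! h
    exact hs (abs_le.1 h)
  · have e : (fun y : Plane => dp * Uplus χ ν L H y + dm * Uminus χ ν L H y)
        = fun y : Plane => waveProfile χ ν c dp dm (y 0)
          * (fun t : ℝ => 1 * Complex.exp (-ν * t)) (y 1) := by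
      funext y
      simp only [Uplus, Uminus, waveProfile, ← hc, sub_eq_add_neg, Complex.exp_add]
      simp only [neg_mul]
      ring
    rw [e, laplacian_mul_separated ha he, deriv_deriv_exp]
    ring

theorem memLp_weighted_wave (hν : 0 < ν) {k : ℝ → ℂ} (hk : Continuous k)
    (hkc : HasCompactSupport k) : MemLp (fun x : Plane => (‖x‖ : ℂ) *
      (k (x 0) * Complex.exp (-ν * x 1))) 2 (volume.restrict {x : Plane | 0 < x 1}) := by
  have h0 : Continuous fun x : Plane => x 0 := by fun_prop
  have h1 : Continuous fun x : Plane => x 1 := by fun_prop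
  have hcont : Continuous fun x : Plane => (‖x‖ : ℂ) * (k (x 0) * Complex.exp (-ν * x 1)) := by
    fun_prop
  rw [memLp_two_iff_integrable_sq_norm hcont.aestronglyMeasurable]
  have hpre : stdFrame ⁻¹' {x : Plane | 0 < x 1} = univ ×ˢ Ioi (0 : ℝ) := by
    ext q; simp
  refine (integrableOn_stdFrame (f := fun x => ‖(‖x‖ : ℂ) * (k (x 0) * Complex.exp (-ν * x 1))‖ ^ 2)).1 ?_
  rw [hpre]
  have hm : Integrable fun s : ℝ => (s ^ 2 + 4 / ν ^ 2) * ‖k s‖ ^ 2 := by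
    refine Continuous.integrable_of_hasCompactSupport (by fun_prop) ?_
    exact (hkc.comp_left (g := fun z : ℂ => ‖z‖ ^ 2) (by simp)).mul_left
  have he : IntegrableOn (fun t : ℝ => Real.exp (-ν * t)) (Ioi 0) :=
    integrableOn_exp_mul_Ioi (by linarith) 0
  have hp := hm.mul_prod he
  have hp' : IntegrableOn (fun q : ℝ × ℝ => (q.1 ^ 2 + 4 / ν ^ 2) * ‖k q.1‖ ^ 2
      * Real.exp (-ν * q.2)) (univ ×ˢ Ioi (0 : ℝ)) := by
    rw [IntegrableOn, Measure.volume_eq_prod, ← Measure.prod_restrict, Measure.restrict_univ]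
    exact hp
  refine Integrable.mono' hp' ?_ ?_
  · exact (((hcont.norm.pow 2).comp stdFrame.continuous)).aestronglyMeasurable
  · filter_upwards [ae_restrict_mem (MeasurableSet.univ.prod measurableSet_Ioi)] with q hq
    have hq2 : 0 < q.2 := hq.2
    rw [norm_pow, norm_norm, norm_mul, norm_mul, Complex.norm_real, norm_norm, mul_pow, mul_pow,
      norm_sq_stdFrame, stdFrame_zero, stdFrame_one, Complex.norm_exp]
    have e1 : (-(ν : ℂ) * (q.2 : ℂ)).re = -ν * q.2 := by simp
    rw [e1, ← Real.exp_nat_mul]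
    have e2 : Real.exp ((2 : ℕ) * (-ν * q.2)) = Real.exp (-ν * q.2) * Real.exp (-ν * q.2) := by
      rw [← Real.exp_add]; congr 1; push_cast; ring
    rw [e2]
    -- One of the two exponentials in the squared norm absorbs the weight, by `(t/2)² ≤ e^t` with `t
    -- = νy`; the other remains integrable in depth.
    have e3 : (q.1 ^ 2 + q.2 ^ 2) * Real.exp (-ν * q.2) ≤ q.1 ^ 2 + 4 / ν ^ 2 := by
      have b1 : Real.exp (-ν * q.2) ≤ 1 := Real.exp_le_one_iff.2 (by nlinarith)
      have b2 : q.2 ^ 2 * Real.exp (-ν * q.2) ≤ 4 / ν ^ 2 := by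
        rw [le_div_iff₀ (by positivity), neg_mul, Real.exp_neg]
        have b3 : ν * q.2 / 2 ≤ Real.exp (ν * q.2 / 2) := by
          linarith [Real.add_one_le_exp (ν * q.2 / 2)]
        have b4 : Real.exp (ν * q.2) = Real.exp (ν * q.2 / 2) ^ 2 := by
          rw [← Real.exp_nat_mul]; congr 1; push_cast; ring
        have b5 := pow_le_pow_left₀ (by positivity) b3 2
        rw [← b4] at b5
        have b6 := Real.exp_pos (ν * q.2)
        rw [← div_eq_mul_inv, div_mul_eq_mul_div, div_le_iff₀ b6]
        nlinarith
      nlinarith [sq_nonneg q.1]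
    have h3 : 0 ≤ ‖k q.1‖ ^ 2 * Real.exp (-ν * q.2) := by positivity
    nlinarith [mul_le_mul_of_nonneg_right e3 h3]

theorem memLp_weighted_fOne (hν : 0 < ν) (hL : 0 < L) (hH : 0 < H) (hχ : IsCutoff χ)
    (dp dm : ℂ) {B : Set Plane} {f : Plane → ℂ} (hf : Continuous f) (hfc : HasCompactSupport f) :
    MemLp (fun x => (‖x‖ : ℂ) * fOne χ ν L H dp dm f x) 2 (volume.restrict (water B)) := by
  obtain ⟨k, hk, hkc, hΔ⟩ := exists_laplacian_waves hν hL hH hχ dp dm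
  have h1 : MemLp (fun x => (‖x‖ : ℂ) * f x) 2 (volume.restrict (water B)) :=
    ((Continuous.memLp_of_hasCompactSupport (by fun_prop) hfc.mul_left)).restrict _
  have h2 := (memLp_weighted_wave hν hk hkc).mono_measure
    (Measure.restrict_mono (fun x hx => hx.1 : water B ⊆ {x : Plane | 0 < x 1}) le_rfl)
  refine (h1.add h2).ae_eq (Filter.Eventually.of_forall fun x => ?_)
  simp only [fOne, hΔ, Pi.add_apply, mul_add]

end

/-! ### Complex solutions -/

/-- A finite energy solution whose data have finite weighted norms. -/
structure WaveSolution (ν L h H : ℝ) (B : Set Plane) (f₁ g₁ : Plane → ℂ) (g₂ : ℝ → ℂ)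
    (v : Plane → ℂ) : Prop where
  ν_pos : 0 < ν
  L_pos : 0 < L
  h_pos : 0 < h
  H_pos : 0 < H
  body : IsSubmergedBody B
  subset_box : B ⊆ {x | |x 0| < L ∧ h < x 1}
  subset_strip : B ⊆ {x | x 1 < H}
  solution : IsSolution B ν f₁ g₁ g₂ v
  energy : FiniteEnergy B v
  weighted : MemLp (fun x => (‖x‖ : ℂ) * f₁ x) 2 (volume.restrict (water B))
  continuous_body : Continuous g₁
  continuous_surface : Continuous g₂
  compact_surface : HasCompactSupport g₂

section

variable {ν L h H : ℝ} {B : Set Plane} {f₁ g₁ : Plane → ℂ} {g₂ : ℝ → ℂ} {v : Plane → ℂ}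

theorem continuous_surf : Continuous surf := by
  have : surf = fun t => stdFrame (t, 0) := funext fun t => (stdFrame_surf t).symm
  rw [this]
  exact stdFrame.continuous.comp (by fun_prop)

theorem norm_surf (t : ℝ) : ‖surf t‖ = |t| := by
  have := norm_sq_stdFrame (t, 0)
  rw [stdFrame_surf] at this
  rw [← Real.sqrt_sq (norm_nonneg (surf t)), this, ← Real.sqrt_sq_eq_abs]
  simp

theorem fderiv_component (hv : ContDiff ℝ ∞ v) (ℓ : ℂ →L[ℝ] ℝ) (x e : Plane) :
    fderiv ℝ (fun x => ℓ (v x)) x e = ℓ (fderiv ℝ v x e) := by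
  have := ℓ.hasFDerivAt.comp x (hv.differentiable (by simp) x).hasFDerivAt
  exact congrArg (fun A => A e) this.fderiv

theorem laplacian_component (hv : ContDiff ℝ ∞ v) (ℓ : ℂ →L[ℝ] ℝ) (x : Plane) :
    (Δ fun x => ℓ (v x)) x = ℓ ((Δ v) x) :=
  (hv.of_le (WithTop.coe_le_coe.2 le_top) : ContDiff ℝ 2 v).contDiffAt.laplacian_CLM_comp_left

theorem integrable_sq_component {α : Type*} [MeasurableSpace α] {μ : Measure α} {u : α → ℂ}
    (hu : MemLp u 2 μ) {ℓ : ℂ →L[ℝ] ℝ} : Integrable (fun x => ℓ (u x) ^ 2) μ :=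
  (ℓ.comp_memLp' hu).integrable_sq

namespace WaveSolution

theorem neg_laplacian_component (hS : WaveSolution ν L h H B f₁ g₁ g₂ v) (ℓ : ℂ →L[ℝ] ℝ)
    {x : Plane} (hx : x ∈ water B) : -(Δ fun x => ℓ (v x)) x = ℓ (f₁ x) := by
  rw [laplacian_component hS.solution.smooth, ← map_neg, hS.solution.eq_water x hx]

theorem surface_component (hS : WaveSolution ν L h H B f₁ g₁ g₂ v) (ℓ : ℂ →L[ℝ] ℝ) (t : ℝ) :
    -ℓ (fderiv ℝ v (surf t) (EuclideanSpace.single 1 1)) - ν * ℓ (v (surf t)) = ℓ (g₂ t) := by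
  rw [← hS.solution.eq_surface t, pd, map_sub, map_neg,
    ← Complex.real_smul, map_smul, smul_eq_mul]

theorem integrableOn_weighted_component (hS : WaveSolution ν L h H B f₁ g₁ g₂ v)
    (ℓ : ℂ →L[ℝ] ℝ) : IntegrableOn (fun x => ‖x‖ ^ 2 * ℓ (f₁ x) ^ 2) (water B) := by
  have := integrable_sq_component hS.weighted (ℓ := ℓ)
  refine this.congr (Filter.Eventually.of_forall fun x => ?_)
  simp only
  rw [← Complex.real_smul, map_smul, smul_eq_mul, mul_pow]

theorem integrableOn_weighted_laplacian (hS : WaveSolution ν L h H B f₁ g₁ g₂ v)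
    (ℓ : ℂ →L[ℝ] ℝ) :
    IntegrableOn (fun x => ‖x‖ ^ 2 * (Δ fun x => ℓ (v x)) x ^ 2) (water B) := by
  refine (hS.integrableOn_weighted_component ℓ).congr_fun (fun x hx => ?_) measurableSet_water
  simp only
  rw [← hS.neg_laplacian_component ℓ hx, neg_sq]

theorem contDiff_component (hS : WaveSolution ν L h H B f₁ g₁ g₂ v) (ℓ : ℂ →L[ℝ] ℝ) :
    ContDiff ℝ ∞ fun x => ℓ (v x) := ℓ.contDiff.comp hS.solution.smooth

theorem integrable_surface (hS : WaveSolution ν L h H B f₁ g₁ g₂ v) {E : Type*}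
    [NormedAddCommGroup E] {k : ℝ → ℂ → E}
    (hk : Continuous fun q : ℝ × ℂ => k q.1 q.2) (h0 : ∀ t, k t 0 = 0) :
    Integrable fun t => k t (g₂ t) := by
  refine Continuous.integrable_of_hasCompactSupport
    (hk.comp (continuous_id.prodMk hS.continuous_surface)) ?_
  refine hS.compact_surface.mono' fun t ht => ?_
  refine subset_tsupport _ fun h => ht ?_
  simp only [h, h0]

theorem energyField (hS : WaveSolution ν L h H B f₁ g₁ g₂ v) (ℓ : ℂ →L[ℝ] ℝ) :
    EnergyField ν L h H (stdFrame ⁻¹' water B) fun q => ℓ (v (stdFrame q)) := by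
  refine energyField_of_real hS.L_pos hS.h_pos hS.H_pos hS.subset_box hS.subset_strip
    (hS.contDiff_component ℓ) (fun i => ?_) (integrable_sq_component hS.energy.trace_memLp)
    (hS.integrableOn_weighted_laplacian ℓ) ?_
  · simp only [fderiv_component hS.solution.smooth]
    exact integrable_sq_component (hS.energy.pd_memLp i)
  · simp only [fderiv_component hS.solution.smooth, hS.surface_component ℓ]
    exact hS.integrable_surface (k := fun t z => (t * ℓ z) ^ 2) (by fun_prop) (by simp)

/-- Two different functionals are allowed because `f₁ v̄` also contains products of real with
imaginary parts. -/
theorem integrableOn_component_mul (hS : WaveSolution ν L h H B f₁ g₁ g₂ v)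
    (ℓ₁ ℓ₂ : ℂ →L[ℝ] ℝ) : IntegrableOn (fun x => ℓ₁ (f₁ x) * ℓ₂ (v x)) (water B) := by
  have hsm := hS.contDiff_component ℓ₁
  -- No continuity of `f₁` is assumed; in the water it is replaced by `-Δv`, which is continuous on
  -- the whole plane.
  have hc : Continuous (Δ fun x => ℓ₁ (v x)) := by
    have : (Δ fun x => ℓ₁ (v x)) = fun x => _ := funext fun x => laplacian_eq_fderiv_fderiv hsm x
    rw [this]
    exact (contDiff_fderiv_apply_const (contDiff_fderiv_apply_const hsm _) _).continuous.add
      (contDiff_fderiv_apply_const (contDiff_fderiv_apply_const hsm _) _).continuous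
  have hw := integrableOn_stdFrame.2 (hS.integrableOn_weighted_laplacian ℓ₁)
  simp only [norm_sq_stdFrame] at hw
  have := (hS.energyField ℓ₂).integrableOn_mul (hc.comp stdFrame.continuous) hw
  have h2 := (integrableOn_stdFrame (f := fun x => (Δ fun x => ℓ₁ (v x)) x * ℓ₂ (v x))).1 this
  refine IntegrableOn.congr_fun h2.neg (fun x hx => ?_) measurableSet_water
  simp only [Pi.neg_apply]
  rw [← hS.neg_laplacian_component ℓ₁ hx, neg_mul]

theorem integrable_surface_mul (hS : WaveSolution ν L h H B f₁ g₁ g₂ v) (ℓ₁ ℓ₂ : ℂ →L[ℝ] ℝ) :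
    Integrable fun t => ℓ₁ (g₂ t) * ℓ₂ (v (surf t)) := by
  have := continuous_surf
  have := hS.solution.smooth.continuous
  exact hS.integrable_surface (k := fun t z => ℓ₁ z * ℓ₂ (v (surf t))) (by fun_prop) (by simp)

/-- The equation and the boundary conditions have real coefficients, so `ℓ ∘ v` solves the same
problem with data `ℓ ∘ f₁`, `ℓ ∘ g₁`, `ℓ ∘ g₂`, for every real-linear `ℓ`. -/
theorem component_estimate (hS : WaveSolution ν L h H B f₁ g₁ g₂ v) (ℓ : ℂ →L[ℝ] ℝ) :
    (∫ x in water B, ℓ (pd 0 v x) ^ 2) + (∫ x in water B, ℓ (pd 1 v x) ^ 2) ≤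
      4 * ((∫ x in water B, ℓ (f₁ x) * ℓ (v x)) + (∫ x in frontier B, ℓ (g₁ x) * ℓ (v x) ∂μH[1])
        + ∫ t, ℓ (g₂ t) * ℓ (v (surf t)))
      + 18 * ((∫ x in water B, ‖x‖ ^ 2 * ℓ (f₁ x) ^ 2) + ν * ∫ t, (t * ℓ (g₂ t)) ^ 2)
      + (72 * (ν * L ^ 2 / h) * (1 + ν * h) ^ 3 - 3) * ∫ x in water B, ℓ (pd 0 v x) ^ 2 := by
  have hv := hS.solution.smooth
  have hs : Integrable fun t => (t * ℓ (g₂ t)) ^ 2 :=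
    hS.integrable_surface (k := fun t z => (t * ℓ z) ^ 2) (by fun_prop) (by simp)
  have key := gradient_estimate_real hS.ν_pos hS.L_pos hS.h_pos hS.H_pos hS.body hS.subset_box
    hS.subset_strip (hS.contDiff_component ℓ) (g := fun x => ℓ (g₁ x))
    (ℓ.continuous.comp hS.continuous_body)
    (fun p hp n hn => by
      rw [fderiv_component hv, hS.solution.eq_body p hp n hn])
    (fun i => by
      simp only [fderiv_component hv]
      exact integrable_sq_component (hS.energy.pd_memLp i))
    (integrable_sq_component hS.energy.trace_memLp) (hS.integrableOn_weighted_laplacian ℓ)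
    ?_ ?_
  · simp only [hS.surface_component ℓ, fderiv_component hv] at key
    have e1 : ∫ x in water B, -(Δ fun x => ℓ (v x)) x * ℓ (v x)
        = ∫ x in water B, ℓ (f₁ x) * ℓ (v x) :=
      setIntegral_congr_fun measurableSet_water fun x hx => by
        rw [hS.neg_laplacian_component ℓ hx]
    have e2 : ∫ x in water B, ‖x‖ ^ 2 * (Δ fun x => ℓ (v x)) x ^ 2
        = ∫ x in water B, ‖x‖ ^ 2 * ℓ (f₁ x) ^ 2 :=
      setIntegral_congr_fun measurableSet_water fun x hx => by
        rw [← hS.neg_laplacian_component ℓ hx, neg_sq]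
    rw [e1, e2] at key
    exact key.2
  · simpa only [fderiv_component hv, hS.surface_component ℓ] using hs
  · simpa only [fderiv_component hv, hS.surface_component ℓ] using hS.integrable_surface_mul ℓ ℓ

theorem integrable_mul_star {α : Type*} [MeasurableSpace α] {μ : Measure α} {a b : α → ℂ}
    (hab : ∀ ℓ₁ ℓ₂ : ℂ →L[ℝ] ℝ, Integrable (fun x => ℓ₁ (a x) * ℓ₂ (b x)) μ) :
    Integrable (fun x => a x * star (b x)) μ := by
  have h1 := (hab Complex.reCLM Complex.reCLM).add (hab Complex.imCLM Complex.imCLM)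
  have h2 := (hab Complex.imCLM Complex.reCLM).sub (hab Complex.reCLM Complex.imCLM)
  refine (h1.ofReal (𝕜 := ℂ) |>.add (h2.ofReal (𝕜 := ℂ) |>.mul_const Complex.I)).congr
    (Filter.Eventually.of_forall fun x => ?_)
  apply Complex.ext
  · simp
  · simp
    ring

theorem re_integral_mul_star {α : Type*} [MeasurableSpace α] {μ : Measure α} {a b : α → ℂ}
    (hab : ∀ ℓ₁ ℓ₂ : ℂ →L[ℝ] ℝ, Integrable (fun x => ℓ₁ (a x) * ℓ₂ (b x)) μ) :
    (∫ x, a x * star (b x) ∂μ).re = (∫ x, Complex.reCLM (a x) * Complex.reCLM (b x) ∂μ)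
      + ∫ x, Complex.imCLM (a x) * Complex.imCLM (b x) ∂μ := by
  rw [← integral_add (hab _ _) (hab _ _)]
  have := Complex.reCLM.integral_comp_comm (integrable_mul_star hab)
  simp only [Complex.reCLM_apply] at this
  rw [← this]
  congr 1
  funext x
  simp

theorem integral_norm_sq {α : Type*} [MeasurableSpace α] {μ : Measure α} {u : α → ℂ}
    (hu : MemLp u 2 μ) : ∫ x, ‖u x‖ ^ 2 ∂μ
      = (∫ x, Complex.reCLM (u x) ^ 2 ∂μ) + ∫ x, Complex.imCLM (u x) ^ 2 ∂μ := by
  rw [← integral_add (integrable_sq_component hu) (integrable_sq_component hu)]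
  congr 1
  funext x
  rw [Complex.sq_norm, Complex.normSq_apply]
  simp [sq]

theorem integrable_body_mul (hS : WaveSolution ν L h H B f₁ g₁ g₂ v) (ℓ₁ ℓ₂ : ℂ →L[ℝ] ℝ) :
    IntegrableOn (fun x => ℓ₁ (g₁ x) * ℓ₂ (v x)) (frontier B) μH[1] := by
  have := hS.solution.smooth.continuous
  have := hS.continuous_body
  exact integrableOn_frontier hS.body (by fun_prop)

theorem memLp_weighted_surface (hS : WaveSolution ν L h H B f₁ g₁ g₂ v) :
    MemLp (fun t : ℝ => (‖surf t‖ : ℂ) * g₂ t) 2 volume := by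
  have := continuous_surf
  have := hS.continuous_surface
  exact Continuous.memLp_of_hasCompactSupport (by fun_prop) hS.compact_surface.mul_left

theorem integralsConverge (hS : WaveSolution ν L h H B f₁ g₁ g₂ v) :
    IntegralsConverge B f₁ g₁ g₂ v where
  water := integrable_mul_star hS.integrableOn_component_mul
  body := integrable_mul_star hS.integrable_body_mul
  surface := integrable_mul_star hS.integrable_surface_mul
  weighted_water := hS.weighted
  weighted_surface := hS.memLp_weighted_surface

theorem component_weighted_water (ℓ : ℂ →L[ℝ] ℝ) :
    ∫ x in water B, ℓ ((‖x‖ : ℂ) * f₁ x) ^ 2 = ∫ x in water B, ‖x‖ ^ 2 * ℓ (f₁ x) ^ 2 := by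
  congr 1
  funext x
  rw [← Complex.real_smul, map_smul, smul_eq_mul, mul_pow]

theorem component_weighted_surface (ℓ : ℂ →L[ℝ] ℝ) :
    ∫ t, ℓ ((‖surf t‖ : ℂ) * g₂ t) ^ 2 = ∫ t, (t * ℓ (g₂ t)) ^ 2 := by
  congr 1
  funext t
  rw [← Complex.real_smul, map_smul, smul_eq_mul, mul_pow, mul_pow, norm_surf, sq_abs]

theorem gradientEstimate (hS : WaveSolution ν L h H B f₁ g₁ g₂ v) :
    GradientEstimate B ν (72 * (ν * L ^ 2 / h) * (1 + ν * h) ^ 3) f₁ g₁ g₂ v := by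
  have hre := hS.component_estimate Complex.reCLM
  have him := hS.component_estimate Complex.imCLM
  unfold GradientEstimate
  rw [sqNormWater, sqNormWater, sqNormWater, sqNormSurface, integral_norm_sq (hS.energy.pd_memLp 0),
    integral_norm_sq (hS.energy.pd_memLp 1), integral_norm_sq hS.weighted,
    integral_norm_sq hS.memLp_weighted_surface, component_weighted_water, component_weighted_water,
    component_weighted_surface, component_weighted_surface, J, Complex.add_re, Complex.add_re,
    re_integral_mul_star hS.integrableOn_component_mul, re_integral_mul_star hS.integrable_body_mul,
    re_integral_mul_star hS.integrable_surface_mul]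
  -- The sum of the estimates for the real and imaginary parts; every term is a sum over the two
  -- components.
  linarith

theorem gradientEstimate_rePart (hS : WaveSolution ν L h H B f₁ g₁ g₂ v) :
    GradientEstimate B ν (72 * (ν * L ^ 2 / h) * (1 + ν * h) ^ 3)
      (rePart f₁) (rePart g₁) (rePart g₂) (rePart v) := by
  have hre := hS.component_estimate Complex.reCLM
  have hpd : ∀ i x, ‖pd i (rePart v) x‖ ^ 2 = Complex.reCLM (pd i v x) ^ 2 := by
    intro i x
    have h1 := Complex.ofRealCLM.hasFDerivAt.comp x
      (Complex.reCLM.hasFDerivAt.comp x (hS.solution.smooth.differentiable (by simp) x).hasFDerivAt)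
    have h2 : pd i (rePart v) x = ((pd i v x).re : ℂ) :=
      congrArg (fun A => A (EuclideanSpace.single i 1)) h1.fderiv
    rw [h2, Complex.norm_real, Real.norm_eq_abs, sq_abs, Complex.reCLM_apply]
  have hmul : ∀ {α : Type} [MeasurableSpace α] {μ : Measure α} (a b : α → ℂ),
      (∫ x, rePart a x * star (rePart b x) ∂μ).re
        = ∫ x, Complex.reCLM (a x) * Complex.reCLM (b x) ∂μ := by
    intro α _ μ a b
    have : (fun x => rePart a x * star (rePart b x))
        = fun x => ((Complex.reCLM (a x) * Complex.reCLM (b x) : ℝ) : ℂ) := by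
      funext x
      simp [rePart]
    rw [this, integral_complex_ofReal, Complex.ofReal_re]
  have hw : ∀ x, ‖(‖x‖ : ℂ) * rePart f₁ x‖ ^ 2 = ‖x‖ ^ 2 * Complex.reCLM (f₁ x) ^ 2 := fun x => by
    simp [rePart, mul_pow]
  have hs : ∀ t, ‖(‖surf t‖ : ℂ) * rePart g₂ t‖ ^ 2 = (t * Complex.reCLM (g₂ t)) ^ 2 := fun t => by
    simp [rePart, mul_pow, norm_surf]
  unfold GradientEstimate
  rw [sqNormWater, sqNormWater, sqNormWater, sqNormSurface, J, Complex.add_re, Complex.add_re]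
  have hsurf := hmul (μ := volume) g₂ fun t => v (surf t)
  have hsurf' : (∫ t, rePart g₂ t * star (rePart v (surf t))).re
      = ∫ t, Complex.reCLM (g₂ t) * Complex.reCLM (v (surf t)) := hsurf
  simp only [hpd, hw, hs, hmul, hsurf']
  exact hre

end WaveSolution

end

end WaterWaves

theorem lemma5p1 (ν L h H : ℝ) (hν : 0 < ν) (hL : 0 < L) (hh : 0 < h) (hH : 0 < H)
    (B : Set Plane) (hB : IsSubmergedBody B)
    (hBL : B ⊆ {x | |x 0| < L ∧ h < x 1}) (hBH : B ⊆ {x | x 1 < H})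
    (χ : ℝ → ℝ) (hχ : IsCutoff χ) (dp dm : ℂ)
    (f g₁ : Plane → ℂ) (g₂ : ℝ → ℂ) (hdata : IsData B f g₁ g₂)
    (v : Plane → ℂ) (hv : IsSolution B ν (fOne χ ν L H dp dm f) g₁ g₂ v)
    (hfin : FiniteEnergy B v) :
    IntegralsConverge B (fOne χ ν L H dp dm f) g₁ g₂ v ∧
    GradientEstimate B ν (72 * (ν * L ^ 2 / h) * (1 + ν * h) ^ 3)
      (fOne χ ν L H dp dm f) g₁ g₂ v ∧
    GradientEstimate B ν (72 * (ν * L ^ 2 / h) * (1 + ν * h) ^ 3)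
      (rePart (fOne χ ν L H dp dm f)) (rePart g₁) (rePart g₂) (rePart v) := by
  have hS : WaveSolution ν L h H B (fOne χ ν L H dp dm f) g₁ g₂ v :=
    { ν_pos := hν
      L_pos := hL
      h_pos := hh
      H_pos := hH
      body := hB
      subset_box := hBL
      subset_strip := hBH
      solution := hv
      energy := hfin
      weighted := memLp_weighted_fOne hν hL hH hχ dp dm hdata.f_smooth.continuous hdata.f_compact
      continuous_body := hdata.g₁_smooth.continuous
      continuous_surface := hdata.g₂_smooth.continuous
      compact_surface := hdata.g₂_compact }
  exact ⟨hS.integralsConverge, hS.gradientEstimate, hS.gradientEstimate_rePart⟩
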